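/- Let $n\ge 1$, let $S^n\subset\mathbb R^{n+1}$ be the unit sphere, $\mathbb{RP}^n=S^n/\{\pm1\}$, and let $g_0$ be the standard round metric on $\mathbb{RP}^n$ (the one for which $S^n\to\mathbb{RP}^n$ is a local isometry). For a nonnegative function $\bar f\in L^n(\mathbb{RP}^n,g_0)$ (possibly taking the value $+\infty$) consider the singular Riemannian metric $g=\bar f^2g_0$, with volume $\operatorname{vol}(\mathbb{RP}^n,g)=\int_{\mathbb{RP}^n}\bar f^{\,n}\,dg_0$ and systole $\operatorname{sys}(\mathbb{RP}^n,g)=\inf_\gamma\int_0^1\bar f(\gamma(t))\,|\gamma'(t)|_{g_0}\,dt$, where $\gamma$ runs over the noncontractible (piecewise) $C^1$ loops $\gamma:[0,1]\to\mathbb{RP}^n$. If $\operatorname{sys}(\mathbb{RP}^n,g)\neq0$, then $$\frac{\operatorname{vol}(\mathbb{RP}^n,g)}{\operatorname{sys}(\mathbb{RP}^n,g)^n}\ \ge\ \frac{\operatorname{vol}(\mathbb{RP}^n,g_0)}{\operatorname{sys}(\mathbb{RP}^n,g_0)^n}.$$ Furthermore, let $n=2$, let $\mu$ be a finite signed Borel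 measure on $S^2$ with $\mu(S^2)=0$, and let $$u(x)=\int_{S^2}G(x,y)\,d\mu(y),\qquad G(x,y)=-\frac1{2\pi}\log\frac{|x-y|}{2}-\frac1{4\pi},\quad G(x,x)=+\infty,$$ be its potential with respect to the Green function $G$ of the round sphere (so that $\mu=\Delta_{g_0}u$ in the distribution sense, with the nonnegative Laplacian). Suppose that $g=\bar f^2g_0$ is as above, with $\bar f\in L^2$ and nonzero systole, and that the lift of $\bar f$ to $S^2$ equals $e^u$ at every point at which the integral defining $u$ makes sense in $[-\infty,+\infty]$. Then equality $$\frac{\operatorname{vol}(\mathbb{RP}^2,g)}{\operatorname{sys}(\mathbb{RP}^2,g)^2}=\frac{\operatorname{vol}(\mathbb{RP}^2,g_0)}{\operatorname{sys}(\mathbb{RP}^2,g_0)^2}$$ holds if and only if $g$ has constant Gaussian curvature, that is, there is a constant $K\in\mathbb R$ such that the curvature measure $\omega=dg_0+\mu$ of $g$ (lifted to $S^2$) equals $K$ times the area measure $e^{2u}\,dg_0$ of $g$. -/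

import Mathlib

open MeasureTheory Set
open scoped ENNReal

noncomputable section

namespace PuInequality

/-- The unit sphere `Sⁿ` in `ℝⁿ⁺¹`. -/
abbrev Sph (n : ℕ) : Type := Metric.sphere (0 : EuclideanSpace ℝ (Fin (n + 1))) 1

/-- Two points of the sphere are identified when they are equal or antipodal. -/
def antipodalSetoid (n : ℕ) : Setoid (Sph n) where
  r x y := x = y ∨ x = -y
  iseqv :=
    { refl := fun _ => Or.inl rfl
      symm := by
        rintro x y (h | h)
        · exact Or.inl h.symm
        · exact Or.inr (by rw [h, neg_neg])
      trans := by
        rintro x y z (h | h) (h' | h')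
        · exact Or.inl (h.trans h')
        · exact Or.inr (h.trans h')
        · exact Or.inr (by rw [h, h'])
        · exact Or.inl (by rw [h, h', neg_neg]) }

/-- Real projective space `ℝPⁿ = Sⁿ/±1`, with the quotient topology and the quotient σ-algebra
(which are Mathlib's instances for quotients). -/
abbrev RP (n : ℕ) : Type := Quotient (antipodalSetoid n)

/-- The double covering `Sⁿ → ℝPⁿ`. -/
def proj {n : ℕ} (x : Sph n) : RP n := Quotient.mk (antipodalSetoid n) x

/-- The Riemannian volume measure of the round unit sphere `Sⁿ`. -/
def sphVol (n : ℕ) : Measure (Sph n) :=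
  (volume : Measure (EuclideanSpace ℝ (Fin (n + 1)))).toSphere

/-- The Riemannian volume measure of the round metric `g₀` on `ℝPⁿ`, for which the double
covering `Sⁿ → ℝPⁿ` is a local isometry: half of the image of the volume measure of `Sⁿ`. -/
def rpVol (n : ℕ) : Measure (RP n) := (2⁻¹ : ℝ≥0∞) • (sphVol n).map proj

/-- A `C¹` loop in `ℝPⁿ`: a loop together with a lift to `Sⁿ` (every path in `ℝPⁿ` has exactly
two lifts, which are antipodal to each other) that is of class `C¹` on `[0, 1]`. The velocity may
vanish and need not match at the end points, so that, up to reparametrization, all piecewise `C¹`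
loops are of this form. The values of `lift` outside `[0, 1]` play no role. -/
structure C1Loop (n : ℕ) where
  base : RP n
  loop : Path base base
  lift : ℝ → Sph n
  contDiffOn_lift : ContDiffOn ℝ 1 (fun t => (lift t : EuclideanSpace ℝ (Fin (n + 1)))) (Icc 0 1)
  proj_lift : ∀ t : unitInterval, proj (lift t) = loop t

/-- A loop is contractible if it is homotopic to the constant loop. -/
def C1Loop.Contractible {n : ℕ} (γ : C1Loop n) : Prop :=
  γ.loop.Homotopic (Path.refl γ.base)

/-- The length `∫₀¹ f(γ(t)) |γ'(t)| dt` of a loop for the singular metric `g = f² g₀` on `ℝPⁿ`.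
The speed for `g₀` is computed on the lift. For a Borel function `f` the integrand is measurable. -/
def C1Loop.length {n : ℕ} (γ : C1Loop n) (f : RP n → ℝ≥0∞) : ℝ≥0∞ :=
  ∫⁻ t in Icc (0 : ℝ) 1, f (proj (γ.lift t)) *
    ‖derivWithin (fun s => (γ.lift s : EuclideanSpace ℝ (Fin (n + 1)))) (Icc 0 1) t‖ₑ

/-- The systole of `(ℝPⁿ, f² g₀)`: the infimum of the lengths of the noncontractible loops. -/
def sys {n : ℕ} (f : RP n → ℝ≥0∞) : ℝ≥0∞ :=
  ⨅ (γ : C1Loop n) (_ : ¬ γ.Contractible), γ.length f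

/-- The volume of `(ℝPⁿ, f² g₀)`. -/
def vol {n : ℕ} (f : RP n → ℝ≥0∞) : ℝ≥0∞ := ∫⁻ p, f p ^ n ∂(rpVol n)

/-- The conformal factor of the round metric `g₀` itself. -/
def roundFactor (n : ℕ) : RP n → ℝ≥0∞ := fun _ => 1

/-- The Green function of the (nonnegative) Laplacian of the round unit sphere `S²`, normalized to
have mean zero: `G(x, y) = -(1/2π) log (|x - y|/2) - 1/(4π)`, where `|x - y|` is the Euclidean
distance in `ℝ³`, and `G(x, x) = +∞`. It satisfies `Δ G(x, ·) = δₓ - 1/(4π)`. -/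
def green (x y : Sph 2) : EReal :=
  open Classical in
  if x = y then ⊤
  else ((-(1 / (2 * Real.pi)) * Real.log (dist x y / 2) - 1 / (4 * Real.pi) : ℝ) : EReal)

/-- The positive part of the integral `∫ G(x, y) dμ(y)`. -/
def potentialPos (μ : SignedMeasure (Sph 2)) (x : Sph 2) : ℝ≥0∞ :=
  ∫⁻ y, (green x y).toENNReal ∂μ.toJordanDecomposition.posPart +
    ∫⁻ y, (-green x y).toENNReal ∂μ.toJordanDecomposition.negPart

/-- The negative part of the integral `∫ G(x, y) dμ(y)`. -/
def potentialNeg (μ : SignedMeasure (Sph 2)) (x : Sph 2) : ℝ≥0∞ :=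
  ∫⁻ y, (-green x y).toENNReal ∂μ.toJordanDecomposition.posPart +
    ∫⁻ y, (green x y).toENNReal ∂μ.toJordanDecomposition.negPart

/-- The integral `∫ G(x, y) dμ(y)` is defined, as an element of `[-∞, +∞]`. -/
def PotentialDefinedAt (μ : SignedMeasure (Sph 2)) (x : Sph 2) : Prop :=
  potentialPos μ x ≠ ⊤ ∨ potentialNeg μ x ≠ ⊤

/-- The potential `u(x) = ∫ G(x, y) dμ(y)`, meaningful where `PotentialDefinedAt μ x` holds. -/
def potential (μ : SignedMeasure (Sph 2)) (x : Sph 2) : EReal :=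
  (potentialPos μ x : EReal) - (potentialNeg μ x : EReal)

/-- The lift of `f` to `S²` is `e^u`, where `u` is the potential of `μ`, at every point at which
the integral defining `u` makes sense. -/
def IsExpPotential (f : RP 2 → ℝ≥0∞) (μ : SignedMeasure (Sph 2)) : Prop :=
  ∀ x : Sph 2, PotentialDefinedAt μ x → f (proj x) = (potential μ x).exp

/-- The curvature measure `ω = dg₀ + μ` (on the double cover `S²`) of the singular metric
`e^{2u} g₀`, where `u` is the potential of `μ`, evaluated on a set. For smooth `u` this is
`K dA = (1 + Δ u) dg₀`, with the nonnegative Laplacian `Δ`. -/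
def curvatureMeasure (μ : SignedMeasure (Sph 2)) (s : Set (Sph 2)) : ℝ :=
  (sphVol 2).real s + μ s

/-- The area, for the lift of `f² g₀` to `S²`, of a subset of `S²`. -/
def liftedArea (f : RP 2 → ℝ≥0∞) (s : Set (Sph 2)) : ℝ≥0∞ :=
  ∫⁻ x in s, f (proj x) ^ 2 ∂(sphVol 2)

/-- The metric `f² g₀`, where the lift of `f` is `e^u` and `u` is the potential of `μ`, has
constant Gaussian curvature: for some real constant `K`, its curvature measure is `K` times its
area measure. -/
def HasConstantCurvature (f : RP 2 → ℝ≥0∞) (μ : SignedMeasure (Sph 2)) : Prop :=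
  ∃ K : ℝ, ∀ s : Set (Sph 2), MeasurableSet s →
    curvatureMeasure μ s = K * (liftedArea f s).toReal

end PuInequality

end

open PuInequality

/-!
The images of a great circle under the orthogonal group project to noncontractible loops, so the
systole is at most the average of their lengths. By invariance of the Haar measure this average is
`π` times the mean of `f`, and Jensen's inequality bounds the mean by the volume. In dimension at
least two, equality in Jensen's inequality forces `f` to be constant almost everywhere. For
`f = e ^ u` the potential of `μ` is then constant. The kernel
`-log (1 - ⟨x, y⟩) = ∑ ⟨x, y⟩ ^ (j + 1) / (j + 1)` is positive definite and commutes with the zonal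
kernels `⟨x, y⟩ ^ k`, so a logarithmic potential determines the moments of a measure up to its total
mass; hence `μ = 0`.

If the curvature is constant, `u` solves the Liouville equation in integrated form and is even. A
bootstrap from `L¹` density to bounded density shows that `u` is continuous. In the Mercator
coordinate the metric is conformal to a flat cylinder, and the method of moving planes applies to
the circles `t = a`: the reflection inequality can only stop being strict at `a = 0`, since a
solution that is symmetric about a circle `t = a` with `a > 0` and even would be periodic in `t`.
Thus `u` is symmetric about the equator. The equator is arbitrary, so `u` is constant.
-/

open scoped Pointwise

noncomputable section

namespace PuInequality

/-- The Euclidean space `ℝⁿ⁺¹` containing `Sⁿ`. -/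
abbrev Ambient (n : ℕ) : Type := EuclideanSpace ℝ (Fin (n + 1))

/-- The restriction of a linear isometry of `ℝⁿ⁺¹` to `Sⁿ`. -/
def sphMap {n : ℕ} (A : Ambient n ≃ₗᵢ[ℝ] Ambient n) (x : Sph n) : Sph n :=
  ⟨A x, by simp⟩

section Isometries

variable {n : ℕ}

@[simp]
theorem coe_sphMap (A : Ambient n ≃ₗᵢ[ℝ] Ambient n) (x : Sph n) :
    (sphMap A x : Ambient n) = A x := rfl

theorem continuous_sphMap (A : Ambient n ≃ₗᵢ[ℝ] Ambient n) : Continuous (sphMap A) :=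
  (A.continuous.comp continuous_subtype_val).subtype_mk _

theorem sphMap_neg (A : Ambient n ≃ₗᵢ[ℝ] Ambient n) (x : Sph n) :
    sphMap A (-x) = -sphMap A x := by
  ext1; simp

@[simp]
theorem sphMap_sphMap_symm (A : Ambient n ≃ₗᵢ[ℝ] Ambient n) (x : Sph n) :
    sphMap A (sphMap A.symm x) = x := by
  ext1; simp

theorem inner_sphMap (A : Ambient n ≃ₗᵢ[ℝ] Ambient n) (x y : Sph n) :
    inner ℝ (sphMap A x : Ambient n) (sphMap A y) = inner ℝ (x : Ambient n) y := by
  simp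

theorem exists_sphMap_swap (x y : Sph n) :
    ∃ A : Ambient n ≃ₗᵢ[ℝ] Ambient n, sphMap A x = y ∧ sphMap A y = x := by
  set A := (ℝ ∙ ((x : Ambient n) - y))ᗮ.reflection
  have hxy : A x = y := Submodule.reflection_sub (by simp)
  have hyx : A y = x := by rw [← hxy, Submodule.reflection_reflection]
  exact ⟨A, Subtype.ext hxy, Subtype.ext hyx⟩

theorem exists_sphMap_eq (x y : Sph n) : ∃ A : Ambient n ≃ₗᵢ[ℝ] Ambient n, sphMap A x = y :=
  (exists_sphMap_swap x y).imp fun _ => And.left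

instance : IsFiniteMeasure (sphVol n) := by unfold sphVol; infer_instance

instance : (sphVol n).IsOpenPosMeasure := by unfold sphVol; infer_instance

instance : NeZero (sphVol n) :=
  ⟨fun h => (Metric.measure_ball_pos volume (0 : Ambient n) one_pos).ne' (by
    simpa [sphVol] using congrArg (· univ) h)⟩

theorem measurePreserving_sphMap (A : Ambient n ≃ₗᵢ[ℝ] Ambient n) :
    MeasurePreserving (sphMap A) (sphVol n) (sphVol n) := by
  have hA := (continuous_sphMap A).measurable
  refine ⟨hA, Measure.ext fun s hs => ?_⟩
  have cone_preimage : Ioo (0 : ℝ) 1 • (((↑) : Sph n → Ambient n) '' (sphMap A ⁻¹' s)) =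
      A ⁻¹' (Ioo (0 : ℝ) 1 • (((↑) : Sph n → Ambient n) '' s)) := by
    ext v
    constructor
    · rintro ⟨r, hr, _, ⟨x, hx, rfl⟩, rfl⟩
      exact ⟨r, hr, _, ⟨_, hx, rfl⟩, by simp⟩
    · rintro ⟨r, hr, _, ⟨x, hx, rfl⟩, h⟩
      exact ⟨r, hr, _, ⟨sphMap A.symm x, by simpa using hx, rfl⟩, A.injective (by simpa using h)⟩
  rw [Measure.map_apply hA hs, sphVol, Measure.toSphere_apply' _ hs,
    Measure.toSphere_apply' _ (hA hs), cone_preimage]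
  congr 1
  exact A.measurePreserving.measure_preimage_equiv (f := A.toHomeomorph.toMeasurableEquiv) _

end Isometries

section Averaging

theorem measurePreserving_inv_smul {G X : Type*} [Group G] [MeasurableSpace G] [MeasurableMul G]
    [MeasurableInv G] [MeasurableSpace X] [MulAction G X] [MeasurableSMul₂ G X]
    [MulAction.IsPretransitive G X] (P : Measure G) [IsProbabilityMeasure P]
    [P.IsMulLeftInvariant] (ν : Measure X) [IsFiniteMeasure ν] [NeZero ν]
    [SMulInvariantMeasure G X ν] (x : X) :
    MeasurePreserving (fun g : G => g⁻¹ • x) P ((ν univ)⁻¹ • ν) := by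
  have hmeas : Measurable fun p : G × X => p.1⁻¹ • p.2 := by fun_prop
  refine ⟨by fun_prop, Measure.ext fun s hs => ?_⟩
  have hs1 : Measurable (s.indicator (1 : X → ℝ≥0∞)) := measurable_one.indicator hs
  set I : X → ℝ≥0∞ := fun y => ∫⁻ g, s.indicator 1 (g⁻¹ • y) ∂P with hI
  have I_const (y : X) : I y = I x := by
    obtain ⟨h, rfl⟩ := MulAction.exists_smul_eq G x y
    calc I (h • x) = ∫⁻ g, s.indicator 1 ((h * g)⁻¹ • h • x) ∂P :=
          (lintegral_mul_left_eq_self (fun g => s.indicator 1 (g⁻¹ • h • x)) h).symm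
      _ = I x := by simp [hI, smul_smul]
  have integral_I : ∫⁻ y, I y ∂ν = ν s := by
    rw [lintegral_lintegral_swap (by exact (hs1.comp (hmeas.comp measurable_swap)).aemeasurable)]
    have (g : G) : ∫⁻ y, s.indicator 1 (g⁻¹ • y) ∂ν = ν s := by
      rw [(measurePreserving_smul g⁻¹ ν).lintegral_comp hs1, lintegral_indicator_one hs]
    simp [this]
  have map_apply_eq : P.map (fun g => g⁻¹ • x) s = I x := by
    rw [← lintegral_indicator_one hs, lintegral_map hs1 (by fun_prop)]
  rw [map_apply_eq, Measure.smul_apply, ← integral_I]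
  simp only [I_const, lintegral_const, smul_eq_mul]
  rw [mul_comm, mul_assoc, ENNReal.mul_inv_cancel (NeZero.ne _) (measure_ne_top ν _), mul_one]

theorem measurePreserving_inv_smul_prod {G X T : Type*} [Group G] [MeasurableSpace G]
    [MeasurableMul G] [MeasurableInv G] [MeasurableSpace X] [MulAction G X] [MeasurableSMul₂ G X]
    [MulAction.IsPretransitive G X] [MeasurableSpace T] (P : Measure G) [IsProbabilityMeasure P]
    [P.IsMulLeftInvariant] (ν : Measure X) [IsFiniteMeasure ν] [NeZero ν]
    [SMulInvariantMeasure G X ν] (τ : Measure T) [IsProbabilityMeasure τ] {c : T → X}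
    (hc : Measurable c) :
    MeasurePreserving (fun p : G × T => p.1⁻¹ • c p.2) (P.prod τ) ((ν univ)⁻¹ • ν) := by
  have hmeas : Measurable fun p : G × T => p.1⁻¹ • c p.2 := by fun_prop
  refine ⟨hmeas, Measure.ext fun s hs => ?_⟩
  have fiber (t : T) : P ((fun g => (g, t)) ⁻¹' ((fun p : G × T => p.1⁻¹ • c p.2) ⁻¹' s)) =
      ((ν univ)⁻¹ • ν) s :=
    (measurePreserving_inv_smul P ν (c t)).measure_preimage hs.nullMeasurableSet
  rw [Measure.map_apply hmeas hs, Measure.prod_apply_symm (hmeas hs)]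
  simp only [fiber, lintegral_const, measure_univ, mul_one]

/-- The orthogonal group of `ℝⁿ⁺¹`, realized inside the continuous linear maps, from which it
inherits its topology. -/
abbrev OrthogonalGroup (n : ℕ) : Type := unitary (Ambient n →L[ℝ] Ambient n)

variable {n : ℕ}

instance : ContinuousStar (Ambient n →L[ℝ] Ambient n) :=
  ⟨(ContinuousLinearMap.adjoint (𝕜 := ℝ) (E := Ambient n) (F := Ambient n)).continuous⟩

instance : CompactSpace (OrthogonalGroup n) := by
  refine isCompact_iff_compactSpace.mp (Metric.isCompact_of_isClosed_isBounded
    (isClosed_unitary (R := Ambient n →L[ℝ] Ambient n))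
    ((Metric.isBounded_closedBall (x := 0) (r := 1)).subset fun U hU => ?_))
  rw [mem_closedBall_zero_iff]
  refine ContinuousLinearMap.opNorm_le_bound _ zero_le_one fun v => ?_
  rw [one_mul]
  exact ((Unitary.linearIsometryEquiv ⟨U, hU⟩).norm_map v).le

instance : SecondCountableTopology (OrthogonalGroup n) :=
  have := secondCountable_of_proper (α := Ambient n →L[ℝ] Ambient n)
  TopologicalSpace.Subtype.secondCountableTopology _

instance : MulAction (OrthogonalGroup n) (Sph n) where
  smul U x := sphMap (Unitary.linearIsometryEquiv U) x
  one_smul _ := rfl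
  mul_smul _ _ _ := rfl

theorem orthogonalGroup_smul_eq (U : OrthogonalGroup n) (x : Sph n) :
    U • x = sphMap (Unitary.linearIsometryEquiv U) x := rfl

instance : ContinuousSMul (OrthogonalGroup n) (Sph n) :=
  ⟨((continuous_subtype_val.comp continuous_fst).clm_apply
    (continuous_subtype_val.comp continuous_snd)).subtype_mk _⟩

instance : MulAction.IsPretransitive (OrthogonalGroup n) (Sph n) where
  exists_smul_eq x y :=
    (exists_sphMap_eq x y).imp' Unitary.linearIsometryEquiv.symm fun A hA => by
      rw [orthogonalGroup_smul_eq, MulEquiv.apply_symm_apply, hA]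

instance : SMulInvariantMeasure (OrthogonalGroup n) (Sph n) (sphVol n) where
  measure_preimage_smul U _ hs :=
    (measurePreserving_sphMap (Unitary.linearIsometryEquiv U)).measure_preimage hs.nullMeasurableSet

/-- The Haar probability measure of the orthogonal group. -/
def orthogonalHaar (n : ℕ) : Measure (OrthogonalGroup n) := Measure.haarMeasure ⊤

instance : IsProbabilityMeasure (orthogonalHaar n) :=
  ⟨Measure.haarMeasure_self (K₀ := (⊤ : TopologicalSpace.PositiveCompacts (OrthogonalGroup n)))⟩

instance : (orthogonalHaar n).IsMulLeftInvariant := by unfold orthogonalHaar; infer_instance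

end Averaging

section Covering

variable {n : ℕ}

theorem proj_eq_proj_iff {x y : Sph n} : proj x = proj y ↔ x = y ∨ x = -y :=
  Quotient.eq (r := antipodalSetoid n)

@[simp]
theorem proj_neg (x : Sph n) : proj (-x) = proj x :=
  proj_eq_proj_iff.mpr (Or.inr rfl)

theorem isQuotientMap_proj : Topology.IsQuotientMap (proj : Sph n → RP n) :=
  isQuotientMap_quot_mk

theorem continuous_proj : Continuous (proj : Sph n → RP n) := isQuotientMap_proj.continuous

theorem measurable_proj : Measurable (proj : Sph n → RP n) :=
  measurable_quot_mk (r := (antipodalSetoid n).r)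

instance : MulAction ℤˣ (Sph n) where
  smul s x := ⟨s • (x : Ambient n), by
    rcases Int.units_eq_one_or s with rfl | rfl <;> simp⟩
  one_smul x := Subtype.ext (one_smul ℤˣ (x : Ambient n))
  mul_smul s t x := Subtype.ext (mul_smul s t (x : Ambient n))

theorem neg_one_units_smul (x : Sph n) : (-1 : ℤˣ) • x = -x :=
  Subtype.ext (by change (-1 : ℤˣ) • (x : Ambient n) = -x; simp)

instance : ContinuousConstSMul ℤˣ (Sph n) where
  continuous_const_smul s := by
    rcases Int.units_eq_one_or s with rfl | rfl
    · simpa only [one_smul] using continuous_id'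
    · simpa only [neg_one_units_smul] using continuous_neg

instance : IsCancelSMul ℤˣ (Sph n) where
  right_cancel' s t x h := by
    have hx := ne_neg_of_mem_unit_sphere ℝ x
    rcases Int.units_eq_one_or s with rfl | rfl <;> rcases Int.units_eq_one_or t with rfl | rfl <;>
      simp_all [neg_one_units_smul, eq_comm]

theorem isCoveringMap_proj : IsCoveringMap (proj : Sph n → RP n) := by
  refine (isQuotientMap_proj.isQuotientCoveringMap_of_properlyDiscontinuousSMul (G := ℤˣ)
    fun {x y} => ?_).isCoveringMap
  rw [proj_eq_proj_iff, MulAction.mem_orbit_iff]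
  refine ⟨?_, fun ⟨s, hs⟩ => ?_⟩
  · rintro (rfl | rfl)
    exacts [⟨1, one_smul _ _⟩, ⟨-1, neg_one_units_smul _⟩]
  · rcases Int.units_eq_one_or s with rfl | rfl <;> simp_all [neg_one_units_smul]

end Covering

section Loops

variable {n : ℕ}

theorem simplyConnectedSpace_compl_singleton (x : Sph n) :
    SimplyConnectedSpace ({x}ᶜ : Set (Sph n)) := by
  have : Fact (Module.finrank ℝ (Ambient n) = n + 1) := ⟨finrank_euclideanSpace_fin⟩
  let e : ({x}ᶜ : Set (Sph n)) ≃ₜ EuclideanSpace ℝ (Fin n) :=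
    (Homeomorph.setCongr (stereographic'_source x).symm).trans <|
      (stereographic' n x).toHomeomorphSourceTarget.trans <|
        (Homeomorph.setCongr (stereographic'_target x)).trans (Homeomorph.Set.univ _)
  have := e.contractibleSpace
  infer_instance

theorem homotopic_refl_of_forall_ne {x y : Sph n} {p : Path x x} (hp : ∀ t, p t ≠ y) :
    p.Homotopic (Path.refl x) := by
  have := simplyConnectedSpace_compl_singleton y
  have hx : x ≠ y := by simpa using hp 0
  let q : Path (⟨x, hx⟩ : ({y}ᶜ : Set (Sph n))) ⟨x, hx⟩ :=
    { toFun := fun t => ⟨p t, hp t⟩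
      continuous_toFun := p.continuous.subtype_mk _
      source' := by simp
      target' := by simp }
  exact (SimplyConnectedSpace.paths_homotopic q (Path.refl _)).map
    ⟨Subtype.val, continuous_subtype_val⟩

namespace C1Loop

theorem continuousOn_lift (γ : C1Loop n) : ContinuousOn γ.lift (Icc 0 1) :=
  Topology.IsInducing.subtypeVal.continuousOn_iff.mpr γ.contDiffOn_lift.continuousOn

/-- The lift of a loop as a continuous map on the unit interval. -/
def liftMap (γ : C1Loop n) : C(unitInterval, Sph n) where
  toFun t := γ.lift t
  continuous_toFun := continuousOn_iff_continuous_domRestrict.mp γ.continuousOn_lift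

theorem proj_lift_zero (γ : C1Loop n) : proj (γ.lift 0) = γ.base := by
  simpa using γ.proj_lift 0

theorem proj_lift_one (γ : C1Loop n) : proj (γ.lift 1) = γ.base := by
  simpa using γ.proj_lift 1

theorem not_contractible_of_lift_one (γ : C1Loop n) (h : γ.lift 1 = -γ.lift 0) :
    ¬ γ.Contractible := by
  intro hγ
  have hbase (p : Path γ.base γ.base) :
      (p : C(unitInterval, RP n)) 0 = proj (γ.lift 0) := by simp [γ.proj_lift_zero]
  have lift_loop : γ.liftMap = isCoveringMap_proj.liftPath _ _ (hbase γ.loop) :=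
    (isCoveringMap_proj.eq_liftPath_iff' _).mpr ⟨funext γ.proj_lift, rfl⟩
  have lift_refl : ContinuousMap.const unitInterval (γ.lift 0) =
      isCoveringMap_proj.liftPath _ _ (hbase (Path.refl _)) :=
    (isCoveringMap_proj.eq_liftPath_iff' _).mpr ⟨by ext; simp [γ.proj_lift_zero], rfl⟩
  have homotopic : (γ.loop : C(unitInterval, RP n)).HomotopicRel (Path.refl γ.base) {0, 1} := hγ
  have lifts_end_at_same_point :=
    isCoveringMap_proj.liftPath_apply_one_eq_of_homotopicRel homotopic _ (hbase _) (hbase _)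
  rw [← lift_loop, ← lift_refl] at lifts_end_at_same_point
  exact ne_neg_of_mem_unit_sphere ℝ _ (lifts_end_at_same_point.symm.trans h)

theorem contractible_of_lift_ne (γ : C1Loop n) {y : Sph n} (hclosed : γ.lift 1 = γ.lift 0)
    (h : ∀ t ∈ Icc (0 : ℝ) 1, γ.lift t ≠ y) : γ.Contractible := by
  have hbase := γ.proj_lift_zero
  obtain ⟨base, loop, lift, contDiffOn_lift, proj_lift⟩ := γ
  dsimp only at hclosed h hbase
  subst hbase
  let p : Path (lift 0) (lift 0) :=
    { toFun := fun t => lift t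
      continuous_toFun := C1Loop.liftMap ⟨_, loop, lift, contDiffOn_lift, proj_lift⟩ |>.continuous
      source' := by simp
      target' := by simpa using hclosed }
  have hp : p.map continuous_proj = loop := Path.ext (funext proj_lift)
  change loop.Homotopic (Path.refl _)
  rw [← hp]
  exact (homotopic_refl_of_forall_ne (p := p) fun t => h t t.2).map ⟨proj, continuous_proj⟩

theorem exists_lift_eq_neg (γ : C1Loop n) (hγ : ¬ γ.Contractible) :
    ∃ t ∈ Icc (0 : ℝ) 1, γ.lift t = -γ.lift 0 := by
  by_contra! h
  refine hγ (γ.contractible_of_lift_ne ?_ h)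
  exact (proj_eq_proj_iff.mp (γ.proj_lift_one.trans γ.proj_lift_zero.symm)).resolve_right
    (h 1 (by simp))

end C1Loop

end Loops

section Length

open Filter Topology InnerProductGeometry

variable {E : Type*} [NormedAddCommGroup E] [InnerProductSpace ℝ E]

theorem angle_eq_two_mul_arcsin {x y : E} (hx : ‖x‖ = 1) (hy : ‖y‖ = 1) :
    angle x y = 2 * Real.arcsin (‖x - y‖ / 2) := by
  have h2 : ‖x - y‖ ≤ 2 := (norm_sub_le x y).trans (by rw [hx, hy]; norm_num)
  have h0 : 0 ≤ ‖x - y‖ / 2 := by positivity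
  have hcos : Real.cos (2 * Real.arcsin (‖x - y‖ / 2)) = inner ℝ x y := by
    rw [Real.cos_two_mul, Real.cos_sq', Real.sin_arcsin (by linarith) (by linarith)]
    have := norm_sub_sq_real x y
    rw [hx, hy] at this
    linarith
  rw [angle, hx, hy, mul_one, div_one, ← hcos, Real.arccos_cos]
  · linarith [Real.arcsin_nonneg.mpr h0]
  · linarith [Real.arcsin_le_pi_div_two (‖x - y‖ / 2)]

theorem tendsto_angle_div_sub {γ : ℝ → E} {γ' : E} {s : ℝ} {t : Set ℝ}
    (hγ : HasDerivWithinAt γ γ' t s) (hts : t ⊆ Ioi s) (hs : ‖γ s‖ = 1)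
    (ht : ∀ r ∈ t, ‖γ r‖ = 1) :
    Tendsto (fun r => angle (γ s) (γ r) / (r - s)) (𝓝[t] s) (𝓝 ‖γ'‖) := by
  have hst : s ∉ t := fun h => lt_irrefl s (hts h)
  set φ : ℝ → ℝ := fun u => 2 * Real.arcsin (u / 2)
  have hφ : HasDerivAt φ 1 0 := by
    have := ((Real.hasDerivAt_arcsin (x := 0 / 2) (by norm_num) (by norm_num)).comp (0 : ℝ)
      ((hasDerivAt_id (0 : ℝ)).div_const 2)).const_mul 2
    simpa using this
  have hnorm : Tendsto (fun r => ‖γ s - γ r‖) (𝓝[t] s) (𝓝 0) := by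
    simpa using (hγ.continuousWithinAt.const_sub (γ s)).norm
  have hslope : Tendsto (fun r => ‖slope γ s r‖) (𝓝[t] s) (𝓝 ‖γ'‖) :=
    ((hasDerivWithinAt_iff_tendsto_slope' hst).mp hγ).norm
  have hdslope : Tendsto (fun r => dslope φ 0 ‖γ s - γ r‖) (𝓝[t] s) (𝓝 1) := by
    have := (continuousAt_dslope_same.mpr hφ.differentiableAt).tendsto.comp hnorm
    rwa [dslope_same, hφ.deriv] at this
  refine ((one_mul ‖γ'‖) ▸ hdslope.mul hslope).congr' ?_
  filter_upwards [self_mem_nhdsWithin] with r hr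
  have hsr : 0 < r - s := sub_pos.mpr (hts hr)
  have := sub_smul_dslope φ 0 ‖γ s - γ r‖
  simp only [sub_zero, smul_eq_mul, φ, zero_div, Real.arcsin_zero, mul_zero] at this
  rw [angle_eq_two_mul_arcsin hs (ht r hr), ← this, slope_def_module, norm_smul, norm_inv,
    Real.norm_of_nonneg hsr.le, norm_sub_rev (γ r)]
  simp only [φ]
  field_simp

theorem eventually_slope_angle_lt {γ : ℝ → E} {γ' x : E} {s b r : ℝ} (hsb : s < b)
    (hγ : HasDerivWithinAt γ γ' (Ioo s b) s) (hunit : ∀ t ∈ Ico s b, ‖γ t‖ = 1)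
    (hr : ‖γ'‖ < r) : ∀ᶠ t in 𝓝[>] s, slope (fun t => angle x (γ t)) s t < r := by
  rw [← nhdsWithin_Ioo_eq_nhdsGT hsb]
  have hs := hunit s (left_mem_Ico.mpr hsb)
  have hlim := tendsto_angle_div_sub hγ (fun t ht => ht.1) hs
    fun t ht => hunit t (Ioo_subset_Ico_self ht)
  filter_upwards [hlim.eventually_lt_const hr, self_mem_nhdsWithin] with t ht hst
  refine lt_of_le_of_lt ?_ ht
  have : 0 < t - s := sub_pos.mpr hst.1
  rw [slope_def_field]
  gcongr
  linarith [angle_le_angle_add_angle x (γ s) (γ t)]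

theorem hasDerivWithinAt_integral_of_continuousOn_Icc {f : ℝ → ℝ} {a b t : ℝ}
    (hf : ContinuousOn f (Icc a b)) (ht : t ∈ Ico a b) :
    HasDerivWithinAt (fun t => ∫ s in a..t, f s) (f t) (Ici t) t := by
  have hmem : Icc a b ∈ 𝓝[>] t := mem_of_superset (Ioo_mem_nhdsGT ht.2)
    (Ioo_subset_Icc_self.trans (Icc_subset_Icc_left ht.1))
  have hint : IntervalIntegrable f volume a t :=
    (hf.mono (Icc_subset_Icc_right ht.2.le)).intervalIntegrable_of_Icc ht.1
  exact intervalIntegral.integral_hasDerivWithinAt_right hint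
    ⟨_, hmem, hf.aestronglyMeasurable measurableSet_Icc⟩
    ((hf t (Ico_subset_Icc_self ht)).mono_of_mem_nhdsWithin hmem)

theorem angle_le_integral_norm_derivWithin {γ : ℝ → E} {a b c : ℝ} (hab : a < b)
    (hγ : ContDiffOn ℝ 1 γ (Icc a b)) (hunit : ∀ t ∈ Icc a b, ‖γ t‖ = 1) (hc : c ∈ Icc a b) :
    angle (γ a) (γ c) ≤ ∫ t in a..c, ‖derivWithin γ (Icc a b) t‖ := by
  have ha : a ∈ Icc a b := left_mem_Icc.mpr hab.le
  have hspeed : ContinuousOn (fun t => ‖derivWithin γ (Icc a b) t‖) (Icc a b) :=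
    (hγ.continuousOn_derivWithin (uniqueDiffOn_Icc hab) le_rfl).norm
  have hangle : ContinuousOn (fun t => angle (γ a) (γ t)) (Icc a b) :=
    Real.continuous_arccos.comp_continuousOn <|
      ((continuousOn_const (c := γ a)).inner hγ.continuousOn).div
        (continuousOn_const.mul hγ.continuousOn.norm) fun t ht => by simp [hunit a ha, hunit t ht]
  have hprim : ContinuousOn (fun t => ∫ s in a..t, ‖derivWithin γ (Icc a b) s‖) (Icc a b) := by
    rw [← uIcc_of_le hab.le] at hspeed ⊢
    exact intervalIntegral.continuousOn_primitive_interval hspeed.integrableOn_uIcc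
  have hstart : angle (γ a) (γ a) ≤ ∫ s in a..a, ‖derivWithin γ (Icc a b) s‖ := by
    simp [angle_self (norm_ne_zero_iff.mp (by simp [hunit a ha] : ‖γ a‖ ≠ 0))]
  refine image_le_of_liminf_slope_right_le_deriv_boundary hangle hstart hprim
    (fun t ht => hasDerivWithinAt_integral_of_continuousOn_Icc hspeed ht) (fun t ht r hr => ?_) hc
  have hsub : Ico t b ⊆ Icc a b := Ico_subset_Icc_self.trans (Icc_subset_Icc_left ht.1)
  have hderiv := (hγ.differentiableOn one_ne_zero t (Ico_subset_Icc_self ht)).hasDerivWithinAt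
  exact (eventually_slope_angle_lt ht.2 (hderiv.mono (Ioo_subset_Ico_self.trans hsub))
    (fun s hs => hunit s (hsub hs)) hr).frequently

variable {n : ℕ}

theorem C1Loop.pi_le_length_roundFactor (γ : C1Loop n) (hγ : ¬ γ.Contractible) :
    ENNReal.ofReal Real.pi ≤ γ.length (roundFactor n) := by
  obtain ⟨c, hc, hneg⟩ := γ.exists_lift_eq_neg hγ
  let speed := derivWithin (fun s => (γ.lift s : Ambient n)) (Icc 0 1)
  have speed_int : IntegrableOn speed (Ioc 0 c) :=
    ((γ.contDiffOn_lift.continuousOn_derivWithin (uniqueDiffOn_Icc one_pos)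
      le_rfl).integrableOn_Icc).mono_set (Ioc_subset_Icc_self.trans (Icc_subset_Icc_right hc.2))
  calc ENNReal.ofReal Real.pi
      = ENNReal.ofReal (angle (γ.lift 0 : Ambient n) (γ.lift c)) := by
        rw [hneg, coe_neg_sphere, angle_self_neg_of_nonzero (ne_zero_of_mem_unit_sphere _)]
    _ ≤ ENNReal.ofReal (∫ t in 0..c, ‖speed t‖) :=
        ENNReal.ofReal_le_ofReal (angle_le_integral_norm_derivWithin
          (γ := fun t => (γ.lift t : Ambient n)) one_pos γ.contDiffOn_lift
          (fun t _ => norm_eq_of_mem_sphere (γ.lift t)) hc)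
    _ = ∫⁻ t in Ioc 0 c, ‖speed t‖ₑ := by
        rw [intervalIntegral.integral_of_le hc.1, ofReal_integral_norm_eq_lintegral_enorm speed_int]
    _ ≤ ∫⁻ t in Icc 0 1, ‖speed t‖ₑ :=
        lintegral_mono_set (Ioc_subset_Icc_self.trans (Icc_subset_Icc_right hc.2))
    _ = γ.length (roundFactor n) := by simp [C1Loop.length, roundFactor, speed]

theorem pi_le_sys_roundFactor (n : ℕ) : ENNReal.ofReal Real.pi ≤ sys (roundFactor n) :=
  le_iInf₂ fun γ hγ => γ.pi_le_length_roundFactor hγ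

end Length

section GreatCircles

theorem norm_cos_smul_add_sin_smul {E : Type*} [NormedAddCommGroup E] [InnerProductSpace ℝ E]
    {e : Fin 2 → E} (he : Orthonormal ℝ e) (s : ℝ) :
    ‖Real.cos s • e 0 + Real.sin s • e 1‖ = 1 := by
  have horth : inner ℝ (Real.cos s • e 0) (Real.sin s • e 1) = 0 := by
    simp [inner_smul_left, inner_smul_right, he.2 (show (0 : Fin 2) ≠ 1 by decide)]
  rw [norm_add_eq_sqrt_iff_real_inner_eq_zero.mpr horth, norm_smul, norm_smul, he.1, he.1]
  simp [← sq]

variable {n : ℕ} {e : Fin 2 → Ambient n}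

/-- The half great circle from `e 0` to `-e 0` through `e 1`, parametrized by `[0, 1]`. -/
def halfCircle (he : Orthonormal ℝ e) (t : ℝ) : Sph n :=
  ⟨Real.cos (Real.pi * t) • e 0 + Real.sin (Real.pi * t) • e 1,
    mem_sphere_zero_iff_norm.mpr (norm_cos_smul_add_sin_smul he _)⟩

theorem coe_halfCircle (he : Orthonormal ℝ e) (t : ℝ) :
    (halfCircle he t : Ambient n) = Real.cos (Real.pi * t) • e 0 + Real.sin (Real.pi * t) • e 1 :=
  rfl

theorem continuous_halfCircle (he : Orthonormal ℝ e) : Continuous (halfCircle he) :=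
  Continuous.subtype_mk (by fun_prop) _

theorem halfCircle_one (he : Orthonormal ℝ e) : halfCircle he 1 = -halfCircle he 0 := by
  ext1
  simp [coe_halfCircle]

theorem sphMap_halfCircle (A : Ambient n ≃ₗᵢ[ℝ] Ambient n) (he : Orthonormal ℝ e) (t : ℝ) :
    sphMap A (halfCircle he t) = halfCircle (he.comp_linearIsometryEquiv A) t := by
  ext1
  simp [coe_halfCircle]

theorem hasDerivAt_halfCircle (he : Orthonormal ℝ e) (t : ℝ) :
    HasDerivAt (fun t => (halfCircle he t : Ambient n))
      (Real.pi • (halfCircle he (t + 1 / 2) : Ambient n)) t := by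
  have hlin : HasDerivAt (fun t : ℝ => Real.pi * t) Real.pi t := by
    simpa using (hasDerivAt_id t).const_mul Real.pi
  refine ((hlin.cos.smul_const (e 0)).add (hlin.sin.smul_const (e 1))).congr_deriv ?_
  rw [coe_halfCircle, show Real.pi * (t + 1 / 2) = Real.pi * t + Real.pi / 2 by ring,
    Real.cos_add_pi_div_two, Real.sin_add_pi_div_two]
  module

/-- The half great circle spanned by `e`, as a loop in projective space. -/
def halfCircleLoop (he : Orthonormal ℝ e) : C1Loop n where
  base := proj (halfCircle he 0)
  loop :=
    { toFun := fun t => proj (halfCircle he t)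
      continuous_toFun := continuous_proj.comp
        ((continuous_halfCircle he).comp continuous_subtype_val)
      source' := by simp
      target' := by simp [halfCircle_one] }
  lift := halfCircle he
  contDiffOn_lift := by
    simp only [coe_halfCircle]
    fun_prop
  proj_lift _ := rfl

theorem not_contractible_halfCircleLoop (he : Orthonormal ℝ e) :
    ¬ (halfCircleLoop he).Contractible :=
  C1Loop.not_contractible_of_lift_one _ (halfCircle_one he)

theorem length_halfCircleLoop (he : Orthonormal ℝ e) (f : RP n → ℝ≥0∞) :
    (halfCircleLoop he).length f =
      ENNReal.ofReal Real.pi * ∫⁻ t in Icc (0 : ℝ) 1, f (proj (halfCircle he t)) := by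
  rw [← lintegral_const_mul' _ _ ENNReal.ofReal_ne_top]
  refine setLIntegral_congr_fun measurableSet_Icc fun t ht => ?_
  have speed : ‖derivWithin (fun s => (halfCircle he s : Ambient n)) (Icc 0 1) t‖ₑ =
      ENNReal.ofReal Real.pi := by
    rw [(hasDerivAt_halfCircle he t).hasDerivWithinAt.derivWithin
      (uniqueDiffOn_Icc zero_lt_one t ht), ← ofReal_norm, norm_smul, norm_eq_of_mem_sphere,
      mul_one, Real.norm_of_nonneg Real.pi_pos.le]
  simp only [halfCircleLoop, speed]
  exact mul_comm _ _

theorem exists_orthonormal_pair (hn : 1 ≤ n) : ∃ e : Fin 2 → Ambient n, Orthonormal ℝ e :=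
  ⟨_, (EuclideanSpace.basisFun (Fin (n + 1)) ℝ).orthonormal.comp
    (Fin.castLE (by omega : 2 ≤ n + 1)) (Fin.castLE_injective _)⟩

end GreatCircles

section MeanValue

variable {X : Type*} [MeasurableSpace X] {m : Measure X} {n : ℕ} {F : X → ℝ≥0∞}

theorem laverage_pow_le [IsFiniteMeasure m] [NeZero m] (hn : 1 ≤ n) (hF : AEMeasurable F m) :
    (⨍⁻ x, F x ∂m) ^ n ≤ ⨍⁻ x, F x ^ n ∂m := by
  have h := eLpNorm'_le_eLpNorm'_of_exponent_le (p := 1) (q := n) zero_lt_one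
    (by exact_mod_cast hn) ((m univ)⁻¹ • m) (hF.smul_measure _).aestronglyMeasurable
  simp only [eLpNorm'_eq_lintegral_enorm, enorm_eq_self, ENNReal.rpow_one, div_one,
    ENNReal.rpow_natCast, ← laverage_eq'] at h
  have hn0 : (n : ℝ) ≠ 0 := by positivity
  calc _ ≤ ((⨍⁻ x, F x ^ n ∂m) ^ (1 / (n : ℝ))) ^ n := by gcongr
    _ = _ := by
      rw [← ENNReal.rpow_natCast, ← ENNReal.rpow_mul, one_div_mul_cancel hn0, ENNReal.rpow_one]

theorem lintegral_pow_ne_top_of_memLp (hn : n ≠ 0) (hF : MemLp F n m) : ∫⁻ x, F x ^ n ∂m ≠ ⊤ := by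
  simpa using (lintegral_rpow_enorm_lt_top_of_eLpNorm_lt_top (by simpa using hn) (by simp) hF.2).ne

theorem laverage_ne_top_of_memLp [IsFiniteMeasure m] (hn : 1 ≤ n) (hF : MemLp F n m) :
    ⨍⁻ x, F x ∂m ≠ ⊤ :=
  (laverage_lt_top (by
    simpa using lintegral_pow_ne_top_of_memLp one_ne_zero
      (hF.mono_exponent (p := (1 : ℕ)) (by exact_mod_cast hn)))).ne

theorem ae_eq_const_or_laverage_pow_lt [IsFiniteMeasure m] (hn : 2 ≤ n) (hF : MemLp F n m) :
    (∃ c : ℝ≥0∞, F =ᵐ[m] fun _ => c) ∨ (⨍⁻ x, F x ∂m) ^ n < ⨍⁻ x, F x ^ n ∂m := by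
  have hFn := lintegral_pow_ne_top_of_memLp (by omega) hF
  have hF1 : ∫⁻ x, F x ∂m ≠ ⊤ := by
    simpa using lintegral_pow_ne_top_of_memLp one_ne_zero
      (hF.mono_exponent (p := (1 : ℕ)) (by exact_mod_cast (by omega : 1 ≤ n)))
  have hmeas := hF.1.aemeasurable
  have hfin : ∀ᵐ x ∂m, F x ≠ ⊤ := (ae_lt_top' hmeas hF1).mono fun x hx => hx.ne
  have hpow : ∀ᵐ x ∂m, F x ^ n ≠ ⊤ := hfin.mono fun x hx => ENNReal.pow_ne_top hx
  have jensen := (strictConvexOn_pow hn).ae_eq_const_or_map_average_lt (continuousOn_pow n)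
    isClosed_Ici (.of_forall fun x => ENNReal.toReal_nonneg)
    (integrable_toReal_of_lintegral_ne_top hmeas hF1)
    (by simpa [Function.comp_def] using
      integrable_toReal_of_lintegral_ne_top (hmeas.pow_const n) hFn)
  refine jensen.imp (fun hconst => ?_) fun hlt => ?_
  · refine ⟨ENNReal.ofReal (⨍ x, (F x).toReal ∂m), ?_⟩
    filter_upwards [hconst, hfin] with x hx hx'
    rw [← ENNReal.ofReal_toReal hx', hx, Function.const_apply]
  · simp only [← ENNReal.toReal_pow] at hlt
    rwa [← toReal_laverage hmeas hfin, ← toReal_laverage (hmeas.pow_const n) hpow,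
      ← ENNReal.toReal_pow, ENNReal.toReal_lt_toReal
        (ENNReal.pow_ne_top (laverage_lt_top hF1).ne) (laverage_lt_top hFn).ne] at hlt

end MeanValue

section ProjectiveSpace

variable {n : ℕ} {f : RP n → ℝ≥0∞}

theorem map_proj_sphVol (n : ℕ) : (sphVol n).map proj = (2 : ℝ≥0∞) • rpVol n := by
  rw [rpVol, smul_smul, ENNReal.mul_inv_cancel two_ne_zero ENNReal.ofNat_ne_top, one_smul]

theorem aemeasurable_comp_proj (hf : AEMeasurable f (rpVol n)) :
    AEMeasurable (fun x => f (proj x)) (sphVol n) :=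
  (map_proj_sphVol n ▸ hf.smul_measure 2).comp_measurable measurable_proj

theorem memLp_comp_proj {p : ℝ≥0∞} (hf : MemLp f p (rpVol n)) :
    MemLp (fun x => f (proj x)) p (sphVol n) :=
  (map_proj_sphVol n ▸ hf.smul_measure ENNReal.ofNat_ne_top).comp_of_map
    measurable_proj.aemeasurable

theorem vol_eq_lintegral_sphVol (hf : AEMeasurable f (rpVol n)) :
    vol f = 2⁻¹ * ∫⁻ x, f (proj x) ^ n ∂sphVol n := by
  have hpow : AEMeasurable (fun p => f p ^ n) ((sphVol n).map proj) :=
    map_proj_sphVol n ▸ (hf.pow_const n).smul_measure 2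
  rw [vol, rpVol, lintegral_smul_measure, smul_eq_mul,
    lintegral_map' hpow measurable_proj.aemeasurable]

theorem vol_roundFactor (n : ℕ) : vol (roundFactor n) = 2⁻¹ * sphVol n univ := by
  rw [vol_eq_lintegral_sphVol (f := roundFactor n) aemeasurable_const]
  simp [roundFactor]

theorem vol_eq_mul_laverage (hf : AEMeasurable f (rpVol n)) :
    vol f = vol (roundFactor n) * ⨍⁻ x, f (proj x) ^ n ∂sphVol n := by
  rw [vol_roundFactor, mul_assoc, measure_mul_laverage, vol_eq_lintegral_sphVol hf]

theorem sys_le_pi_mul_laverage (hn : 1 ≤ n) (hf : AEMeasurable f (rpVol n)) :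
    sys f ≤ ENNReal.ofReal Real.pi * ⨍⁻ x, f (proj x) ∂sphVol n := by
  obtain ⟨e, he⟩ := exists_orthonormal_pair hn
  have : IsProbabilityMeasure (volume.restrict (Icc (0 : ℝ) 1)) := ⟨by simp⟩
  have equidistributed := measurePreserving_inv_smul_prod (orthogonalHaar n) (sphVol n)
    (volume.restrict (Icc (0 : ℝ) 1)) (continuous_halfCircle he).measurable
  have hfproj : AEMeasurable (fun x => f (proj x)) ((sphVol n univ)⁻¹ • sphVol n) :=
    (aemeasurable_comp_proj hf).smul_measure _
  have sys_le_length (g : OrthogonalGroup n) : sys f ≤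
      ENNReal.ofReal Real.pi * ∫⁻ t in Icc (0 : ℝ) 1, f (proj (g⁻¹ • halfCircle he t)) := by
    simp only [orthogonalGroup_smul_eq, sphMap_halfCircle, ← length_halfCircleLoop]
    exact iInf₂_le (f := fun (γ : C1Loop n) (_ : ¬ γ.Contractible) => γ.length f) _
      (not_contractible_halfCircleLoop _)
  calc sys f = ∫⁻ _, sys f ∂orthogonalHaar n := by simp
    _ ≤ ∫⁻ g, ENNReal.ofReal Real.pi *
          (∫⁻ t in Icc (0 : ℝ) 1, f (proj (g⁻¹ • halfCircle he t))) ∂orthogonalHaar n :=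
        lintegral_mono sys_le_length
    _ = ENNReal.ofReal Real.pi * ⨍⁻ x, f (proj x) ∂sphVol n := by
        rw [lintegral_const_mul' _ _ ENNReal.ofReal_ne_top, laverage_eq',
          ← equidistributed.map_eq,
          lintegral_map' (equidistributed.map_eq ▸ hfproj) equidistributed.aemeasurable,
          lintegral_prod _ ((equidistributed.map_eq ▸ hfproj).comp_measurable
            equidistributed.measurable)]

theorem sys_roundFactor (hn : 1 ≤ n) : sys (roundFactor n) = ENNReal.ofReal Real.pi := by
  refine le_antisymm ?_ (pi_le_sys_roundFactor n)
  simpa [roundFactor] using sys_le_pi_mul_laverage hn (f := roundFactor n) aemeasurable_const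

theorem vol_div_sys_pow_roundFactor_mul_le (hn : 1 ≤ n) (hf : AEMeasurable f (rpVol n)) :
    vol (roundFactor n) / sys (roundFactor n) ^ n * sys f ^ n ≤
      vol (roundFactor n) * (⨍⁻ x, f (proj x) ∂sphVol n) ^ n := by
  have hpi : ENNReal.ofReal Real.pi ^ n ≠ 0 := by simp [Real.pi_pos]
  have hpi' : ENNReal.ofReal Real.pi ^ n ≠ ⊤ := by simp
  calc _ ≤ vol (roundFactor n) / ENNReal.ofReal Real.pi ^ n *
        (ENNReal.ofReal Real.pi * ⨍⁻ x, f (proj x) ∂sphVol n) ^ n := by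
        rw [sys_roundFactor hn]
        gcongr
        exact sys_le_pi_mul_laverage hn hf
    _ = _ := by rw [mul_pow, ← mul_assoc, ENNReal.div_mul_cancel hpi hpi']

theorem sys_ne_top_of_memLp (hn : 1 ≤ n) (hf : MemLp f n (rpVol n)) : sys f ≠ ⊤ :=
  ne_top_of_le_ne_top
    (ENNReal.mul_ne_top ENNReal.ofReal_ne_top (laverage_ne_top_of_memLp hn (memLp_comp_proj hf)))
    (sys_le_pi_mul_laverage hn hf.1.aemeasurable)

theorem pu_inequality (hn : 1 ≤ n) (hf : MemLp f n (rpVol n)) (hsys : sys f ≠ 0) :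
    vol (roundFactor n) / sys (roundFactor n) ^ n ≤ vol f / sys f ^ n := by
  have hmeas := hf.1.aemeasurable
  rw [ENNReal.le_div_iff_mul_le (.inl (pow_ne_zero n hsys))
    (.inl (ENNReal.pow_ne_top (sys_ne_top_of_memLp hn hf))), vol_eq_mul_laverage hmeas]
  refine (vol_div_sys_pow_roundFactor_mul_le hn hmeas).trans ?_
  gcongr
  exact laverage_pow_le hn (aemeasurable_comp_proj hmeas)

theorem ae_eq_const_of_vol_div_sys_pow_eq (hn : 2 ≤ n) (hf : MemLp f n (rpVol n))
    (hsys : sys f ≠ 0)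
    (heq : vol f / sys f ^ n = vol (roundFactor n) / sys (roundFactor n) ^ n) :
    ∃ c : ℝ≥0∞, (fun x => f (proj x)) =ᵐ[sphVol n] fun _ => c := by
  have hn1 : 1 ≤ n := by omega
  have hmeas := hf.1.aemeasurable
  refine (ae_eq_const_or_laverage_pow_lt hn (memLp_comp_proj hf)).resolve_right fun hlt => ?_
  have hle := vol_div_sys_pow_roundFactor_mul_le hn1 hmeas
  rw [← heq, ENNReal.div_mul_cancel (pow_ne_zero n hsys)
    (ENNReal.pow_ne_top (sys_ne_top_of_memLp hn1 hf)), vol_eq_mul_laverage hmeas] at hle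
  have hvol : vol (roundFactor n) ≠ 0 := by simp [vol_roundFactor, NeZero.ne (sphVol n)]
  have hvol' : vol (roundFactor n) ≠ ⊤ := by
    simp [vol_roundFactor, ENNReal.mul_ne_top, measure_ne_top]
  exact hlt.not_ge ((ENNReal.mul_le_mul_iff_right hvol hvol').mp hle)

end ProjectiveSpace

section Cylinder

/-- The conformal cylindrical (Mercator) coordinates `(t, θ)` on `S²`: `t` is the isometric
latitude and `θ` the longitude. The round metric is `(dt² + dθ²) / cosh² t`. -/
def mercator (p : ℝ × ℝ) : Sph 2 :=
  ⟨!₂[Real.cos p.2 / Real.cosh p.1, Real.sin p.2 / Real.cosh p.1,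
    Real.sinh p.1 / Real.cosh p.1], by
      have := (Real.cosh_pos p.1).ne'
      rw [mem_sphere_zero_iff_norm, EuclideanSpace.norm_eq, Real.sqrt_eq_one, Fin.sum_univ_three]
      simp only [Real.norm_eq_abs, sq_abs, Matrix.cons_val_zero, Matrix.cons_val_one,
        Matrix.cons_val, div_pow]
      field_simp
      linarith [Real.cosh_sq p.1, Real.sin_sq_add_cos_sq p.2]⟩

theorem coe_mercator (p : ℝ × ℝ) : (mercator p : Ambient 2) =
    !₂[Real.cos p.2 / Real.cosh p.1, Real.sin p.2 / Real.cosh p.1,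
      Real.sinh p.1 / Real.cosh p.1] := rfl

theorem continuous_mercator : Continuous mercator := by
  have hcosh (p : ℝ × ℝ) : Real.cosh p.1 ≠ 0 := (Real.cosh_pos _).ne'
  refine ((PiLp.continuous_toLp 2 _).comp (continuous_pi fun i => ?_)).subtype_mk _
  fin_cases i
  · exact (Real.continuous_cos.comp continuous_snd).div (by fun_prop) hcosh
  · exact (Real.continuous_sin.comp continuous_snd).div (by fun_prop) hcosh
  · exact (Real.continuous_sinh.comp continuous_fst).div (by fun_prop) hcosh

theorem one_sub_inner_mercator (p q : ℝ × ℝ) :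
    1 - inner ℝ (mercator p : Ambient 2) (mercator q : Ambient 2) =
      (Real.cosh (p.1 - q.1) - Real.cos (p.2 - q.2)) / (Real.cosh p.1 * Real.cosh q.1) := by
  have hp := (Real.cosh_pos p.1).ne'
  have hq := (Real.cosh_pos q.1).ne'
  rw [coe_mercator, coe_mercator, PiLp.inner_apply, Fin.sum_univ_three, Real.cosh_sub,
    Real.cos_sub]
  simp only [Matrix.cons_val_zero, RCLike.inner_apply, Real.ringHom_apply, Matrix.cons_val_one,
    Matrix.cons_val]
  field_simp
  ring

/-- Lebesgue measure on the cylinder `ℝ × (-π, π)`, the range of the coordinates `(t, θ)`. -/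
def cylinderVol : Measure (ℝ × ℝ) :=
  (volume : Measure ℝ).prod ((volume : Measure ℝ).restrict (Ioo (-Real.pi) Real.pi))

theorem smul_mem_cone_iff {n : ℕ} {s : Set (Sph n)} {r : ℝ} (hr : 0 < r) (x : Sph n) :
    r • (x : Ambient n) ∈ Ioo (0 : ℝ) 1 • (((↑) : Sph n → Ambient n) '' s) ↔ r < 1 ∧ x ∈ s := by
  refine ⟨?_, fun h => ⟨r, ⟨hr, h.1⟩, _, ⟨x, h.2, rfl⟩, rfl⟩⟩
  rintro ⟨r', hr', _, ⟨y, hy, rfl⟩, h : r' • (y : Ambient n) = r • (x : Ambient n)⟩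
  obtain rfl : r' = r := by
    simpa [norm_smul, abs_of_pos hr, abs_of_pos hr'.1] using congrArg norm h
  exact ⟨hr'.2, Subtype.ext (smul_right_injective _ hr.ne' h) ▸ hy⟩

theorem measurableSet_cone {n : ℕ} {s : Set (Sph n)} (hs : MeasurableSet s) :
    MeasurableSet (Ioo (0 : ℝ) 1 • (((↑) : Sph n → Ambient n) '' s)) := by
  have himage : MeasurableSet (((↑) : Sph n → Ambient n) '' s) :=
    (MeasurableEmbedding.subtype_coe
      Metric.isClosed_sphere.measurableSet).measurableSet_image.mpr hs
  rw [← image_smul_prod]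
  refine (measurableSet_Ioo.prod himage).image_of_continuousOn_injOn
    (continuous_fst.smul continuous_snd).continuousOn ?_
  rintro ⟨r, _⟩ ⟨hr, x, _, rfl⟩ ⟨r', _⟩ ⟨hr', y, _, rfl⟩
    (h : r • (x : Ambient n) = r' • (y : Ambient n))
  obtain rfl : r = r' := by
    simpa [norm_smul, abs_of_pos hr.1, abs_of_pos hr'.1] using congrArg norm h
  exact Prod.ext rfl (smul_right_injective (Ambient n) hr.1.ne' h)

/-- The coordinates `(X₂, (X₀, X₁))` of a point of `ℝ³`: the third coordinate is split off, as
needed for cylindrical coordinates. -/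
def splitThirdCoord : Ambient 2 ≃ᵐ ℝ × (ℝ × ℝ) :=
  ((MeasurableEquiv.toLp 2 (Fin 3 → ℝ)).symm.trans
    (MeasurableEquiv.piFinSuccAbove (fun _ => ℝ) 2)).trans
      (MeasurableEquiv.prodCongr (MeasurableEquiv.refl ℝ) MeasurableEquiv.finTwoArrow)

theorem splitThirdCoord_symm_apply (p : ℝ × (ℝ × ℝ)) :
    splitThirdCoord.symm p = !₂[p.2.1, p.2.2, p.1] :=
  splitThirdCoord.symm_apply_eq.mpr rfl

theorem measurePreserving_splitThirdCoord : MeasurePreserving splitThirdCoord volume volume :=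
  ((MeasurePreserving.id volume).prod (volume_preserving_finTwoArrow ℝ)).comp
    ((volume_preserving_piFinSuccAbove (fun _ : Fin 3 => ℝ) 2).comp
      (EuclideanSpace.volume_preserving_symm_measurableEquiv_toLp (Fin 3)))

theorem lintegral_ambient_two {H : Ambient 2 → ℝ≥0∞} (hH : Measurable H) :
    ∫⁻ X, H X = ∫⁻ q : ℝ × ℝ, ∫⁻ z : ℝ, H !₂[q.1, q.2, z] := by
  rw [← measurePreserving_splitThirdCoord.symm.lintegral_comp hH, Measure.volume_eq_prod,
    lintegral_prod_symm _ (by fun_prop)]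
  simp only [splitThirdCoord_symm_apply]

theorem lintegral_eq_lintegral_mul_sinh {r : ℝ} (hr : 0 < r) (g : ℝ → ℝ≥0∞) :
    ∫⁻ z, g z = ∫⁻ t, ENNReal.ofReal (r * Real.cosh t) * g (r * Real.sinh t) := by
  have hsurj : Function.Surjective fun t => r * Real.sinh t :=
    (mul_left_surjective₀ hr.ne').comp Real.sinh_surjective
  have hsubst := lintegral_image_eq_lintegral_abs_deriv_mul MeasurableSet.univ
    (fun t _ => ((Real.hasDerivAt_sinh t).const_mul r).hasDerivWithinAt)
    (((mul_right_injective₀ hr.ne').comp Real.sinh_injective).injOn) g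
  rw [image_univ, hsurj.range_eq] at hsubst
  simpa only [Measure.restrict_univ, abs_of_pos (mul_pos hr (Real.cosh_pos _))] using hsubst

theorem lintegral_sq_Ioo {a : ℝ} (ha : 0 ≤ a) :
    ∫⁻ r in Ioo 0 a, ENNReal.ofReal (r ^ 2) = ENNReal.ofReal (a ^ 3 / 3) := by
  rw [Measure.restrict_congr_set Ioo_ae_eq_Ioc,
    ← ofReal_integral_eq_lintegral_ofReal (intervalIntegral.intervalIntegrable_pow _).1
      (.of_forall fun r => sq_nonneg r),
    ← intervalIntegral.integral_of_le ha, integral_pow]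
  norm_num

theorem smul_mercator (r t θ : ℝ) :
    (r * Real.cosh t) • (mercator (t, θ) : Ambient 2) =
      !₂[r * Real.cos θ, r * Real.sin θ, r * Real.sinh t] := by
  have := (Real.cosh_pos t).ne'
  rw [coe_mercator]
  ext i
  fin_cases i <;> simp <;> field_simp

/-- Polar coordinates `(r, θ)` in the horizontal plane, followed by the substitution
`z = r sinh t`. -/
theorem lintegral_ambient_two_eq_lintegral_mercator {H : Ambient 2 → ℝ≥0∞} (hH : Measurable H) :
    ∫⁻ X, H X = ∫⁻ t, ∫⁻ θ in Ioo (-Real.pi) Real.pi, ∫⁻ r in Ioi (0 : ℝ),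
      ENNReal.ofReal (r ^ 2 * Real.cosh t) *
        H ((r * Real.cosh t) • (mercator (t, θ) : Ambient 2)) := by
  simp only [smul_mercator]
  let G : ℝ × (ℝ × ℝ) → ℝ≥0∞ := fun p => ENNReal.ofReal (p.2.1 ^ 2 * Real.cosh p.1) *
    H !₂[p.2.1 * Real.cos p.2.2, p.2.1 * Real.sin p.2.2, p.2.1 * Real.sinh p.1]
  have hG : Measurable G := by fun_prop
  have hsinh (p : ℝ × ℝ) (hp : p ∈ polarCoord.target) :
      ENNReal.ofReal p.1 • ∫⁻ z, H !₂[(polarCoord.symm p).1, (polarCoord.symm p).2, z] =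
        ∫⁻ t, G (t, p) := by
    have hr : 0 < p.1 := (polarCoord_target ▸ hp).1
    rw [lintegral_eq_lintegral_mul_sinh hr, smul_eq_mul,
      ← lintegral_const_mul' _ _ ENNReal.ofReal_ne_top]
    refine lintegral_congr fun t => ?_
    rw [← mul_assoc, ← ENNReal.ofReal_mul hr.le, polarCoord_symm_apply, ← mul_assoc, ← sq]
  calc ∫⁻ X, H X = ∫⁻ q : ℝ × ℝ, ∫⁻ z, H !₂[q.1, q.2, z] := lintegral_ambient_two hH
    _ = ∫⁻ p in polarCoord.target, ∫⁻ t, G (t, p) := by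
        rw [← lintegral_comp_polarCoord_symm]
        exact setLIntegral_congr_fun polarCoord.open_target.measurableSet hsinh
    _ = ∫⁻ t, ∫⁻ p in polarCoord.target, G (t, p) :=
        lintegral_lintegral_swap (hG.comp measurable_swap).aemeasurable
    _ = _ := by
        refine lintegral_congr fun t => ?_
        rw [polarCoord_target, Measure.volume_eq_prod, ← Measure.prod_restrict,
          lintegral_prod_symm _ (by fun_prop)]

theorem lintegral_radial_cone (s : Set (Sph 2)) (t θ : ℝ) :
    ∫⁻ r in Ioi (0 : ℝ), ENNReal.ofReal (r ^ 2 * Real.cosh t) *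
        (Ioo (0 : ℝ) 1 • (((↑) : Sph 2 → Ambient 2) '' s)).indicator 1
          ((r * Real.cosh t) • (mercator (t, θ) : Ambient 2)) =
      3⁻¹ * (ENNReal.ofReal (Real.cosh t ^ 2)⁻¹ * s.indicator 1 (mercator (t, θ))) := by
  have hcosh := Real.cosh_pos t
  have hindicator (r : ℝ) (hr : r ∈ Ioi 0) : ENNReal.ofReal (r ^ 2 * Real.cosh t) *
        (Ioo (0 : ℝ) 1 • (((↑) : Sph 2 → Ambient 2) '' s)).indicator 1
          ((r * Real.cosh t) • (mercator (t, θ) : Ambient 2)) =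
      (Ioo 0 (Real.cosh t)⁻¹).indicator (fun r => ENNReal.ofReal (r ^ 2)) r *
        (ENNReal.ofReal (Real.cosh t) * s.indicator 1 (mercator (t, θ))) := by
    have hr0 : 0 < r := hr
    rw [ENNReal.ofReal_mul (sq_nonneg r), mul_assoc]
    have hmem := smul_mem_cone_iff (s := s) (mul_pos hr0 hcosh) (mercator (t, θ))
    rw [← lt_div_iff₀ hcosh, one_div] at hmem
    by_cases hr1 : r < (Real.cosh t)⁻¹ <;> by_cases hs : mercator (t, θ) ∈ s <;>
      simp [indicator, hmem, hr0, hr1, hs]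
  rw [setLIntegral_congr_fun measurableSet_Ioi hindicator,
    lintegral_mul_const _ (by measurability), setLIntegral_indicator measurableSet_Ioo,
    inter_eq_left.mpr Ioo_subset_Ioi_self, lintegral_sq_Ioo (by positivity), ← mul_assoc,
    ← mul_assoc, ← ENNReal.ofReal_mul (by positivity)]
  congr 1
  rw [show (3 : ℝ≥0∞)⁻¹ = ENNReal.ofReal 3⁻¹ by
    rw [ENNReal.ofReal_inv_of_pos (by norm_num), ENNReal.ofReal_ofNat],
    ← ENNReal.ofReal_mul (by positivity)]
  congr 1
  field_simp

theorem sphVol_two_apply {s : Set (Sph 2)} (hs : MeasurableSet s) :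
    sphVol 2 s = ∫⁻ p, ENNReal.ofReal (Real.cosh p.1 ^ 2)⁻¹ *
      s.indicator 1 (mercator p) ∂cylinderVol := by
  have hmeas : Measurable fun p : ℝ × ℝ => ENNReal.ofReal (Real.cosh p.1 ^ 2)⁻¹ *
      s.indicator 1 (mercator p) :=
    Measurable.mul (by fun_prop) ((measurable_one.indicator hs).comp continuous_mercator.measurable)
  rw [sphVol, Measure.toSphere_apply' _ hs, finrank_euclideanSpace_fin,
    show ((2 + 1 : ℕ) : ℝ≥0∞) = 3 by norm_num, ← lintegral_indicator_one (measurableSet_cone hs),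
    lintegral_ambient_two_eq_lintegral_mercator
      (measurable_one.indicator (measurableSet_cone hs))]
  have hthird : (3⁻¹ : ℝ≥0∞) ≠ ⊤ := by simp
  simp only [lintegral_radial_cone, lintegral_const_mul' _ _ hthird]
  rw [← mul_assoc, ENNReal.mul_inv_cancel (by simp) (by simp), one_mul, cylinderVol,
    lintegral_prod _ hmeas.aemeasurable]

theorem sphVol_two_eq : sphVol 2 =
    (cylinderVol.withDensity fun p => ENNReal.ofReal (Real.cosh p.1 ^ 2)⁻¹).map mercator := by
  ext s hs
  have hpre := continuous_mercator.measurable hs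
  rw [sphVol_two_apply hs, Measure.map_apply continuous_mercator.measurable hs,
    withDensity_apply _ hpre, ← lintegral_indicator hpre]
  refine lintegral_congr fun p => ?_
  by_cases hp : mercator p ∈ s <;> simp [hp]

theorem lintegral_sphVol_two {F : Sph 2 → ℝ≥0∞} (hF : Measurable F) :
    ∫⁻ x, F x ∂sphVol 2 =
      ∫⁻ p, ENNReal.ofReal (Real.cosh p.1 ^ 2)⁻¹ * F (mercator p) ∂cylinderVol := by
  rw [sphVol_two_eq, lintegral_map hF continuous_mercator.measurable,
    lintegral_withDensity_eq_lintegral_mul _ (by fun_prop)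
      (by exact hF.comp continuous_mercator.measurable)]
  rfl

theorem integral_sphVol_two {F : Sph 2 → ℝ} (hF : Measurable F) :
    ∫ x, F x ∂sphVol 2 = ∫ p, (Real.cosh p.1 ^ 2)⁻¹ * F (mercator p) ∂cylinderVol := by
  rw [sphVol_two_eq, integral_map continuous_mercator.measurable.aemeasurable
    hF.aestronglyMeasurable, integral_withDensity_eq_integral_toReal_smul (by fun_prop)
    (.of_forall fun p => ENNReal.ofReal_lt_top)]
  refine integral_congr_ae (.of_forall fun p => ?_)
  simp only [smul_eq_mul, ENNReal.toReal_ofReal (inv_nonneg.mpr (sq_nonneg _))]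

theorem integrable_sphVol_two_iff {F : Sph 2 → ℝ} (hF : Measurable F) :
    Integrable F (sphVol 2) ↔
      Integrable (fun p => (Real.cosh p.1 ^ 2)⁻¹ * F (mercator p)) cylinderVol := by
  rw [sphVol_two_eq, integrable_map_measure hF.aestronglyMeasurable
    continuous_mercator.measurable.aemeasurable, integrable_withDensity_iff_integrable_smul₀'
    (by fun_prop) (.of_forall fun p => ENNReal.ofReal_lt_top)]
  refine integrable_congr (.of_forall fun p => ?_)
  simp only [smul_eq_mul, Function.comp, ENNReal.toReal_ofReal (inv_nonneg.mpr (sq_nonneg _))]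

theorem sphVol_two_univ : sphVol 2 univ = ENNReal.ofReal (4 * Real.pi) := by
  rw [sphVol, Measure.toSphere_apply_univ, EuclideanSpace.volume_ball_fin_three,
    finrank_euclideanSpace_fin, ENNReal.ofReal_one, one_pow, one_mul, ← ENNReal.ofReal_natCast,
    ← ENNReal.ofReal_mul (by positivity)]
  congr 1
  push_cast
  ring

end Cylinder

section ChordKernel

/-- Half of the squared chordal distance `|x - y|² / 2 = 1 - ⟨x, y⟩` on the sphere; the logarithmic
kernel of potential theory on `S²` is a multiple of `log (chord x y)`. -/
def chord {n : ℕ} (x y : Sph n) : ℝ := 1 - inner ℝ (x : Ambient n) (y : Ambient n)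

section AnyDimension

variable {n : ℕ}

theorem abs_inner_le_one (x y : Sph n) : |inner ℝ (x : Ambient n) (y : Ambient n)| ≤ 1 := by
  simpa using abs_real_inner_le_norm (x : Ambient n) (y : Ambient n)

theorem chord_eq_dist_sq (x y : Sph n) : chord x y = dist x y ^ 2 / 2 := by
  rw [Subtype.dist_eq, dist_eq_norm, norm_sub_sq_real, chord]
  simp only [norm_eq_of_mem_sphere]
  ring

theorem chord_nonneg (x y : Sph n) : 0 ≤ chord x y :=
  sub_nonneg.mpr (abs_le.mp (abs_inner_le_one x y)).2

theorem chord_le_two (x y : Sph n) : chord x y ≤ 2 := by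
  unfold chord
  linarith [(abs_le.mp (abs_inner_le_one x y)).1]

theorem chord_eq_zero_iff {x y : Sph n} : chord x y = 0 ↔ x = y := by
  simp [chord_eq_dist_sq]

theorem chord_pos {x y : Sph n} (h : x ≠ y) : 0 < chord x y :=
  (chord_nonneg x y).lt_of_ne' (chord_eq_zero_iff.not.mpr h)

theorem chord_comm (x y : Sph n) : chord x y = chord y x := by
  rw [chord, real_inner_comm, chord]

theorem chord_sphMap (A : Ambient n ≃ₗᵢ[ℝ] Ambient n) (x y : Sph n) :
    chord (sphMap A x) (sphMap A y) = chord x y := by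
  rw [chord, inner_sphMap, chord]

theorem integral_sphMap (A : Ambient n ≃ₗᵢ[ℝ] Ambient n) {g : Sph n → ℝ} (hg : Measurable g) :
    ∫ x, g (sphMap A x) ∂sphVol n = ∫ x, g x ∂sphVol n := by
  rw [← integral_map_of_stronglyMeasurable (continuous_sphMap A).measurable hg.stronglyMeasurable,
    (measurePreserving_sphMap A).map_eq]

@[fun_prop]
theorem continuous_chord {X : Type*} [TopologicalSpace X] {f g : X → Sph n}
    (hf : Continuous f) (hg : Continuous g) : Continuous fun a => chord (f a) (g a) := by
  unfold chord
  fun_prop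

@[fun_prop]
theorem measurable_chord {X : Type*} [MeasurableSpace X] {f g : X → Sph n}
    (hf : Measurable f) (hg : Measurable g) : Measurable fun a => chord (f a) (g a) := by
  unfold chord
  fun_prop

end AnyDimension

/-- The kernel `chord ^ (-1/4)`, equal to `∞` on the diagonal. It dominates `|log chord|` and
`(log chord)²` up to constants and is still integrable; any other exponent of small absolute value
would serve as well. -/
def chordKernel {n : ℕ} (x y : Sph n) : ℝ≥0∞ := ENNReal.ofReal (chord x y) ^ (-(1 / 4) : ℝ)

section Domination

variable {n : ℕ}

@[fun_prop]
theorem measurable_chordKernel {X : Type*} [MeasurableSpace X] {f g : X → Sph n}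
    (hf : Measurable f) (hg : Measurable g) : Measurable fun a => chordKernel (f a) (g a) :=
  (measurable_chord hf hg).ennreal_ofReal.pow_const _

theorem chordKernel_comm (x y : Sph n) : chordKernel x y = chordKernel y x := by
  rw [chordKernel, chord_comm, chordKernel]

theorem chordKernel_self (x : Sph n) : chordKernel x x = ⊤ := by
  rw [chordKernel, chord_eq_zero_iff.mpr rfl, ENNReal.ofReal_zero,
    ENNReal.zero_rpow_of_neg (by norm_num)]

theorem ofReal_rpow_chord_le (x y : Sph n) :
    ENNReal.ofReal (chord x y ^ (-(1 / 4) : ℝ)) ≤ chordKernel x y := by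
  rcases eq_or_ne x y with rfl | h
  · exact (chordKernel_self x).symm ▸ le_top
  · exact (ENNReal.ofReal_rpow_of_pos (chord_pos h)).ge

theorem abs_log_le_rpow_neg_div {d s : ℝ} (hd : 0 ≤ d) (hd' : d ≤ 2) (hs : 0 < s)
    (hs' : s ≤ 1 / 2) : |Real.log d| ≤ d ^ (-s) / s := by
  rcases hd.eq_or_lt with rfl | hpos
  · rw [Real.log_zero, abs_zero]
    positivity
  rcases le_total d 1 with h1 | h1
  · have hlt := Real.abs_log_mul_self_rpow_lt d s hpos h1 hs
    rw [abs_mul, abs_of_pos (Real.rpow_pos_of_pos hpos s)] at hlt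
    rw [Real.rpow_neg hd, ← one_div, div_right_comm, le_div_iff₀ (Real.rpow_pos_of_pos hpos s)]
    exact hlt.le
  · have hlog : Real.log d ≤ 1 := (Real.log_le_sub_one_of_pos hpos).trans (by linarith)
    have hhalf : 2⁻¹ ≤ d ^ (-s) := calc
      2⁻¹ ≤ d⁻¹ := by gcongr
      _ = d ^ (-1 : ℝ) := (Real.rpow_neg_one d).symm
      _ ≤ d ^ (-s) := Real.rpow_le_rpow_of_exponent_le h1 (by linarith)
    rw [abs_of_nonneg (Real.log_nonneg h1), le_div_iff₀ hs]
    nlinarith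

theorem abs_log_chord_le (x y : Sph n) :
    |Real.log (chord x y)| ≤ 4 * chord x y ^ (-(1 / 4) : ℝ) := by
  have := abs_log_le_rpow_neg_div (s := 1 / 4) (chord_nonneg x y) (chord_le_two x y)
    (by norm_num) (by norm_num)
  linarith

theorem sq_log_chord_le (x y : Sph n) :
    Real.log (chord x y) ^ 2 ≤ 64 * chord x y ^ (-(1 / 4) : ℝ) := by
  have hlog := abs_log_le_rpow_neg_div (s := 1 / 8) (chord_nonneg x y) (chord_le_two x y)
    (by norm_num) (by norm_num)
  calc Real.log (chord x y) ^ 2 ≤ (chord x y ^ (-(1 / 8) : ℝ) / (1 / 8)) ^ 2 :=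
        sq_le_sq' (neg_le_of_abs_le hlog) (le_of_abs_le hlog)
    _ = 64 * chord x y ^ (-(1 / 4) : ℝ) := by
        rw [div_pow, ← Real.rpow_mul_natCast (chord_nonneg x y)]
        norm_num
        ring

theorem integrable_rpow_chord {m : Measure (Sph n)} {x : Sph n}
    (h : ∫⁻ y, chordKernel x y ∂m ≠ ⊤) :
    Integrable (fun y => chord x y ^ (-(1 / 4) : ℝ)) m := by
  refine ⟨(measurable_chord measurable_const measurable_id).pow_const _ |>.aestronglyMeasurable, ?_⟩
  rw [hasFiniteIntegral_iff_ofReal (.of_forall fun y => Real.rpow_nonneg (chord_nonneg x y) _)]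
  exact (lintegral_mono fun y => ofReal_rpow_chord_le x y).trans_lt h.lt_top

theorem integrable_log_chord {m : Measure (Sph n)} {x : Sph n}
    (h : ∫⁻ y, chordKernel x y ∂m ≠ ⊤) : Integrable (fun y => Real.log (chord x y)) m :=
  ((integrable_rpow_chord h).const_mul 4).mono'
    (measurable_chord measurable_const measurable_id).log.aestronglyMeasurable
    (.of_forall fun y => abs_log_chord_le x y)

/-- The logarithmic potential `∫ log (|x - y|² / 2) dm(y)` of a measure on the sphere; it is
meaningful at the points `x` at which the kernel is integrable. -/
def logPotential (m : Measure (Sph n)) (x : Sph n) : ℝ := ∫ y, Real.log (chord x y) ∂m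

theorem measurable_logPotential (m : Measure (Sph n)) [SFinite m] : Measurable (logPotential m) :=
  (StronglyMeasurable.integral_prod_right' (ν := m)
    (f := fun p : Sph n × Sph n => Real.log (chord p.1 p.2))
    (measurable_chord measurable_fst measurable_snd).log.stronglyMeasurable).measurable

end Domination

/-- The north pole `(0, 0, 1)` of `S²`. -/
def north : Sph 2 := ⟨EuclideanSpace.single 2 1, by simp⟩

theorem chord_north_mercator (p : ℝ × ℝ) : chord north (mercator p) =
    Real.exp (-p.1) / Real.cosh p.1 := by
  have hcosh := (Real.cosh_pos p.1).ne'
  rw [chord, north, coe_mercator, EuclideanSpace.inner_single_left]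
  simp only [Real.ringHom_apply, Matrix.cons_val, one_mul]
  field_simp
  exact Real.cosh_sub_sinh p.1

theorem exp_abs_le_two_mul_cosh (t : ℝ) : Real.exp |t| ≤ 2 * Real.cosh t := by
  rw [← Real.cosh_abs, Real.cosh_eq]
  linarith [Real.exp_pos (-|t|)]

theorem integrable_exp_neg_mul_abs {a : ℝ} (ha : 0 < a) :
    Integrable fun t : ℝ => Real.exp (-(a * |t|)) := by
  refine .of_integral_ne_zero ?_
  rw [integral_comp_abs (f := fun t => Real.exp (-(a * t)))]
  simp only [← neg_mul, integral_exp_mul_Ioi (neg_neg_of_pos ha)]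
  simp [ha.ne']

theorem chordKernel_north_mercator_le (p : ℝ × ℝ) :
    ENNReal.ofReal (Real.cosh p.1 ^ 2)⁻¹ * chordKernel north (mercator p) ≤
      ENNReal.ofReal (4 * Real.exp (-(1 * |p.1|))) := by
  have hcosh := Real.cosh_pos p.1
  have hexp := exp_abs_le_two_mul_cosh p.1
  have hrpow : (Real.exp (-p.1) / Real.cosh p.1) ^ (-(1 / 4) : ℝ) ≤ 2 * Real.cosh p.1 := by
    have hbase : Real.cosh p.1 * Real.exp p.1 ≤ (2 * Real.cosh p.1) ^ 4 := by
      have : Real.exp p.1 ≤ 2 * Real.cosh p.1 := (Real.exp_le_exp.mpr (le_abs_self _)).trans hexp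
      nlinarith [Real.one_le_cosh p.1, pow_le_pow_left₀ zero_le_one (Real.one_le_cosh p.1) 2,
        sq_nonneg (Real.cosh p.1 ^ 2 - 1)]
    calc (Real.exp (-p.1) / Real.cosh p.1) ^ (-(1 / 4) : ℝ)
        = (Real.cosh p.1 * Real.exp p.1) ^ (1 / 4 : ℝ) := by
          rw [Real.rpow_neg (by positivity), ← Real.inv_rpow (by positivity), inv_div, Real.exp_neg,
            div_inv_eq_mul]
      _ ≤ ((2 * Real.cosh p.1) ^ 4) ^ (1 / 4 : ℝ) :=
          Real.rpow_le_rpow (by positivity) hbase (by norm_num)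
      _ = 2 * Real.cosh p.1 := by
          simpa using Real.pow_rpow_inv_natCast (by positivity : 0 ≤ 2 * Real.cosh p.1)
            (four_ne_zero)
  rw [chordKernel, chord_north_mercator, ENNReal.ofReal_rpow_of_pos (by positivity),
    ← ENNReal.ofReal_mul (by positivity)]
  refine ENNReal.ofReal_le_ofReal ?_
  calc (Real.cosh p.1 ^ 2)⁻¹ * (Real.exp (-p.1) / Real.cosh p.1) ^ (-(1 / 4) : ℝ)
      ≤ (Real.cosh p.1 ^ 2)⁻¹ * (2 * Real.cosh p.1) := by gcongr
    _ = 4 * (2 * Real.cosh p.1)⁻¹ := by field_simp; norm_num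
    _ ≤ 4 * Real.exp (-(1 * |p.1|)) := by
        rw [one_mul, Real.exp_neg]
        gcongr

/-- The total mass `∫ chordKernel x y dy` of the kernel over `S²`, which does not depend on `x`. -/
def chordKernelMass : ℝ≥0∞ := ∫⁻ y, chordKernel north y ∂sphVol 2

theorem lintegral_chordKernel (x : Sph 2) :
    ∫⁻ y, chordKernel x y ∂sphVol 2 = chordKernelMass := by
  obtain ⟨A, rfl⟩ := exists_sphMap_eq north x
  rw [chordKernelMass, ← (measurePreserving_sphMap A).lintegral_comp (by fun_prop)]
  simp only [chordKernel, chord_sphMap]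

theorem chordKernelMass_ne_top : chordKernelMass ≠ ⊤ := by
  rw [chordKernelMass, lintegral_sphVol_two (by fun_prop)]
  refine ne_top_of_le_ne_top ?_ (lintegral_mono chordKernel_north_mercator_le)
  rw [cylinderVol, lintegral_prod _ (by fun_prop)]
  simp only [lintegral_const, Measure.restrict_apply_univ, Real.volume_Ioo]
  rw [lintegral_mul_const _ (by fun_prop)]
  exact ENNReal.mul_ne_top
    ((integrable_exp_neg_mul_abs zero_lt_one).const_mul 4).lintegral_lt_top.ne
    ENNReal.ofReal_ne_top

theorem lintegral_chordKernel_ne_top (x : Sph 2) : ∫⁻ y, chordKernel x y ∂sphVol 2 ≠ ⊤ :=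
  lintegral_chordKernel x ▸ chordKernelMass_ne_top

instance : NullSingletonClass (sphVol 2) where
  measure_singleton x := by
    by_contra h
    have hle : ∫⁻ y in {x}, chordKernel x y ∂sphVol 2 ≤ chordKernelMass :=
      lintegral_chordKernel x ▸ setLIntegral_le_lintegral _ _
    rw [lintegral_singleton, chordKernel_self, ENNReal.top_mul h] at hle
    exact chordKernelMass_ne_top (top_le_iff.mp hle)

theorem lintegral_lintegral_chordKernel (m : Measure (Sph 2)) [SFinite m] :
    ∫⁻ x, ∫⁻ y, chordKernel x y ∂m ∂sphVol 2 = chordKernelMass * m univ := by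
  rw [lintegral_lintegral_swap (f := chordKernel)
    (by fun_prop : Measurable fun p : Sph 2 × Sph 2 => chordKernel p.1 p.2).aemeasurable]
  simp only [chordKernel_comm _ (_ : Sph 2), lintegral_chordKernel, lintegral_const]

theorem ae_lintegral_chordKernel_ne_top (m : Measure (Sph 2)) [IsFiniteMeasure m] :
    ∀ᵐ x ∂sphVol 2, ∫⁻ y, chordKernel x y ∂m ≠ ⊤ := by
  have hmeas : Measurable fun x => ∫⁻ y, chordKernel x y ∂m :=
    (by fun_prop : Measurable fun p : Sph 2 × Sph 2 => chordKernel p.1 p.2).lintegral_prod_right'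
  refine (ae_lt_top hmeas ?_).mono fun x hx => hx.ne
  rw [lintegral_lintegral_chordKernel]
  exact ENNReal.mul_ne_top chordKernelMass_ne_top (measure_ne_top _ _)

theorem integrable_rpow_chord_prod (m : Measure (Sph 2)) [IsFiniteMeasure m] :
    Integrable (fun p : Sph 2 × Sph 2 => chord p.1 p.2 ^ (-(1 / 4) : ℝ)) (m.prod (sphVol 2)) := by
  have hmeas : Measurable fun p : Sph 2 × Sph 2 => chord p.1 p.2 ^ (-(1 / 4) : ℝ) :=
    (measurable_chord measurable_fst measurable_snd).pow_const _
  refine (integrable_prod_iff hmeas.aestronglyMeasurable).mpr ⟨.of_forall fun x =>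
    integrable_rpow_chord (lintegral_chordKernel_ne_top x), ?_⟩
  have hconst : ∀ x : Sph 2, ∫ y, ‖chord x y ^ (-(1 / 4) : ℝ)‖ ∂sphVol 2 =
      ∫ y, ‖chord north y ^ (-(1 / 4) : ℝ)‖ ∂sphVol 2 := by
    intro x
    obtain ⟨A, rfl⟩ := exists_sphMap_eq north x
    rw [← integral_sphMap A (by fun_prop)]
    simp only [chord_sphMap]
  simp only [hconst]
  exact integrable_const _

theorem integrable_log_chord_prod (m : Measure (Sph 2)) [IsFiniteMeasure m] :
    Integrable (fun p : Sph 2 × Sph 2 => Real.log (chord p.1 p.2)) (m.prod (sphVol 2)) :=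
  ((integrable_rpow_chord_prod m).const_mul 4).mono'
    (measurable_chord measurable_fst measurable_snd).log.aestronglyMeasurable
    (.of_forall fun p => abs_log_chord_le p.1 p.2)

end ChordKernel

section Moments

section ZonalMoment

variable {n k : ℕ} {m : Measure (Sph n)}

/-- A monomial of degree `k` in the coordinates of `ℝⁿ⁺¹`, restricted to the sphere. The index is
the list of the `k` coordinates that are multiplied, so that each monomial occurs with its
multinomial multiplicity. -/
def sphMonomial (p : Fin k → Fin (n + 1)) (x : Sph n) : ℝ := ∏ i, (x : Ambient n) (p i)

@[fun_prop]
theorem continuous_sphMonomial (p : Fin k → Fin (n + 1)) : Continuous (sphMonomial p) := by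
  unfold sphMonomial
  fun_prop

theorem inner_pow_eq_sum_sphMonomial (k : ℕ) (x y : Sph n) :
    inner ℝ (x : Ambient n) y ^ k =
      ∑ p : Fin k → Fin (n + 1), sphMonomial p x * sphMonomial p y := by
  rw [PiLp.inner_apply, Fintype.sum_pow]
  refine Finset.sum_congr rfl fun p _ => ?_
  rw [sphMonomial, sphMonomial, ← Finset.prod_mul_distrib]
  exact Finset.prod_congr rfl fun i _ => by simp [mul_comm]

theorem norm_inner_pow_le_one (k : ℕ) (x y : Sph n) : ‖inner ℝ (x : Ambient n) y ^ k‖ ≤ 1 := by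
  rw [norm_pow]
  exact pow_le_one₀ (norm_nonneg _) (abs_inner_le_one x y)

theorem integrable_of_continuous [IsFiniteMeasure m] {v : Sph n → ℝ} (hv : Continuous v) :
    Integrable v m :=
  hv.integrable_of_hasCompactSupport (.of_compactSpace v)

/-- The `k`-th zonal moment `∫ ⟨x, z⟩ᵏ dm(z)` of a measure, as a function of the pole `x`. -/
def zonalMoment (m : Measure (Sph n)) (k : ℕ) (x : Sph n) : ℝ :=
  ∫ z, inner ℝ (x : Ambient n) z ^ k ∂m

theorem zonalMoment_zero (x : Sph n) : zonalMoment m 0 x = m.real univ := by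
  simp [zonalMoment]

theorem zonalMoment_eq_sum (m : Measure (Sph n)) [IsFiniteMeasure m] (k : ℕ) (x : Sph n) :
    zonalMoment m k x =
      ∑ p : Fin k → Fin (n + 1), (∫ z, sphMonomial p z ∂m) * sphMonomial p x := by
  simp only [zonalMoment, inner_pow_eq_sum_sphMonomial]
  rw [integral_finsetSum _ fun p _ => (integrable_of_continuous (by fun_prop)).const_mul _]
  simp only [integral_const_mul, mul_comm]

@[fun_prop]
theorem continuous_zonalMoment (m : Measure (Sph n)) [IsFiniteMeasure m] (k : ℕ) :
    Continuous (zonalMoment m k) := by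
  rw [funext (zonalMoment_eq_sum m k)]
  fun_prop

theorem zonalMoment_sphVol_eq (k : ℕ) (x y : Sph n) :
    zonalMoment (sphVol n) k x = zonalMoment (sphVol n) k y := by
  obtain ⟨A, rfl⟩ := exists_sphMap_eq x y
  rw [zonalMoment, zonalMoment, ← integral_sphMap A
    (g := fun z : Sph n => inner ℝ (sphMap A x : Ambient n) z ^ k) (by fun_prop)]
  simp only [inner_sphMap]

theorem integral_zonalMoment (m : Measure (Sph n)) [IsFiniteMeasure m] (k : ℕ) (x : Sph n) :
    ∫ y, zonalMoment m k y ∂sphVol n = m.real univ * zonalMoment (sphVol n) k x := by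
  unfold zonalMoment
  rw [integral_integral_swap]
  · have hinner : ∀ z : Sph n, ∫ y : Sph n, inner ℝ (y : Ambient n) z ^ k ∂sphVol n =
        zonalMoment (sphVol n) k x := fun z => by
      rw [zonalMoment_sphVol_eq k x z]
      simp only [zonalMoment, real_inner_comm (z : Ambient n)]
    simp only [hinner, integral_const, smul_eq_mul, zonalMoment]
  · exact .of_bound (C := 1) (by fun_prop) (.of_forall fun p => norm_inner_pow_le_one k p.1 p.2)

theorem hasSum_exp_inner_smul_mul_I (r : ℝ) (x z : Sph n) :
    HasSum (fun k : ℕ => ((k.factorial : ℂ)⁻¹ * (r * Complex.I) ^ k) *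
        (inner ℝ (x : Ambient n) z ^ k : ℝ))
      (Complex.exp (inner ℝ (z : Ambient n) (r • (x : Ambient n)) * Complex.I)) := by
  have hexp := NormedSpace.exp_series_hasSum_exp' (𝕂 := ℂ) (𝔸 := ℂ)
    ((inner ℝ (z : Ambient n) (r • (x : Ambient n)) : ℝ) * Complex.I)
  rw [← Complex.exp_eq_exp_ℂ] at hexp
  refine hexp.congr_fun fun k => ?_
  rw [inner_smul_right, real_inner_comm, smul_eq_mul]
  push_cast
  ring

theorem hasSum_charFun_map_coe (m : Measure (Sph n)) [IsFiniteMeasure m] (r : ℝ) (x : Sph n) :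
    HasSum (fun k : ℕ => ((k.factorial : ℂ)⁻¹ * (r * Complex.I) ^ k) * zonalMoment m k x)
      (charFun (m.map ((↑) : Sph n → Ambient n)) (r • (x : Ambient n))) := by
  have hterm : ∀ k : ℕ, ((k.factorial : ℂ)⁻¹ * (r * Complex.I) ^ k) * zonalMoment m k x =
      ∫ z, ((k.factorial : ℂ)⁻¹ * (r * Complex.I) ^ k) *
        (inner ℝ (x : Ambient n) z ^ k : ℝ) ∂m := fun k => by
    rw [integral_const_mul, integral_complex_ofReal, zonalMoment]
  simp only [hterm]
  rw [charFun_apply, integral_map continuous_subtype_val.measurable.aemeasurable (by fun_prop)]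
  refine hasSum_integral_of_dominated_convergence (fun k _ => |r| ^ k / k.factorial)
    (fun k => Continuous.aestronglyMeasurable (by fun_prop)) (fun k => .of_forall fun z => ?_)
    (.of_forall fun _ => Real.summable_pow_div_factorial _) (integrable_const _)
    (.of_forall fun z => hasSum_exp_inner_smul_mul_I r x z)
  simp only [norm_mul, norm_pow, norm_inv, Complex.norm_I, Complex.norm_real,
    Complex.norm_natCast, mul_one, Real.norm_eq_abs, div_eq_inv_mul]
  refine mul_le_of_le_one_right (by positivity) ?_
  simpa using norm_inner_pow_le_one k x z

theorem exists_eq_smul_coe (ξ : Ambient n) : ∃ (r : ℝ) (x : Sph n), ξ = r • (x : Ambient n) := by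
  by_cases hξ : ξ = 0
  · exact ⟨0, ⟨EuclideanSpace.single 0 1, by simp⟩, by simp [hξ]⟩
  · exact ⟨‖ξ‖, ⟨‖ξ‖⁻¹ • ξ, by simp [norm_smul, hξ]⟩, by simp [smul_smul, hξ]⟩

theorem measure_eq_of_zonalMoment_eq {P N : Measure (Sph n)} [IsFiniteMeasure P]
    [IsFiniteMeasure N] (h : ∀ k x, zonalMoment P k x = zonalMoment N k x) :
    P = N := by
  have hemb : MeasurableEmbedding ((↑) : Sph n → Ambient n) :=
    .subtype_coe Metric.isClosed_sphere.measurableSet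
  have hmap : P.map ((↑) : Sph n → Ambient n) = N.map (↑) := by
    refine Measure.ext_of_charFun (funext fun ξ => ?_)
    obtain ⟨r, x, rfl⟩ := exists_eq_smul_coe ξ
    have hP := hasSum_charFun_map_coe P r x
    simp only [h] at hP
    exact hP.unique (hasSum_charFun_map_coe N r x)
  rw [← hemb.comap_map P, hmap, hemb.comap_map]

theorem integral_inner_pow_mul_mul [IsFiniteMeasure m] (k : ℕ) {v : Sph n → ℝ} (hv : Continuous v) :
    ∫ q, inner ℝ (q.1 : Ambient n) q.2 ^ k * (v q.1 * v q.2) ∂m.prod m =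
      ∑ p : Fin k → Fin (n + 1), (∫ x, sphMonomial p x * v x ∂m) ^ 2 := by
  have hint : ∀ p : Fin k → Fin (n + 1), Integrable (fun x => sphMonomial p x * v x) m :=
    fun p => integrable_of_continuous (by fun_prop)
  simp only [inner_pow_eq_sum_sphMonomial, Finset.sum_mul, mul_mul_mul_comm]
  rw [integral_finsetSum _ fun p _ => (hint p).mul_prod (hint p)]
  refine Finset.sum_congr rfl fun p _ => ?_
  rw [integral_prod_mul (fun x => sphMonomial p x * v x) (fun x => sphMonomial p x * v x), sq]

theorem integral_zonalMoment_mul_eq_zero {P : Measure (Sph n)}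
    [IsFiniteMeasure P] [IsFiniteMeasure m] {v : Sph n → ℝ} (hv : Continuous v)
    (h : ∀ p : Fin k → Fin (n + 1), ∫ x, sphMonomial p x * v x ∂m = 0) :
    ∫ x, zonalMoment P k x * v x ∂m = 0 := by
  simp only [zonalMoment_eq_sum, Finset.sum_mul, mul_assoc]
  rw [integral_finsetSum _ fun p _ => (integrable_of_continuous (by fun_prop)).const_mul _]
  simp only [integral_const_mul, h, mul_zero, Finset.sum_const_zero]

end ZonalMoment

variable {P N m : Measure (Sph 2)} [IsFiniteMeasure m]

theorem integrable_log_chord_mul_prod {g : Sph 2 × Sph 2 → ℝ} (hg : Continuous g) :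
    Integrable (fun q => Real.log (chord q.1 q.2) * g q) (m.prod (sphVol 2)) := by
  obtain ⟨B, hB⟩ := isCompact_univ.exists_bound_of_continuousOn hg.continuousOn
  exact (integrable_log_chord_prod m).mul_bdd (c := B) hg.aestronglyMeasurable
    (.of_forall fun q => hB q (mem_univ q))

theorem integral_log_chord_mul_inner_pow_comm (k : ℕ) (x z : Sph 2) :
    ∫ y, Real.log (chord x y) * inner ℝ (y : Ambient 2) z ^ k ∂sphVol 2 =
      ∫ y, Real.log (chord z y) * inner ℝ (y : Ambient 2) x ^ k ∂sphVol 2 := by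
  obtain ⟨A, hx, hz⟩ := exists_sphMap_swap x z
  rw [← integral_sphMap A
    (g := fun y => Real.log (chord x y) * inner ℝ (y : Ambient 2) (z : Ambient 2) ^ k)
    ((measurable_chord measurable_const measurable_id).log.mul (by fun_prop))]
  have hchord : ∀ y, chord x (sphMap A y) = chord z y := fun y => by rw [← hz, chord_sphMap]
  have hinner : ∀ y : Sph 2, inner ℝ (sphMap A y : Ambient 2) z = inner ℝ (y : Ambient 2) x :=
    fun y => by rw [← hx, inner_sphMap]
  simp only [hchord, hinner]

theorem integrable_log_chord_mul (x : Sph 2) {v : Sph 2 → ℝ} (hv : Continuous v) :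
    Integrable (fun y => Real.log (chord x y) * v y) (sphVol 2) := by
  obtain ⟨B, hB⟩ := isCompact_univ.exists_bound_of_continuousOn hv.continuousOn
  exact (integrable_log_chord (lintegral_chordKernel_ne_top x)).mul_bdd (c := B)
    hv.aestronglyMeasurable (.of_forall fun y => hB y (mem_univ y))

theorem integrable_logPotential (m : Measure (Sph 2)) [IsFiniteMeasure m] :
    Integrable (logPotential m) (sphVol 2) := by
  unfold logPotential
  simpa only [chord_comm _ (_ : Sph 2)] using (integrable_log_chord_prod m).integral_prod_right

theorem integrable_logPotential_mul (m : Measure (Sph 2)) [IsFiniteMeasure m]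
    (k : ℕ) (x : Sph 2) :
    Integrable (fun y => logPotential m y * inner ℝ (y : Ambient 2) x ^ k)
      (sphVol 2) :=
  (integrable_logPotential m).mul_bdd (c := 1) (by fun_prop)
    (.of_forall fun y => norm_inner_pow_le_one k y x)

/-- The kernels `log (chord x y)` and `⟨y, z⟩ᵏ` are both zonal, hence commute as operators. -/
theorem integral_log_chord_mul_zonalMoment (m : Measure (Sph 2)) [IsFiniteMeasure m]
    (k : ℕ) (x : Sph 2) :
    ∫ y, Real.log (chord x y) * zonalMoment m k y ∂sphVol 2 =
      ∫ y, logPotential m y * inner ℝ (y : Ambient 2) x ^ k ∂sphVol 2 := by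
  calc ∫ y, Real.log (chord x y) * zonalMoment m k y ∂sphVol 2
      = ∫ y, ∫ z, Real.log (chord x y) * inner ℝ (y : Ambient 2) z ^ k ∂m ∂sphVol 2 := by
        simp only [integral_const_mul, zonalMoment]
    _ = ∫ z, ∫ y, Real.log (chord x y) * inner ℝ (y : Ambient 2) z ^ k ∂sphVol 2 ∂m :=
        integral_integral_swap
          (((integrable_log_chord (lintegral_chordKernel_ne_top x)).comp_fst m).mul_bdd (c := 1)
            (by fun_prop) (.of_forall fun p => norm_inner_pow_le_one k p.1 p.2))
    _ = ∫ z, ∫ y, Real.log (chord z y) * inner ℝ (y : Ambient 2) x ^ k ∂sphVol 2 ∂m := by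
        simp only [integral_log_chord_mul_inner_pow_comm k x]
    _ = ∫ y, ∫ z, Real.log (chord z y) * inner ℝ (y : Ambient 2) x ^ k ∂m ∂sphVol 2 :=
        integral_integral_swap
          (integrable_log_chord_mul_prod (g := fun p => inner ℝ (p.2 : Ambient 2) x ^ k)
            (by fun_prop))
    _ = ∫ y, logPotential m y * inner ℝ (y : Ambient 2) x ^ k ∂sphVol 2 := by
        simp only [integral_mul_const, chord_comm _ (_ : Sph 2), logPotential]

theorem neg_log_one_sub_abs_le (s : ℝ) :
    -Real.log (1 - |s|) ≤ |Real.log (1 - s)| + |Real.log (1 + s)| := by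
  rcases abs_cases s with ⟨h, _⟩ | ⟨h, _⟩
  · rw [h]
    linarith [neg_abs_le (Real.log (1 - s)), abs_nonneg (Real.log (1 + s))]
  · rw [h, sub_neg_eq_add]
    linarith [neg_abs_le (Real.log (1 + s)), abs_nonneg (Real.log (1 - s))]

theorem abs_inner_lt_one {n : ℕ} {x y : Sph n} (h : y ≠ x) (h' : y ≠ -x) :
    |inner ℝ (x : Ambient n) y| < 1 := by
  have hpos := chord_pos h.symm
  have hneg := chord_pos (x := x) (y := -y) fun e => h' (by rw [e, neg_neg])
  simp only [chord, coe_neg_sphere, inner_neg_right] at hpos hneg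
  exact abs_lt.mpr ⟨by linarith, by linarith⟩

theorem ae_prod_abs_inner_lt_one :
    ∀ᵐ q : Sph 2 × Sph 2 ∂(sphVol 2).prod (sphVol 2), |inner ℝ (q.1 : Ambient 2) q.2| < 1 := by
  refine (Measure.ae_prod_iff_ae_ae (measurableSet_lt (by fun_prop) measurable_const)).mpr
    (.of_forall fun x => ?_)
  filter_upwards [measure_eq_zero_iff_ae_notMem.mp
    (({x, -x} : Set (Sph 2)).toFinite.measure_zero (sphVol 2))] with y hy
  simp only [mem_insert_iff, mem_singleton_iff, not_or] at hy
  exact abs_inner_lt_one hy.1 hy.2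

theorem measurePreserving_neg_sphVol (n : ℕ) :
    MeasurePreserving (fun x : Sph n => -x) (sphVol n) (sphVol n) := by
  convert measurePreserving_sphMap (LinearIsometryEquiv.neg ℝ : Ambient n ≃ₗᵢ[ℝ] Ambient n) using 1
  funext x
  ext1
  simp

theorem integrable_log_one_sub_abs_inner :
    Integrable (fun q : Sph 2 × Sph 2 => Real.log (1 - |inner ℝ (q.1 : Ambient 2) q.2|))
      ((sphVol 2).prod (sphVol 2)) := by
  have hlog := integrable_log_chord_prod (sphVol 2)
  have hlog_neg : Integrable (fun q : Sph 2 × Sph 2 => Real.log (chord q.1 (-q.2)))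
      ((sphVol 2).prod (sphVol 2)) :=
    ((MeasurePreserving.id _).prod (measurePreserving_neg_sphVol 2)).integrable_comp_of_integrable
      hlog
  refine (hlog.abs.add hlog_neg.abs).mono' (Measurable.aestronglyMeasurable (by fun_prop)) ?_
  filter_upwards [ae_prod_abs_inner_lt_one] with q hq
  have hnonneg := abs_nonneg (inner ℝ (q.1 : Ambient 2) (q.2 : Ambient 2))
  rw [Real.norm_eq_abs, abs_of_nonpos (Real.log_nonpos (by linarith) (by linarith))]
  exact (neg_log_one_sub_abs_le _).trans_eq (by simp [chord])

/-- Expanding `-log (1 - s) = ∑ sʲ⁺¹ / (j + 1)` writes the logarithmic energy of a density as a sum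
of squares, up to the sign. -/
theorem hasSum_logEnergy {v : Sph 2 → ℝ} (hv : Continuous v) :
    HasSum (fun j : ℕ => ((j : ℝ) + 1)⁻¹ *
        ∑ p : Fin (j + 1) → Fin 3, (∫ x, sphMonomial p x * v x ∂sphVol 2) ^ 2)
      (-∫ q, Real.log (chord q.1 q.2) * (v q.1 * v q.2) ∂(sphVol 2).prod (sphVol 2)) := by
  obtain ⟨B, hB⟩ := isCompact_univ.exists_bound_of_continuousOn
    (f := fun q : Sph 2 × Sph 2 => v q.1 * v q.2) (by fun_prop)
  have hseries := fun (s : ℝ) (hs : |s| < 1) => Real.hasSum_pow_div_log_of_abs_lt_one hs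
  have hterm : ∀ j : ℕ, ((j : ℝ) + 1)⁻¹ *
      ∑ p : Fin (j + 1) → Fin 3, (∫ x, sphMonomial p x * v x ∂sphVol 2) ^ 2 =
      ∫ q, inner ℝ (q.1 : Ambient 2) q.2 ^ (j + 1) / (j + 1) * (v q.1 * v q.2)
        ∂(sphVol 2).prod (sphVol 2) := fun j => by
    rw [← integral_inner_pow_mul_mul (j + 1) hv, ← integral_const_mul]
    simp only [div_eq_inv_mul, mul_assoc]
  simp only [hterm, ← integral_neg, ← neg_mul]
  refine hasSum_integral_of_dominated_convergence
    (fun j q => |inner ℝ (q.1 : Ambient 2) q.2| ^ (j + 1) / (j + 1) * B)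
    (fun j => Continuous.aestronglyMeasurable (by fun_prop))
    (fun j => .of_forall fun q => ?_) ?_ ?_ ?_
  · rw [norm_mul, norm_div, norm_pow, Real.norm_eq_abs, Real.norm_of_nonneg
      (by positivity : (0 : ℝ) ≤ j + 1)]
    exact mul_le_mul_of_nonneg_left (hB q (mem_univ q)) (by positivity)
  · filter_upwards [ae_prod_abs_inner_lt_one] with q hq
    exact (hseries _ (by rwa [abs_abs])).summable.mul_right _
  · refine (integrable_log_one_sub_abs_inner.neg.mul_const B).congr ?_
    filter_upwards [ae_prod_abs_inner_lt_one] with q hq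
    rw [tsum_mul_right, (hseries _ (by rwa [abs_abs])).tsum_eq, Pi.neg_apply]
  · filter_upwards [ae_prod_abs_inner_lt_one] with q hq
    exact (hseries _ hq).mul_right _

theorem integral_sphMonomial_mul_eq_zero {v : Sph 2 → ℝ} (hv : Continuous v)
    (hlog : ∫ q, Real.log (chord q.1 q.2) * (v q.1 * v q.2) ∂(sphVol 2).prod (sphVol 2) = 0)
    {k : ℕ} (hk : k ≠ 0) (p : Fin k → Fin 3) : ∫ x, sphMonomial p x * v x ∂sphVol 2 = 0 := by
  obtain ⟨j, rfl⟩ := Nat.exists_eq_succ_of_ne_zero hk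
  have hsum := hasSum_logEnergy hv
  rw [hlog, neg_zero, hasSum_zero_iff_of_nonneg fun j => by positivity] at hsum
  have hsq := (mul_eq_zero.mp (congrFun hsum j)).resolve_left (by positivity)
  rw [Finset.sum_eq_zero_iff_of_nonneg fun p _ => sq_nonneg _] at hsq
  exact pow_eq_zero_iff two_ne_zero |>.mp (hsq p (Finset.mem_univ p))

section Uniqueness

variable [IsFiniteMeasure P] [IsFiniteMeasure N] {c : ℝ}

theorem integral_log_chord_mul_zonalMoment_sub
    (hc : ∀ᵐ x ∂sphVol 2, logPotential P x - logPotential N x = c)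
    (k : ℕ) (x : Sph 2) :
    ∫ y, Real.log (chord x y) * (zonalMoment P k y - zonalMoment N k y) ∂sphVol 2 =
      c * zonalMoment (sphVol 2) k north := by
  have hae : ∀ᵐ y ∂sphVol 2, logPotential P y * inner ℝ (y : Ambient 2) x ^ k -
      logPotential N y * inner ℝ (y : Ambient 2) x ^ k =
      c * inner ℝ (x : Ambient 2) y ^ k := by
    filter_upwards [hc] with y hy
    rw [← sub_mul, hy, real_inner_comm]
  simp only [mul_sub]
  rw [integral_sub (integrable_log_chord_mul x (continuous_zonalMoment P k))
      (integrable_log_chord_mul x (continuous_zonalMoment N k)),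
    integral_log_chord_mul_zonalMoment, integral_log_chord_mul_zonalMoment,
    ← integral_sub (integrable_logPotential_mul P k x)
      (integrable_logPotential_mul N k x),
    integral_congr_ae hae, integral_const_mul, zonalMoment_sphVol_eq k north x, zonalMoment]

theorem logEnergy_zonalMoment_sub_eq_zero (hPN : P univ = N univ)
    (hc : ∀ᵐ x ∂sphVol 2, logPotential P x - logPotential N x = c)
    (k : ℕ) :
    ∫ q, Real.log (chord q.1 q.2) * ((zonalMoment P k q.1 - zonalMoment N k q.1) *
      (zonalMoment P k q.2 - zonalMoment N k q.2)) ∂(sphVol 2).prod (sphVol 2) = 0 := by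
  rw [integral_prod _ (integrable_log_chord_mul_prod (by fun_prop))]
  simp only [mul_left_comm (Real.log _), integral_const_mul,
    integral_log_chord_mul_zonalMoment_sub hc k, integral_mul_const]
  rw [integral_sub (integrable_of_continuous (by fun_prop))
    (integrable_of_continuous (by fun_prop)), integral_zonalMoment P k north,
    integral_zonalMoment N k north, measureReal_def, hPN, measureReal_def, sub_self, zero_mul]

theorem zonalMoment_eq_of_logPotential_sub_eq (hPN : P univ = N univ)
    (hc : ∀ᵐ x ∂sphVol 2, logPotential P x - logPotential N x = c)
    (k : ℕ) (x : Sph 2) : zonalMoment P k x = zonalMoment N k x := by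
  rcases eq_or_ne k 0 with rfl | hk
  · rw [zonalMoment_zero, zonalMoment_zero, measureReal_def, hPN, measureReal_def]
  set v := fun x => zonalMoment P k x - zonalMoment N k x
  have hv : Continuous v := by fun_prop
  have hmoment := integral_sphMonomial_mul_eq_zero hv
    (logEnergy_zonalMoment_sub_eq_zero hPN hc k) hk
  have hsq : ∫ x, v x ^ 2 ∂sphVol 2 = 0 := by
    have hexpand : ∀ x, v x ^ 2 = zonalMoment P k x * v x - zonalMoment N k x * v x := fun x => by
      rw [← sub_mul, sq]
    simp only [hexpand]
    rw [integral_sub (integrable_of_continuous (by fun_prop))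
      (integrable_of_continuous (by fun_prop)), integral_zonalMoment_mul_eq_zero hv hmoment,
      integral_zonalMoment_mul_eq_zero hv hmoment, sub_zero]
  rw [integral_eq_zero_iff_of_nonneg (fun x => sq_nonneg _)
    (integrable_of_continuous (hv.pow 2))] at hsq
  have hzero := congrFun ((Continuous.ae_eq_iff_eq (sphVol 2) (hv.pow 2) continuous_zero).mp hsq) x
  exact sub_eq_zero.mp (pow_eq_zero_iff two_ne_zero |>.mp hzero)

theorem measure_eq_of_logPotential_sub_eq (hPN : P univ = N univ)
    (hc : ∀ᵐ x ∂sphVol 2, logPotential P x - logPotential N x = c) :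
    P = N :=
  measure_eq_of_zonalMoment_eq (zonalMoment_eq_of_logPotential_sub_eq hPN hc)

end Uniqueness

end Moments

section Potential

/-- The Green function `green x y` for `x ≠ y`, as a real number expressed through `chord x y`. -/
def greenReal (x y : Sph 2) : ℝ :=
  -(1 / (4 * Real.pi)) * Real.log (chord x y) + (Real.log 2 - 1) / (4 * Real.pi)

theorem green_eq_greenReal {x y : Sph 2} (h : x ≠ y) : green x y = greenReal x y := by
  have hd : 0 < dist x y := dist_pos.mpr h
  rw [green, greenReal, if_neg h, chord_eq_dist_sq, Real.log_div (by positivity) (by norm_num),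
    Real.log_div (by positivity) (by norm_num), Real.log_pow]
  congr 1
  field_simp
  push_cast
  ring

theorem ae_ne_of_lintegral_chordKernel_ne_top {n : ℕ} {m : Measure (Sph n)} {x : Sph n}
    (h : ∫⁻ y, chordKernel x y ∂m ≠ ⊤) : ∀ᵐ y ∂m, x ≠ y := by
  filter_upwards [ae_lt_top (by fun_prop) h] with y hy hxy
  exact hy.ne (hxy ▸ chordKernel_self x)

section Measure

variable {m : Measure (Sph 2)} {x : Sph 2}

theorem integrable_greenReal [IsFiniteMeasure m] (h : ∫⁻ y, chordKernel x y ∂m ≠ ⊤) :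
    Integrable (greenReal x) m :=
  ((integrable_log_chord h).const_mul _).add (integrable_const _)

theorem integral_greenReal [IsFiniteMeasure m] (h : ∫⁻ y, chordKernel x y ∂m ≠ ⊤) :
    ∫ y, greenReal x y ∂m = -(1 / (4 * Real.pi)) * logPotential m x +
      m.real univ * ((Real.log 2 - 1) / (4 * Real.pi)) := by
  simp only [greenReal]
  rw [integral_add ((integrable_log_chord h).const_mul _) (integrable_const _),
    integral_const_mul, integral_const, smul_eq_mul, logPotential]

theorem lintegral_toENNReal_green (h : ∫⁻ y, chordKernel x y ∂m ≠ ⊤) :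
    ∫⁻ y, (green x y).toENNReal ∂m = ∫⁻ y, ENNReal.ofReal (greenReal x y) ∂m := by
  refine lintegral_congr_ae ?_
  filter_upwards [ae_ne_of_lintegral_chordKernel_ne_top h] with y hy
  rw [green_eq_greenReal hy, EReal.real_coe_toENNReal]

theorem lintegral_toENNReal_neg_green (h : ∫⁻ y, chordKernel x y ∂m ≠ ⊤) :
    ∫⁻ y, (-green x y).toENNReal ∂m = ∫⁻ y, ENNReal.ofReal (-greenReal x y) ∂m := by
  refine lintegral_congr_ae ?_
  filter_upwards [ae_ne_of_lintegral_chordKernel_ne_top h] with y hy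
  rw [green_eq_greenReal hy, ← EReal.coe_neg, EReal.real_coe_toENNReal]

end Measure

theorem coe_ennreal_eq_coe_toReal {a : ℝ≥0∞} (h : a ≠ ⊤) : (a : EReal) = (a.toReal : EReal) := by
  lift a to NNReal using h
  rfl

variable {μ : SignedMeasure (Sph 2)} {x : Sph 2}

theorem potentialDefinedAt_of_lintegral_chordKernel_ne_top
    (hpos : ∫⁻ y, chordKernel x y ∂μ.toJordanDecomposition.posPart ≠ ⊤)
    (hneg : ∫⁻ y, chordKernel x y ∂μ.toJordanDecomposition.negPart ≠ ⊤) :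
    PotentialDefinedAt μ x := by
  rw [PotentialDefinedAt, potentialPos, lintegral_toENNReal_green hpos,
    lintegral_toENNReal_neg_green hneg]
  exact Or.inl (ENNReal.add_ne_top.mpr ⟨(integrable_greenReal hpos).lintegral_lt_top.ne,
    (integrable_greenReal hneg).neg.lintegral_lt_top.ne⟩)

theorem potential_eq_integral_greenReal_sub
    (hpos : ∫⁻ y, chordKernel x y ∂μ.toJordanDecomposition.posPart ≠ ⊤)
    (hneg : ∫⁻ y, chordKernel x y ∂μ.toJordanDecomposition.negPart ≠ ⊤) :
    potential μ x = (∫ y, greenReal x y ∂μ.toJordanDecomposition.posPart -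
      ∫ y, greenReal x y ∂μ.toJordanDecomposition.negPart : ℝ) := by
  have ipos := integrable_greenReal hpos
  have ineg := integrable_greenReal hneg
  have hpos₁ := ipos.lintegral_lt_top.ne
  have hpos₂ := ipos.neg.lintegral_lt_top.ne
  have hneg₁ := ineg.lintegral_lt_top.ne
  have hneg₂ := ineg.neg.lintegral_lt_top.ne
  simp only [Pi.neg_apply] at hpos₂ hneg₂
  rw [potential, potentialPos, potentialNeg, lintegral_toENNReal_green hpos,
    lintegral_toENNReal_green hneg, lintegral_toENNReal_neg_green hpos,
    lintegral_toENNReal_neg_green hneg,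
    coe_ennreal_eq_coe_toReal (ENNReal.add_ne_top.mpr ⟨hpos₁, hneg₂⟩),
    coe_ennreal_eq_coe_toReal (ENNReal.add_ne_top.mpr ⟨hpos₂, hneg₁⟩), ← EReal.coe_sub,
    ENNReal.toReal_add hpos₁ hneg₂, ENNReal.toReal_add hpos₂ hneg₁,
    integral_eq_lintegral_pos_part_sub_lintegral_neg_part ipos,
    integral_eq_lintegral_pos_part_sub_lintegral_neg_part ineg]
  congr 1
  ring

theorem posPart_real_sub_negPart_real (μ : SignedMeasure (Sph 2)) {s : Set (Sph 2)}
    (hs : MeasurableSet s) : μ.toJordanDecomposition.posPart.real s -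
      μ.toJordanDecomposition.negPart.real s = μ s := by
  have h := congrArg (fun ν => ν s) μ.toSignedMeasure_toJordanDecomposition
  simpa only [JordanDecomposition.toSignedMeasure, sub_apply,
    Measure.toSignedMeasure_apply_measurable hs] using h

theorem posPart_univ_eq_negPart_univ (hμ : μ univ = 0) :
    μ.toJordanDecomposition.posPart univ = μ.toJordanDecomposition.negPart univ := by
  have h := posPart_real_sub_negPart_real μ MeasurableSet.univ
  exact (measureReal_eq_measureReal_iff).mp (sub_eq_zero.mp (h.trans hμ))

theorem potential_eq_logPotential_sub (hμ : μ univ = 0)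
    (hpos : ∫⁻ y, chordKernel x y ∂μ.toJordanDecomposition.posPart ≠ ⊤)
    (hneg : ∫⁻ y, chordKernel x y ∂μ.toJordanDecomposition.negPart ≠ ⊤) :
    potential μ x = (-(1 / (4 * Real.pi)) * (logPotential μ.toJordanDecomposition.posPart x -
      logPotential μ.toJordanDecomposition.negPart x) : ℝ) := by
  rw [potential_eq_integral_greenReal_sub hpos hneg, integral_greenReal hpos,
    integral_greenReal hneg, measureReal_def, posPart_univ_eq_negPart_univ hμ, measureReal_def]
  congr 1
  ring

variable {f : RP 2 → ℝ≥0∞}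

theorem IsExpPotential.ae_eq_exp_logPotential (hf : IsExpPotential f μ) (hμ : μ univ = 0) :
    ∀ᵐ x ∂sphVol 2, f (proj x) = ENNReal.ofReal (Real.exp (-(1 / (4 * Real.pi)) *
      (logPotential μ.toJordanDecomposition.posPart x -
        logPotential μ.toJordanDecomposition.negPart x))) := by
  filter_upwards [ae_lintegral_chordKernel_ne_top μ.toJordanDecomposition.posPart,
    ae_lintegral_chordKernel_ne_top μ.toJordanDecomposition.negPart] with x hpos hneg
  rw [hf x (potentialDefinedAt_of_lintegral_chordKernel_ne_top hpos hneg),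
    potential_eq_logPotential_sub hμ hpos hneg, EReal.exp_coe]

theorem IsExpPotential.measure_eq_zero_of_ae_eq_const (hf : IsExpPotential f μ)
    (hμ : μ univ = 0) {c : ℝ≥0∞} (hc : (fun x => f (proj x)) =ᵐ[sphVol 2] fun _ => c) :
    μ = 0 := by
  have hparts : μ.toJordanDecomposition.posPart = μ.toJordanDecomposition.negPart := by
    refine measure_eq_of_logPotential_sub_eq (posPart_univ_eq_negPart_univ hμ)
      (c := -(4 * Real.pi) * Real.log c.toReal) ?_
    filter_upwards [hc, hf.ae_eq_exp_logPotential hμ] with x hconst hexp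
    rw [← hconst, hexp, ENNReal.toReal_ofReal (Real.exp_pos _).le, Real.log_exp]
    field_simp
  rw [← μ.toSignedMeasure_toJordanDecomposition, JordanDecomposition.toSignedMeasure]
  simp only [hparts, sub_self]

theorem IsExpPotential.eq_roundFactor (hf : IsExpPotential f 0) : f = roundFactor 2 := by
  funext p
  obtain ⟨x, rfl⟩ := Quotient.exists_rep p
  have hzero := SignedMeasure.toJordanDecomposition_zero (α := Sph 2)
  have hpos : potentialPos 0 x = 0 := by simp [potentialPos, hzero]
  have hneg : potentialNeg 0 x = 0 := by simp [potentialNeg, hzero]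
  have hfx := hf x (.inl (by simp [hpos]))
  rw [potential, hpos, hneg] at hfx
  simpa [proj, roundFactor] using hfx

theorem hasConstantCurvature_roundFactor : HasConstantCurvature (roundFactor 2) 0 :=
  ⟨1, fun s _ => by simp [curvatureMeasure, liftedArea, roundFactor, measureReal_def]⟩

end Potential

section DensityBounds

open Filter Topology

theorem exists_measure_nat_lt_le {α : Type*} [MeasurableSpace α] (m : Measure α)
    [IsFiniteMeasure m] {r : α → ℝ} (hr : Measurable r) {ε : ℝ≥0∞} (hε : 0 < ε) :
    ∃ M : ℕ, m {x | (M : ℝ) < r x} ≤ ε := by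
  have htendsto := tendsto_measure_iInter_atTop (μ := m) (s := fun n : ℕ => {x | (n : ℝ) < r x})
    (fun n => (measurableSet_lt measurable_const hr).nullMeasurableSet)
    (fun a b hab x (hx : (b : ℝ) < r x) => lt_of_le_of_lt (by exact_mod_cast hab) hx)
    ⟨0, measure_ne_top _ _⟩
  have hempty : ⋂ n : ℕ, {x | (n : ℝ) < r x} = ∅ := by
    ext x
    simp only [mem_iInter, mem_ofPred_eq, mem_empty_iff_false, iff_false, not_forall, not_lt]
    exact exists_nat_ge (r x)
  rw [hempty, measure_empty] at htendsto
  exact (htendsto.eventually (ge_mem_nhds hε)).exists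

theorem restrict_withDensity_le_smul {α : Type*} [MeasurableSpace α] {μ : Measure α}
    {f : α → ℝ≥0∞} {s : Set α} (hs : MeasurableSet s) {M : ℝ≥0∞} (h : ∀ x ∈ s, f x ≤ M) :
    (μ.withDensity f).restrict s ≤ M • μ := by
  rw [restrict_withDensity hs, ← withDensity_const]
  calc (μ.restrict s).withDensity f ≤ (μ.restrict s).withDensity fun _ => M :=
        withDensity_mono (ae_restrict_of_forall_mem hs h)
    _ ≤ μ.withDensity fun _ => M := by
        simp only [withDensity_const]
        gcongr
        exact Measure.restrict_le_self

end DensityBounds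

section PotentialBounds

variable {n : ℕ} {m : Measure (Sph n)} {x y : Sph n}

theorem exp_neg_mul_log_chord_le (h : x ≠ y) {a : ℝ} (ha : 0 ≤ a) (ha' : a ≤ 1 / 4) :
    Real.exp (-a * Real.log (chord x y)) ≤ 2 * chord x y ^ (-(1 / 4) : ℝ) := by
  have hpos := chord_pos h
  rw [mul_comm, ← Real.rpow_def_of_pos hpos]
  rcases le_total (chord x y) 1 with hle | hge
  · have := Real.rpow_le_rpow_of_exponent_ge hpos hle (by linarith : -(1 / 4) ≤ -a)
    have := Real.rpow_pos_of_pos hpos (-(1 / 4) : ℝ)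
    linarith
  · have hle_one : chord x y ^ (-a) ≤ 1 := Real.rpow_le_one_of_one_le_of_nonpos hge (by linarith)
    have hhalf : (2 : ℝ)⁻¹ ≤ chord x y ^ (-(1 / 4) : ℝ) :=
      calc (2 : ℝ)⁻¹ ≤ (chord x y)⁻¹ := by gcongr; exact chord_le_two x y
        _ = chord x y ^ (-1 : ℝ) := (Real.rpow_neg_one _).symm
        _ ≤ _ := Real.rpow_le_rpow_of_exponent_le hge (by norm_num)
    linarith

theorem integral_rpow_chord_le_toReal (h : ∫⁻ y, chordKernel x y ∂m ≠ ⊤) :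
    ∫ y, chord x y ^ (-(1 / 4) : ℝ) ∂m ≤ (∫⁻ y, chordKernel x y ∂m).toReal := by
  rw [integral_eq_lintegral_of_nonneg_ae
    (.of_forall fun y => Real.rpow_nonneg (chord_nonneg x y) _)
    ((measurable_chord measurable_const measurable_id).pow_const _).aestronglyMeasurable]
  exact ENNReal.toReal_mono h (lintegral_mono fun y => ofReal_rpow_chord_le x y)

theorem abs_logPotential_le_toReal (h : ∫⁻ y, chordKernel x y ∂m ≠ ⊤) :
    |logPotential m x| ≤ 4 * (∫⁻ y, chordKernel x y ∂m).toReal :=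
  calc |logPotential m x| ≤ ∫ y, |Real.log (chord x y)| ∂m := abs_integral_le_integral_abs
    _ ≤ ∫ y, 4 * chord x y ^ (-(1 / 4) : ℝ) ∂m :=
      integral_mono (integrable_log_chord h).abs ((integrable_rpow_chord h).const_mul 4)
        fun y => abs_log_chord_le x y
    _ ≤ _ := by
      rw [integral_const_mul]
      gcongr
      exact integral_rpow_chord_le_toReal h

section ExponentialIntegrability

variable {a : ℝ} (ha : 0 ≤ a) (ha' : a ≤ 1 / 4) (h : ∫⁻ y, chordKernel x y ∂m ≠ ⊤)
include ha ha' h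

theorem integrable_exp_neg_mul_log_chord :
    Integrable (fun y => Real.exp (-a * Real.log (chord x y))) m := by
  refine ((integrable_rpow_chord h).const_mul 2).mono'
    ((measurable_chord measurable_const measurable_id).log.const_mul _).exp.aestronglyMeasurable ?_
  filter_upwards [ae_ne_of_lintegral_chordKernel_ne_top h] with y hy
  rw [Real.norm_eq_abs, Real.abs_exp]
  exact exp_neg_mul_log_chord_le hy ha ha'

theorem integral_exp_neg_mul_log_chord_le :
    ∫ y, Real.exp (-a * Real.log (chord x y)) ∂m ≤ 2 * (∫⁻ y, chordKernel x y ∂m).toReal :=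
  calc ∫ y, Real.exp (-a * Real.log (chord x y)) ∂m
      ≤ ∫ y, 2 * chord x y ^ (-(1 / 4) : ℝ) ∂m := by
        refine integral_mono_ae (integrable_exp_neg_mul_log_chord ha ha' h)
          ((integrable_rpow_chord h).const_mul 2) ?_
        filter_upwards [ae_ne_of_lintegral_chordKernel_ne_top h] with y hy
        exact exp_neg_mul_log_chord_le hy ha ha'
    _ ≤ _ := by
        rw [integral_const_mul]
        gcongr
        exact integral_rpow_chord_le_toReal h

end ExponentialIntegrability

/- Jensen's inequality for the probability measure `m / m univ` (Brezis–Merle). -/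
theorem ofReal_exp_neg_mul_logPotential_le [IsFiniteMeasure m] {α : ℝ} (hα : 0 ≤ α)
    (hm : α * m.real univ ≤ 1 / 4) (h : ∫⁻ y, chordKernel x y ∂m ≠ ⊤) :
    ENNReal.ofReal (Real.exp (-α * logPotential m x)) ≤
      1 + ENNReal.ofReal (2 / m.real univ) * ∫⁻ y, chordKernel x y ∂m := by
  rcases eq_or_ne m 0 with rfl | hm0
  · simp [logPotential]
  have : NeZero m := ⟨hm0⟩
  have hmass : 0 < m.real univ := measureReal_univ_pos
  set a := α * m.real univ with ha_def
  have ha : 0 ≤ a := by positivity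
  have hjensen := convexOn_exp.map_average_le (μ := m)
    (f := fun y => -a * Real.log (chord x y)) Real.continuous_exp.continuousOn
    isClosed_univ (.of_forall fun _ => mem_univ _) ((integrable_log_chord h).const_mul _)
    (integrable_exp_neg_mul_log_chord ha hm h)
  have haverage : ⨍ y, -a * Real.log (chord x y) ∂m = -α * logPotential m x := by
    rw [average_eq, integral_const_mul, smul_eq_mul, logPotential, ha_def]
    field_simp
  rw [haverage, average_eq, smul_eq_mul] at hjensen
  calc ENNReal.ofReal (Real.exp (-α * logPotential m x))
      ≤ ENNReal.ofReal (2 / m.real univ * (∫⁻ y, chordKernel x y ∂m).toReal) := by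
        refine ENNReal.ofReal_le_ofReal (hjensen.trans ?_)
        rw [div_eq_inv_mul, mul_assoc]
        gcongr
        exact integral_exp_neg_mul_log_chord_le ha hm h
    _ = ENNReal.ofReal (2 / m.real univ) * ∫⁻ y, chordKernel x y ∂m := by
        rw [ENNReal.ofReal_mul (by positivity), ENNReal.ofReal_toReal h]
    _ ≤ _ := le_add_self

end PotentialBounds

section BoundedDensity

open Filter Topology

variable {m : Measure (Sph 2)} {C : ℝ≥0∞}

theorem lintegral_chordKernel_le_of_le_smul (h : m ≤ C • sphVol 2) (x : Sph 2) :
    ∫⁻ y, chordKernel x y ∂m ≤ C * chordKernelMass :=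
  (lintegral_mono' h le_rfl).trans_eq <| by
    rw [lintegral_smul_measure, smul_eq_mul, lintegral_chordKernel]

theorem lintegral_chordKernel_ne_top_of_le_smul (hC : C ≠ ⊤) (h : m ≤ C • sphVol 2) (x : Sph 2) :
    ∫⁻ y, chordKernel x y ∂m ≠ ⊤ :=
  ne_top_of_le_ne_top (ENNReal.mul_ne_top hC chordKernelMass_ne_top)
    (lintegral_chordKernel_le_of_le_smul h x)

/-- The logarithm of `chord`, cut off from below at level `-R`; these continuous kernels
approximate the potential of a measure of bounded density uniformly. -/
def truncLogChord {n : ℕ} (R : ℝ) (x y : Sph n) : ℝ := Real.log (max (chord x y) (Real.exp (-R)))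

theorem continuous_truncLogChord {n : ℕ} (R : ℝ) :
    Continuous fun p : Sph n × Sph n => truncLogChord R p.1 p.2 := by
  unfold truncLogChord
  have hpos (p : Sph n × Sph n) : max (chord p.1 p.2) (Real.exp (-R)) ≠ 0 :=
    (lt_max_of_lt_right (Real.exp_pos _)).ne'
  fun_prop (disch := exact hpos)

theorem abs_truncLogChord_le {n : ℕ} {R : ℝ} (hR : 1 ≤ R) (x y : Sph n) :
    |truncLogChord R x y| ≤ R := by
  have hpos : 0 < max (chord x y) (Real.exp (-R)) := lt_max_of_lt_right (Real.exp_pos _)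
  have hle : max (chord x y) (Real.exp (-R)) ≤ 2 :=
    max_le (chord_le_two x y) ((Real.exp_le_one_iff.mpr (by linarith)).trans one_le_two)
  refine abs_le.mpr ⟨?_, ?_⟩
  · exact (Real.le_log_iff_exp_le hpos).mpr (le_max_right _ _)
  · exact (Real.log_le_sub_one_of_pos hpos).trans (by linarith)

theorem abs_truncLogChord_sub_log_le {n : ℕ} {R : ℝ} (hR : 0 < R) {x y : Sph n} (h : x ≠ y) :
    |truncLogChord R x y - Real.log (chord x y)| ≤ 64 / R * chord x y ^ (-(1 / 4) : ℝ) := by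
  have hpos := chord_pos h
  rw [truncLogChord]
  rcases le_total (Real.exp (-R)) (chord x y) with hle | hle
  · rw [max_eq_left hle, sub_self, abs_zero]
    positivity
  · have hlog : Real.log (chord x y) ≤ -R := (Real.log_le_iff_le_exp hpos).mpr hle
    rw [max_eq_right hle, Real.log_exp, abs_of_nonneg (by linarith), div_mul_eq_mul_div,
      le_div_iff₀ hR]
    nlinarith [sq_log_chord_le x y]

theorem continuous_integral_truncLogChord [IsFiniteMeasure m] {R : ℝ} (hR : 1 ≤ R) :
    Continuous fun x => ∫ y, truncLogChord R x y ∂m :=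
  continuous_of_dominated (bound := fun _ => R)
    (fun x => ((continuous_truncLogChord R).comp (.prodMk_right x)).aestronglyMeasurable)
    (fun x => .of_forall (abs_truncLogChord_le hR x)) (integrable_const _)
    (.of_forall fun y => (continuous_truncLogChord R).comp (.prodMk_left y))

theorem abs_integral_truncLogChord_sub_logPotential_le [IsFiniteMeasure m] {R : ℝ} (hR : 1 ≤ R)
    {x : Sph 2} (h : ∫⁻ y, chordKernel x y ∂m ≠ ⊤) :
    |∫ y, truncLogChord R x y ∂m - logPotential m x| ≤
      64 / R * (∫⁻ y, chordKernel x y ∂m).toReal := by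
  have htrunc : Integrable (truncLogChord R x) m :=
    (integrable_const R).mono'
      ((continuous_truncLogChord R).comp (.prodMk_right x)).aestronglyMeasurable
      (.of_forall (abs_truncLogChord_le hR x))
  rw [logPotential, ← integral_sub htrunc (integrable_log_chord h), ← Real.norm_eq_abs]
  calc ‖∫ y, (truncLogChord R x y - Real.log (chord x y)) ∂m‖
      ≤ ∫ y, 64 / R * chord x y ^ (-(1 / 4) : ℝ) ∂m := by
        refine norm_integral_le_of_norm_le ((integrable_rpow_chord h).const_mul _) ?_
        filter_upwards [ae_ne_of_lintegral_chordKernel_ne_top h] with y hy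
        exact abs_truncLogChord_sub_log_le (by linarith) hy
    _ ≤ _ := by
        rw [integral_const_mul]
        gcongr
        exact integral_rpow_chord_le_toReal h

theorem continuous_logPotential [IsFiniteMeasure m] (hC : C ≠ ⊤) (h : m ≤ C • sphVol 2) :
    Continuous (logPotential m) := by
  have hR (N : ℕ) : (1 : ℝ) ≤ N + 1 := by simp
  have huniform : TendstoUniformly (fun (N : ℕ) x => ∫ y, truncLogChord (N + 1) x y ∂m)
      (logPotential m) atTop := by
    rw [Metric.tendstoUniformly_iff]
    intro ε hε
    have herror : Tendsto (fun N : ℕ => 64 / ((N : ℝ) + 1) * (C * chordKernelMass).toReal)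
        atTop (𝓝 0) := by
      simpa using (tendsto_const_nhds.div_atTop (tendsto_atTop_add_const_right _ (1 : ℝ)
        tendsto_natCast_atTop_atTop)).mul_const (C * chordKernelMass).toReal
    filter_upwards [herror.eventually (gt_mem_nhds hε)] with N hN x
    rw [dist_comm, Real.dist_eq]
    calc _ ≤ 64 / ((N : ℝ) + 1) * (∫⁻ y, chordKernel x y ∂m).toReal :=
          abs_integral_truncLogChord_sub_logPotential_le (hR N)
            (lintegral_chordKernel_ne_top_of_le_smul hC h x)
      _ ≤ 64 / ((N : ℝ) + 1) * (C * chordKernelMass).toReal := by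
          gcongr
          · exact ENNReal.mul_ne_top hC chordKernelMass_ne_top
          · exact lintegral_chordKernel_le_of_le_smul h x
      _ < ε := hN
  exact huniform.continuous
    (Eventually.of_forall fun N => continuous_integral_truncLogChord (hR N)).frequently

theorem mul_abs_log_chord_le {n : ℕ} (r : ℝ) (x y : Sph n) :
    r * |Real.log (chord x y)| ≤ 64 * chord x y ^ (-(1 / 4) : ℝ) + r ^ 2 := by
  nlinarith [sq_log_chord_le x y, sq_nonneg (r - |Real.log (chord x y)|),
    sq_abs (Real.log (chord x y)), sq_nonneg r, sq_nonneg (Real.log (chord x y))]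

theorem abs_logPotential_withDensity_le {r : Sph 2 → ℝ} (hr : Measurable r) (hr0 : ∀ x, 0 ≤ r x)
    (hr2 : ∫⁻ x, ENNReal.ofReal (r x ^ 2) ∂sphVol 2 ≠ ⊤) (x : Sph 2) :
    |logPotential ((sphVol 2).withDensity fun y => ENNReal.ofReal (r y)) x| ≤
      (64 * chordKernelMass + ∫⁻ y, ENNReal.ofReal (r y ^ 2) ∂sphVol 2).toReal := by
  have hfin : 64 * chordKernelMass + ∫⁻ y, ENNReal.ofReal (r y ^ 2) ∂sphVol 2 ≠ ⊤ :=
    ENNReal.add_ne_top.mpr ⟨ENNReal.mul_ne_top (by norm_num) chordKernelMass_ne_top, hr2⟩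
  refine (norm_integral_le_lintegral_norm (fun y => Real.log (chord x y))).trans
    (ENNReal.toReal_mono hfin ?_)
  have hlog : Measurable fun y => ENNReal.ofReal ‖Real.log (chord x y)‖ :=
    (measurable_chord measurable_const measurable_id).log.norm.ennreal_ofReal
  rw [lintegral_withDensity_eq_lintegral_mul _ hr.ennreal_ofReal hlog]
  calc ∫⁻ y, ENNReal.ofReal (r y) * ENNReal.ofReal ‖Real.log (chord x y)‖ ∂sphVol 2
      ≤ ∫⁻ y, (64 * chordKernel x y + ENNReal.ofReal (r y ^ 2)) ∂sphVol 2 := by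
        refine lintegral_mono fun y => ?_
        rw [← ENNReal.ofReal_mul (hr0 y), Real.norm_eq_abs]
        refine (ENNReal.ofReal_le_ofReal (mul_abs_log_chord_le (r y) x y)).trans ?_
        rw [ENNReal.ofReal_add
          (mul_nonneg (by norm_num) (Real.rpow_nonneg (chord_nonneg x y) _)) (sq_nonneg _),
          ENNReal.ofReal_mul (by norm_num)]
        gcongr
        · norm_num
        · exact ofReal_rpow_chord_le x y
    _ = _ := by
        rw [lintegral_add_left (by fun_prop), lintegral_const_mul _ (by fun_prop),
          lintegral_chordKernel]

end BoundedDensity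

section Bootstrap

/-- The conformal factor `w = c - (1/4π) ∫ log (|x - y|² / 2) dm(y)` determined by `m`. It solves
`Δ w + 1 = m` for the nonnegative Laplacian when `m` has the mass of the sphere. -/
def liouvilleFactor (c : ℝ) (m : Measure (Sph 2)) (x : Sph 2) : ℝ :=
  c - 1 / (4 * Real.pi) * logPotential m x

theorem measurable_liouvilleFactor (c : ℝ) (m : Measure (Sph 2)) [SFinite m] :
    Measurable (liouvilleFactor c m) :=
  ((measurable_logPotential m).const_mul _).const_sub _

/-- The curvature equation of `e^{2w} g₀` for curvature one: `m` is the area measure of the metric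
whose conformal factor it determines. -/
def IsLiouvilleMeasure (c : ℝ) (m : Measure (Sph 2)) : Prop :=
  m = (sphVol 2).withDensity fun x => ENNReal.ofReal (Real.exp (2 * liouvilleFactor c m x))

variable {m : Measure (Sph 2)} [IsFiniteMeasure m] {c : ℝ}

theorem logPotential_eq_add_compl {n : ℕ} {m : Measure (Sph n)} {s : Set (Sph n)} {x : Sph n}
    (hs : MeasurableSet s) (h : ∫⁻ y, chordKernel x y ∂m ≠ ⊤) :
    logPotential m x = logPotential (m.restrict s) x + logPotential (m.restrict sᶜ) x :=
  (integral_add_compl hs (integrable_log_chord h)).symm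

theorem ofReal_exp_liouvilleFactor_sq_le {s : Set (Sph 2)} (hs : MeasurableSet s) {M : ℝ≥0∞}
    (hM : M ≠ ⊤) (hcompl : m.restrict sᶜ ≤ M • sphVol 2)
    (hmass : (m.restrict s).real univ ≤ Real.pi / 4) {x : Sph 2}
    (hx : ∫⁻ y, chordKernel x y ∂m ≠ ⊤) :
    ENNReal.ofReal (Real.exp (2 * liouvilleFactor c m x) ^ 2) ≤
      ENNReal.ofReal (Real.exp (4 * c + 4 * (M * chordKernelMass).toReal / Real.pi)) *
        (1 + ENNReal.ofReal (2 / (m.restrict s).real univ) *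
          ∫⁻ y, chordKernel x y ∂m.restrict s) := by
  have hpi := Real.pi_pos
  have hxs : ∫⁻ y, chordKernel x y ∂m.restrict s ≠ ⊤ :=
    ne_top_of_le_ne_top hx (setLIntegral_le_lintegral _ _)
  have hsmall := ofReal_exp_neg_mul_logPotential_le (α := 1 / Real.pi) (by positivity)
    (by field_simp; linarith) hxs
  refine le_trans ?_ (mul_le_mul_right hsmall _)
  rw [← ENNReal.ofReal_mul (Real.exp_pos _).le, ← Real.exp_add, ← Real.exp_nat_mul]
  refine ENNReal.ofReal_le_ofReal (Real.exp_le_exp.mpr ?_)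
  have hbounded : -(logPotential (m.restrict sᶜ) x) ≤ 4 * (M * chordKernelMass).toReal :=
    (neg_le_abs _).trans <|
      (abs_logPotential_le_toReal (lintegral_chordKernel_ne_top_of_le_smul hM hcompl x)).trans <|
        mul_le_mul_of_nonneg_left (ENNReal.toReal_mono (ENNReal.mul_ne_top hM
          chordKernelMass_ne_top) (lintegral_chordKernel_le_of_le_smul hcompl x)) (by norm_num)
  calc ((2 : ℕ) : ℝ) * (2 * liouvilleFactor c m x)
      = 4 * c + -(logPotential (m.restrict sᶜ) x) / Real.pi +
          -(1 / Real.pi) * logPotential (m.restrict s) x := by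
        rw [liouvilleFactor, logPotential_eq_add_compl hs hx]
        push_cast
        field_simp
        ring
    _ ≤ _ := by gcongr

theorem IsLiouvilleMeasure.lintegral_exp_sq_ne_top (hm : IsLiouvilleMeasure c m) :
    ∫⁻ x, ENNReal.ofReal (Real.exp (2 * liouvilleFactor c m x) ^ 2) ∂sphVol 2 ≠ ⊤ := by
  have hdensity : Measurable fun x => Real.exp (2 * liouvilleFactor c m x) :=
    ((measurable_liouvilleFactor c m).const_mul 2).exp
  obtain ⟨M, hM⟩ := exists_measure_nat_lt_le m hdensity
    (ENNReal.ofReal_pos.mpr (by positivity : 0 < Real.pi / 4))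
  set s := {x | (M : ℝ) < Real.exp (2 * liouvilleFactor c m x)}
  have hs : MeasurableSet s := measurableSet_lt measurable_const hdensity
  have hcompl : m.restrict sᶜ ≤ (M : ℝ≥0∞) • sphVol 2 := by
    nth_rewrite 1 [hm]
    refine restrict_withDensity_le_smul hs.compl fun x hx => ?_
    exact (ENNReal.ofReal_le_ofReal (not_lt.mp hx)).trans_eq (ENNReal.ofReal_natCast M)
  have hmass : (m.restrict s).real univ ≤ Real.pi / 4 := by
    rw [measureReal_restrict_apply_univ, measureReal_def]
    exact ENNReal.toReal_le_of_le_ofReal (by positivity) hM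
  refine ne_top_of_le_ne_top ?_ (lintegral_mono_ae ((ae_lintegral_chordKernel_ne_top m).mono
    fun x => ofReal_exp_liouvilleFactor_sq_le hs (ENNReal.natCast_ne_top M) hcompl hmass))
  have hkernel : Measurable fun x => ∫⁻ y, chordKernel x y ∂m.restrict s :=
    (by fun_prop : Measurable fun p : Sph 2 × Sph 2 => chordKernel p.1 p.2).lintegral_prod_right'
  rw [lintegral_const_mul _ (by fun_prop), lintegral_add_left measurable_const,
    lintegral_const_mul _ hkernel, lintegral_lintegral_chordKernel, lintegral_const]
  finiteness [chordKernelMass_ne_top]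

theorem IsLiouvilleMeasure.exists_le_smul_sphVol (hm : IsLiouvilleMeasure c m) :
    ∃ C : ℝ≥0∞, C ≠ ⊤ ∧ m ≤ C • sphVol 2 := by
  obtain ⟨B, hB⟩ : ∃ B : ℝ, ∀ x, |logPotential m x| ≤ B := by
    rw [hm]
    exact ⟨_, abs_logPotential_withDensity_le ((measurable_liouvilleFactor c m).const_mul 2).exp
      (fun x => (Real.exp_pos _).le) hm.lintegral_exp_sq_ne_top⟩
  refine ⟨ENNReal.ofReal (Real.exp (2 * (c + 1 / (4 * Real.pi) * B))), ENNReal.ofReal_ne_top, ?_⟩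
  nth_rewrite 1 [hm]
  rw [← Measure.restrict_univ (μ := (sphVol 2).withDensity _)]
  refine restrict_withDensity_le_smul .univ fun x _ =>
    ENNReal.ofReal_le_ofReal (Real.exp_le_exp.mpr ?_)
  have := mul_le_mul_of_nonneg_left (abs_le.mp (hB x)).1
    (by positivity : 0 ≤ 1 / (4 * Real.pi))
  rw [liouvilleFactor]
  linarith

theorem IsLiouvilleMeasure.continuous_liouvilleFactor (hm : IsLiouvilleMeasure c m) :
    Continuous (liouvilleFactor c m) := by
  obtain ⟨C, hC, hle⟩ := hm.exists_le_smul_sphVol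
  exact continuous_const.sub ((continuous_logPotential hC hle).const_mul _)

end Bootstrap

section Liouville

/-- A continuous solution of the Liouville equation on the sphere, in integral form: a metric
`e^{2w} g₀` of curvature one and area `4π`. -/
structure IsLiouville (w : Sph 2 → ℝ) : Prop where
  continuous : Continuous w
  mass : ∫ x, Real.exp (2 * w x) ∂sphVol 2 = 4 * Real.pi
  eq : ∃ c : ℝ, ∀ x, w x = c - 1 / (4 * Real.pi) *
    ∫ y, Real.log (chord x y) * Real.exp (2 * w y) ∂sphVol 2

theorem logPotential_sphVol (x : Sph 2) :
    logPotential (sphVol 2) x = logPotential (sphVol 2) north := by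
  obtain ⟨A, hA⟩ := exists_sphMap_eq north x
  have hlog : Measurable fun y => Real.log (chord x y) :=
    (measurable_chord measurable_const measurable_id).log
  rw [logPotential, logPotential, ← integral_sphMap A hlog]
  simp only [← hA, chord_sphMap]

theorem IsLiouvilleMeasure.isLiouville {m : Measure (Sph 2)} [IsFiniteMeasure m] {c : ℝ}
    (hm : IsLiouvilleMeasure c m) (hmass : m univ = sphVol 2 univ) :
    IsLiouville (liouvilleFactor c m) := by
  have hcont := hm.continuous_liouvilleFactor
  have hdensity : Continuous fun x => Real.exp (2 * liouvilleFactor c m x) := by fun_prop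
  refine ⟨hcont, ?_, c, fun x => ?_⟩
  · rw [integral_eq_lintegral_of_nonneg_ae (.of_forall fun x => (Real.exp_pos _).le)
      hdensity.aestronglyMeasurable, ← setLIntegral_univ, ← withDensity_apply _ .univ, ← hm,
      hmass, sphVol_two_univ, ENNReal.toReal_ofReal (by positivity)]
  · have hpotential : logPotential m x =
        ∫ y, Real.log (chord x y) * Real.exp (2 * liouvilleFactor c m y) ∂sphVol 2 := by
      rw [logPotential]
      nth_rewrite 1 [hm]
      rw [integral_withDensity_eq_integral_toReal_smul hdensity.measurable.ennreal_ofReal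
        (.of_forall fun _ => ENNReal.ofReal_lt_top)]
      simp only [smul_eq_mul, ENNReal.toReal_ofReal (Real.exp_pos _).le, mul_comm]
    rw [← hpotential, liouvilleFactor]

section ConstantCurvature

variable {μ : SignedMeasure (Sph 2)} {f : RP 2 → ℝ≥0∞}

theorem HasConstantCurvature.exists_pos (hK : HasConstantCurvature f μ) (hμ : μ univ = 0) :
    liftedArea f univ ≠ ⊤ ∧ ∃ K : ℝ, 0 < K ∧ ∀ s, MeasurableSet s →
      curvatureMeasure μ s = K * (liftedArea f s).toReal := by
  obtain ⟨K, hK⟩ := hK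
  have hgauss_bonnet : 4 * Real.pi = K * (liftedArea f univ).toReal := by
    rw [← hK univ .univ, curvatureMeasure, hμ, measureReal_def, sphVol_two_univ,
      ENNReal.toReal_ofReal (by positivity), add_zero]
  have hpos : 0 < K * (liftedArea f univ).toReal := hgauss_bonnet ▸ by positivity
  refine ⟨fun htop => by simp [htop] at hpos, K,
    pos_of_mul_pos_left hpos ENNReal.toReal_nonneg, hK⟩

theorem ae_eq_ofReal_mul_sq_of_eq_exp {w : Sph 2 → ℝ} {K : ℝ} (hK : 0 < K)
    (h : ∀ᵐ x ∂sphVol 2, f (proj x) = ENNReal.ofReal (Real.exp (w x))) :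
    ∀ᵐ x ∂sphVol 2, ENNReal.ofReal (Real.exp (2 * (Real.log K / 2 + w x))) =
      ENNReal.ofReal K * f (proj x) ^ 2 := by
  filter_upwards [h] with x hx
  rw [hx, ← ENNReal.ofReal_pow (Real.exp_pos _).le, ← ENNReal.ofReal_mul hK.le,
    ← Real.exp_nat_mul, mul_add, mul_div_cancel₀ _ two_ne_zero, Real.exp_add, Real.exp_log hK,
    Nat.cast_ofNat]

theorem posPart_add_sphVol_eq {m : Measure (Sph 2)} [IsFiniteMeasure m]
    (hm : ∀ s, MeasurableSet s → curvatureMeasure μ s = m.real s) :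
    μ.toJordanDecomposition.posPart + sphVol 2 = m + μ.toJordanDecomposition.negPart := by
  ext s hs
  rw [← measureReal_eq_measureReal_iff, measureReal_add_apply, measureReal_add_apply, ← hm s hs,
    curvatureMeasure, ← posPart_real_sub_negPart_real μ hs]
  ring

theorem logPotential_add {n : ℕ} {m m' : Measure (Sph n)} {x : Sph n}
    (h : ∫⁻ y, chordKernel x y ∂m ≠ ⊤) (h' : ∫⁻ y, chordKernel x y ∂m' ≠ ⊤) :
    logPotential (m + m') x = logPotential m x + logPotential m' x :=
  integral_add_measure (integrable_log_chord h) (integrable_log_chord h')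

theorem ae_logPotential_sub_eq {P N m : Measure (Sph 2)} [IsFiniteMeasure P] [IsFiniteMeasure N]
    [IsFiniteMeasure m] (h : P + sphVol 2 = m + N) :
    ∀ᵐ x ∂sphVol 2, logPotential P x - logPotential N x =
      logPotential m x - logPotential (sphVol 2) north := by
  filter_upwards [ae_lintegral_chordKernel_ne_top P, ae_lintegral_chordKernel_ne_top N,
    ae_lintegral_chordKernel_ne_top m] with x hP hN hm
  have hsum := congrArg (fun ν : Measure (Sph 2) => logPotential ν x) h
  simp only [logPotential_add hP (lintegral_chordKernel_ne_top x), logPotential_add hm hN,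
    logPotential_sphVol] at hsum
  linarith

theorem HasConstantCurvature.exists_isLiouvilleMeasure (hK : HasConstantCurvature f μ)
    (hf : IsExpPotential f μ) (hμ : μ univ = 0) :
    ∃ (m : Measure (Sph 2)) (c b : ℝ), IsFiniteMeasure m ∧ m univ = sphVol 2 univ ∧
      IsLiouvilleMeasure c m ∧
      ∀ᵐ x ∂sphVol 2, f (proj x) = ENNReal.ofReal (Real.exp (liouvilleFactor c m x + b)) := by
  obtain ⟨harea, K, hKpos, hK⟩ := hK.exists_pos hμ
  set P := μ.toJordanDecomposition.posPart with hP_def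
  set N := μ.toJordanDecomposition.negPart
  set u : Sph 2 → ℝ := fun x => -(1 / (4 * Real.pi)) * (logPotential P x - logPotential N x)
  have hfu : ∀ᵐ x ∂sphVol 2, f (proj x) = ENNReal.ofReal (Real.exp (u x)) :=
    hf.ae_eq_exp_logPotential hμ
  set m := (sphVol 2).withDensity fun x =>
    ENNReal.ofReal (Real.exp (2 * (Real.log K / 2 + u x))) with hm_def
  have hm (s : Set (Sph 2)) (hs : MeasurableSet s) : m s = ENNReal.ofReal K * liftedArea f s := by
    rw [hm_def, withDensity_apply _ hs, liftedArea,
      ← lintegral_const_mul' _ _ ENNReal.ofReal_ne_top]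
    exact lintegral_congr_ae (ae_restrict_of_ae (ae_eq_ofReal_mul_sq_of_eq_exp hKpos hfu))
  have hfinite : IsFiniteMeasure m :=
    ⟨hm univ .univ ▸ (ENNReal.mul_ne_top ENNReal.ofReal_ne_top harea).lt_top⟩
  have hbalance : P + sphVol 2 = m + N := posPart_add_sphVol_eq fun s hs => by
    rw [hK s hs, measureReal_def, hm s hs, ENNReal.toReal_mul, ENNReal.toReal_ofReal hKpos.le]
  have hmass : m univ = sphVol 2 univ := by
    have huniv := congrArg (fun ν : Measure (Sph 2) => ν univ) hbalance
    simp only [Measure.add_apply, hP_def, posPart_univ_eq_negPart_univ hμ] at huniv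
    rw [add_comm] at huniv
    exact ((ENNReal.add_left_inj (measure_ne_top _ _)).mp huniv).symm
  set c := Real.log K / 2 + 1 / (4 * Real.pi) * logPotential (sphVol 2) north with hc_def
  have hw : ∀ᵐ x ∂sphVol 2, Real.log K / 2 + u x = liouvilleFactor c m x := by
    filter_upwards [ae_logPotential_sub_eq hbalance] with x hx
    simp only [liouvilleFactor, u, hx, hc_def]
    ring
  refine ⟨m, c, -(Real.log K / 2), hfinite, hmass, ?_, ?_⟩
  · exact withDensity_congr_ae (hw.mono fun x hx => by simp only [hx])
  · filter_upwards [hfu, hw] with x hx hx'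
    rw [hx, ← hx', add_neg_cancel_comm]

theorem neg_eq_of_ae_eq_exp {w : Sph 2 → ℝ} (hw : Continuous w) {b : ℝ}
    (h : ∀ᵐ x ∂sphVol 2, f (proj x) = ENNReal.ofReal (Real.exp (w x + b))) (x : Sph 2) :
    w (-x) = w x := by
  have hneg := (measurePreserving_neg_sphVol 2).quasiMeasurePreserving.ae h
  refine congrFun (Measure.eq_of_ae_eq (μ := sphVol 2) ?_ (hw.comp continuous_neg) hw) x
  filter_upwards [h, hneg] with x hx hx'
  rw [proj_neg, hx, ENNReal.ofReal_eq_ofReal_iff (Real.exp_pos _).le (Real.exp_pos _).le,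
    Real.exp_eq_exp] at hx'
  simp only [Function.comp_apply]
  linarith

end ConstantCurvature

end Liouville

section CylinderReflection

/-- The reflection of the cylinder in the circle `t = a`. -/
def cylinderRefl (a : ℝ) (p : ℝ × ℝ) : ℝ × ℝ := (2 * a - p.1, p.2)

theorem cylinderRefl_involutive (a : ℝ) : Function.Involutive (cylinderRefl a) := fun p => by
  simp [cylinderRefl]

theorem continuous_cylinderRefl (a : ℝ) : Continuous (cylinderRefl a) := by
  unfold cylinderRefl
  fun_prop

theorem measurePreserving_cylinderRefl (a : ℝ) :
    MeasurePreserving (cylinderRefl a) cylinderVol cylinderVol :=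
  (Measure.measurePreserving_sub_left volume (2 * a)).prod (MeasurePreserving.id _)

theorem integral_cylinderRefl (a : ℝ) (F : ℝ × ℝ → ℝ) :
    ∫ p, F (cylinderRefl a p) ∂cylinderVol = ∫ p, F p ∂cylinderVol :=
  (measurePreserving_cylinderRefl a).integral_comp (MeasurableEquiv.ofInvolutive _
    (cylinderRefl_involutive a) (continuous_cylinderRefl a).measurable).measurableEmbedding F

theorem integrable_cylinderRefl (a : ℝ) {F : ℝ × ℝ → ℝ} (hF : Integrable F cylinderVol) :
    Integrable (fun p => F (cylinderRefl a p)) cylinderVol :=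
  (measurePreserving_cylinderRefl a).integrable_comp_of_integrable hF

theorem integrable_cylinderVol_fst {g : ℝ → ℝ} (hg : Integrable g) :
    Integrable (fun p : ℝ × ℝ => g p.1) cylinderVol :=
  hg.comp_fst _

theorem integral_cylinderVol_fst (g : ℝ → ℝ) :
    ∫ p, g p.1 ∂cylinderVol = 2 * Real.pi * ∫ t, g t := by
  rw [cylinderVol, integral_fun_fst, measureReal_restrict_apply_univ, smul_eq_mul,
    Real.volume_real_Ioo_of_le (by linarith [Real.pi_pos])]
  ring

theorem ae_fst_ne (t : ℝ) : ∀ᵐ p ∂cylinderVol, p.1 ≠ t :=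
  Measure.quasiMeasurePreserving_fst.ae (Measure.ae_ne volume t)

theorem integrable_exp_neg_abs : Integrable fun t : ℝ => Real.exp (-|t|) := by
  simpa only [one_mul] using integrable_exp_neg_mul_abs one_pos

theorem integrable_exp_neg_abs_fst :
    Integrable (fun q : ℝ × ℝ => Real.exp (-|q.1|)) cylinderVol :=
  integrable_cylinderVol_fst integrable_exp_neg_abs

end CylinderReflection

section ReflectedKernel

/-- The chord function of the sphere in cylindrical coordinates, up to the conformal factors
`cosh t` and `cosh t'`. -/
def cylinderChord (p q : ℝ × ℝ) : ℝ := Real.cosh (p.1 - q.1) - Real.cos (p.2 - q.2)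

theorem chord_mercator (p q : ℝ × ℝ) : chord (mercator p) (mercator q) =
    cylinderChord p q / (Real.cosh p.1 * Real.cosh q.1) :=
  one_sub_inner_mercator p q

theorem cylinderChord_cylinderRefl_cylinderRefl (a : ℝ) (p q : ℝ × ℝ) :
    cylinderChord (cylinderRefl a p) (cylinderRefl a q) = cylinderChord p q := by
  unfold cylinderChord cylinderRefl
  rw [← Real.cosh_neg]
  ring_nf

theorem cosh_sub_one_le_cylinderChord (p q : ℝ × ℝ) :
    Real.cosh (p.1 - q.1) - 1 ≤ cylinderChord p q :=
  sub_le_sub_left (Real.cos_le_one _) _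

theorem cylinderChord_nonneg (p q : ℝ × ℝ) : 0 ≤ cylinderChord p q :=
  (sub_nonneg.mpr (Real.one_le_cosh _)).trans (cosh_sub_one_le_cylinderChord p q)

theorem cylinderChord_pos {p q : ℝ × ℝ} (h : q.1 ≠ p.1) : 0 < cylinderChord p q :=
  (sub_pos.mpr (Real.one_lt_cosh.mpr (sub_ne_zero.mpr h.symm))).trans_le
    (cosh_sub_one_le_cylinderChord p q)

theorem log_chord_mercator {p q : ℝ × ℝ} (h : q.1 ≠ p.1) :
    Real.log (chord (mercator p) (mercator q)) =
      Real.log (cylinderChord p q) - Real.log (Real.cosh p.1) - Real.log (Real.cosh q.1) := by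
  have hp := (Real.cosh_pos p.1).ne'
  have hq := (Real.cosh_pos q.1).ne'
  rw [chord_mercator, Real.log_div (cylinderChord_pos h).ne' (mul_ne_zero hp hq),
    Real.log_mul hp hq, sub_sub]

theorem cylinderChord_le_cylinderChord_cylinderRefl {a : ℝ} {p q : ℝ × ℝ} (hp : a ≤ p.1)
    (hq : a ≤ q.1) : cylinderChord p q ≤ cylinderChord (cylinderRefl a p) q := by
  unfold cylinderChord cylinderRefl
  dsimp only
  gcongr
  rw [Real.cosh_le_cosh]
  exact sq_le_sq.mp (by nlinarith)

theorem cylinderChord_lt_cylinderChord_cylinderRefl {a : ℝ} {p q : ℝ × ℝ} (hp : a < p.1)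
    (hq : a < q.1) : cylinderChord p q < cylinderChord (cylinderRefl a p) q := by
  unfold cylinderChord cylinderRefl
  dsimp only
  gcongr
  rw [Real.cosh_lt_cosh]
  exact sq_lt_sq.mp (by nlinarith)

/-- The difference of the logarithmic kernel and its reflection in the circle `t = a`: the
kernel of the moving plane argument. -/
def reflectedKernel (a : ℝ) (p q : ℝ × ℝ) : ℝ :=
  Real.log (cylinderChord (cylinderRefl a p) q) - Real.log (cylinderChord p q)

theorem reflectedKernel_cylinderRefl (a : ℝ) (p q : ℝ × ℝ) :
    reflectedKernel a p (cylinderRefl a q) = -reflectedKernel a p q := by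
  unfold reflectedKernel
  rw [cylinderChord_cylinderRefl_cylinderRefl,
    ← cylinderChord_cylinderRefl_cylinderRefl a p (cylinderRefl a q),
    cylinderRefl_involutive, neg_sub]

variable {a : ℝ} {p q : ℝ × ℝ}

theorem reflectedKernel_nonneg (hp : a ≤ p.1) (hq : a ≤ q.1) (hne : q.1 ≠ p.1) :
    0 ≤ reflectedKernel a p q :=
  sub_nonneg.mpr (Real.log_le_log (cylinderChord_pos hne)
    (cylinderChord_le_cylinderChord_cylinderRefl hp hq))

theorem reflectedKernel_pos (hp : a < p.1) (hq : a < q.1) (hne : q.1 ≠ p.1) :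
    0 < reflectedKernel a p q :=
  sub_pos.mpr (Real.log_lt_log (cylinderChord_pos hne)
    (cylinderChord_lt_cylinderChord_cylinderRefl hp hq))

end ReflectedKernel

section SingularWeight

/-- The weight `|s|^(-1/4)`. Its square dominates the logarithmic singularity of
`reflectedKernel`, while its cube is still locally integrable. -/
def singularWeight (s : ℝ) : ℝ := |s| ^ (-(1 / 4) : ℝ)

theorem singularWeight_nonneg (s : ℝ) : 0 ≤ singularWeight s := Real.rpow_nonneg (abs_nonneg s) _

theorem measurable_singularWeight : Measurable singularWeight := by
  unfold singularWeight
  fun_prop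

theorem singularWeight_pow_eight (s : ℝ) : singularWeight s ^ 8 = (s ^ 2)⁻¹ := by
  rw [singularWeight, ← Real.rpow_mul_natCast (abs_nonneg s), ← sq_abs s,
    ← Real.rpow_natCast (|s|) 2, ← Real.rpow_neg (abs_nonneg s)]
  norm_num

theorem singularWeight_pow_three (s : ℝ) : singularWeight s ^ 3 = |s| ^ (-(3 / 4) : ℝ) := by
  rw [singularWeight, ← Real.rpow_mul_natCast (abs_nonneg s)]
  norm_num

theorem sq_div_two_le_cosh_sub_one (s : ℝ) : s ^ 2 / 2 ≤ Real.cosh s - 1 := by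
  have hhalf : (s / 2) ^ 2 ≤ Real.sinh (s / 2) ^ 2 := by
    rw [sq_le_sq, Real.abs_sinh]
    exact Real.self_le_sinh_iff.mpr (abs_nonneg _)
  have hdouble := Real.cosh_two_mul (s / 2)
  rw [mul_div_cancel₀ s two_ne_zero, Real.cosh_sq] at hdouble
  linarith

theorem cosh_add_le (s : ℝ) {b : ℝ} (hb : 0 ≤ b) :
    Real.cosh (s + b) ≤ Real.exp b * Real.cosh s := by
  rw [Real.cosh_add, ← Real.cosh_add_sinh]
  nlinarith [Real.sinh_nonneg_iff.mpr hb, Real.sinh_lt_cosh s]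

theorem log_cosh_sub_log_cosh_sub_one_le {s : ℝ} (hs : s ≠ 0) :
    Real.log (Real.cosh s) - Real.log (Real.cosh s - 1) ≤ 5 * singularWeight s ^ 2 := by
  have hcosh := Real.cosh_pos s
  have hsub : 0 < Real.cosh s - 1 := sub_pos.mpr (Real.one_lt_cosh.mpr hs)
  have hnonneg := singularWeight_nonneg s
  have hratio : Real.cosh s / (Real.cosh s - 1) ≤ 1 + 2 * singularWeight s ^ 8 := by
    have hinv : (s ^ 2)⁻¹ * s ^ 2 = 1 := inv_mul_cancel₀ (by positivity)
    rw [singularWeight_pow_eight, div_le_iff₀ hsub]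
    nlinarith [mul_le_mul_of_nonneg_left (sq_div_two_le_cosh_sub_one s)
      (inv_nonneg.mpr (sq_nonneg s))]
  have hpow : 1 + 2 * singularWeight s ^ 8 ≤ (1 + 5 / 4 * singularWeight s ^ 2) ^ 4 := by
    nlinarith [pow_nonneg hnonneg 2, pow_nonneg hnonneg 4, pow_nonneg hnonneg 6,
      pow_nonneg hnonneg 8]
  calc Real.log (Real.cosh s) - Real.log (Real.cosh s - 1)
      = Real.log (Real.cosh s / (Real.cosh s - 1)) := (Real.log_div hcosh.ne' hsub.ne').symm
    _ ≤ Real.log ((1 + 5 / 4 * singularWeight s ^ 2) ^ 4) :=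
        Real.log_le_log (by positivity) (hratio.trans hpow)
    _ = 4 * Real.log (1 + 5 / 4 * singularWeight s ^ 2) := by
        rw [Real.log_pow, Nat.cast_ofNat]
    _ ≤ 4 * (5 / 4 * singularWeight s ^ 2) := by
        gcongr
        rw [add_comm]
        exact (Real.log_le_sub_one_of_pos (by positivity)).trans_eq (add_sub_cancel_right _ _)
    _ = _ := by ring

theorem log_cylinderChord_cylinderRefl_le {a : ℝ} (p : ℝ × ℝ) {q : ℝ × ℝ} (hq : a ≤ q.1) :
    Real.log (cylinderChord (cylinderRefl a p) q) ≤
      1 + 2 * (q.1 - a) + Real.log (Real.cosh (p.1 - q.1)) := by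
  have hcosh := Real.cosh_pos (p.1 - q.1)
  have hreflect : Real.cosh ((cylinderRefl a p).1 - q.1) =
      Real.cosh (p.1 - q.1 + 2 * (q.1 - a)) := by
    rw [← Real.cosh_neg, cylinderRefl]
    ring_nf
  have hle : cylinderChord (cylinderRefl a p) q ≤
      2 * (Real.exp (2 * (q.1 - a)) * Real.cosh (p.1 - q.1)) := by
    have hcos := Real.neg_one_le_cos ((cylinderRefl a p).2 - q.2)
    rw [cylinderChord, hreflect]
    linarith [cosh_add_le (p.1 - q.1) (b := 2 * (q.1 - a)) (by linarith),
      Real.one_le_cosh (p.1 - q.1 + 2 * (q.1 - a))]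
  rcases (cylinderChord_nonneg (cylinderRefl a p) q).eq_or_lt with hzero | hpos
  · rw [← hzero, Real.log_zero]
    linarith [Real.log_nonneg (Real.one_le_cosh (p.1 - q.1))]
  · refine (Real.log_le_log hpos hle).trans ?_
    rw [Real.log_mul two_ne_zero (by positivity), Real.log_mul (Real.exp_pos _).ne' hcosh.ne',
      Real.log_exp]
    linarith [Real.log_two_lt_d9]

theorem reflectedKernel_le {a : ℝ} {p q : ℝ × ℝ} (hq : a ≤ q.1) (hne : q.1 ≠ p.1) :
    reflectedKernel a p q ≤ 1 + 2 * (q.1 - a) + 5 * singularWeight (p.1 - q.1) ^ 2 := by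
  have hs : p.1 - q.1 ≠ 0 := sub_ne_zero.mpr hne.symm
  have hlog : Real.log (Real.cosh (p.1 - q.1) - 1) ≤ Real.log (cylinderChord p q) :=
    Real.log_le_log (sub_pos.mpr (Real.one_lt_cosh.mpr hs)) (cosh_sub_one_le_cylinderChord p q)
  unfold reflectedKernel
  linarith [log_cylinderChord_cylinderRefl_le p hq, log_cosh_sub_log_cosh_sub_one_le hs]

theorem sq_le_mul_pow_three_add {x ε : ℝ} (hx : 0 ≤ x) (hε : 0 < ε) :
    x ^ 2 ≤ ε * x ^ 3 + 1 / ε ^ 2 := by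
  rcases le_total (ε * x) 1 with hle | hge
  · have hsq : x ^ 2 ≤ 1 / ε ^ 2 := by
      rw [le_div_iff₀ (by positivity), mul_comm, ← mul_pow]
      exact pow_le_one₀ (by positivity) hle
    have : 0 ≤ ε * x ^ 3 := by positivity
    linarith
  · have hcube : x ^ 2 ≤ ε * x ^ 3 :=
      calc x ^ 2 ≤ (ε * x) * x ^ 2 := le_mul_of_one_le_left (sq_nonneg x) hge
        _ = ε * x ^ 3 := by ring
    have : 0 ≤ 1 / ε ^ 2 := by positivity
    linarith

theorem reflectedKernel_le_mul_exp {a ε : ℝ} (ha : 0 ≤ a) (hε : 0 < ε) {p q : ℝ × ℝ}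
    (hq : a ≤ q.1) (hne : q.1 ≠ p.1) : reflectedKernel a p q ≤
      (2 + 5 / ε ^ 2 + 5 * ε * singularWeight (p.1 - q.1) ^ 3) * Real.exp q.1 := by
  have hnonneg := singularWeight_nonneg (p.1 - q.1)
  have hyoung : 5 * singularWeight (p.1 - q.1) ^ 2 ≤
      5 / ε ^ 2 + 5 * ε * singularWeight (p.1 - q.1) ^ 3 := by
    rw [div_eq_mul_one_div]
    linarith [sq_le_mul_pow_three_add hnonneg hε]
  have hexp : 5 / ε ^ 2 + 5 * ε * singularWeight (p.1 - q.1) ^ 3 ≤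
      (5 / ε ^ 2 + 5 * ε * singularWeight (p.1 - q.1) ^ 3) * Real.exp q.1 :=
    le_mul_of_one_le_right (by positivity) (Real.one_le_exp (ha.trans hq))
  linarith [reflectedKernel_le hq hne, Real.add_one_le_exp q.1]

/-- The cube of `singularWeight`, cut off away from its singularity. -/
def localSingularWeight : ℝ → ℝ := (Ioc (-1) 1).indicator fun s => singularWeight s ^ 3

theorem localSingularWeight_nonneg (s : ℝ) : 0 ≤ localSingularWeight s :=
  indicator_nonneg (fun s _ => pow_nonneg (singularWeight_nonneg s) 3) s

theorem integrable_localSingularWeight : Integrable localSingularWeight := by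
  rw [localSingularWeight, integrable_indicator_iff measurableSet_Ioc]
  have hcpow := (intervalIntegral.intervalIntegrable_cpow' (a := -1) (b := 1)
    (r := ((-(3 / 4) : ℝ) : ℂ)) (by rw [Complex.ofReal_re]; norm_num)).norm
  rw [intervalIntegrable_iff_integrableOn_Ioc_of_le (by norm_num)] at hcpow
  refine hcpow.congr_fun (fun s _ => ?_) measurableSet_Ioc
  dsimp only
  rw [Complex.norm_cpow_real, Complex.norm_real, Real.norm_eq_abs, singularWeight_pow_three]

theorem singularWeight_pow_three_le (s : ℝ) :
    singularWeight s ^ 3 ≤ localSingularWeight s + 1 := by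
  by_cases hs : s ∈ Ioc (-1 : ℝ) 1
  · rw [localSingularWeight, indicator_of_mem hs]
    linarith
  · rw [localSingularWeight, indicator_of_notMem hs, zero_add, singularWeight_pow_three]
    refine Real.rpow_le_one_of_one_le_of_nonpos ?_ (by norm_num)
    by_contra! hlt
    exact hs ⟨(abs_lt.mp hlt).1, (abs_lt.mp hlt).2.le⟩

theorem singularWeight_pow_three_mul_exp_le (t s : ℝ) :
    singularWeight (t - s) ^ 3 * Real.exp (-|s|) ≤
      localSingularWeight (t - s) + Real.exp (-|s|) :=
  calc singularWeight (t - s) ^ 3 * Real.exp (-|s|)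
      ≤ (localSingularWeight (t - s) + 1) * Real.exp (-|s|) := by
        gcongr
        exact singularWeight_pow_three_le _
    _ = localSingularWeight (t - s) * Real.exp (-|s|) + Real.exp (-|s|) := by ring
    _ ≤ _ := by
        gcongr
        exact mul_le_of_le_one_right (localSingularWeight_nonneg _)
          (Real.exp_le_one_iff.mpr (neg_nonpos.mpr (abs_nonneg s)))

theorem integrable_localSingularWeight_add_exp (t : ℝ) :
    Integrable fun s : ℝ => localSingularWeight (t - s) + Real.exp (-|s|) :=
  (integrable_localSingularWeight.comp_sub_left t).add integrable_exp_neg_abs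

theorem integrable_singularWeight_pow_three_mul_exp (t : ℝ) :
    Integrable fun s : ℝ => singularWeight (t - s) ^ 3 * Real.exp (-|s|) := by
  have := measurable_singularWeight
  refine (integrable_localSingularWeight_add_exp t).mono'
    (Measurable.aestronglyMeasurable (by fun_prop)) (.of_forall fun s => ?_)
  rw [Real.norm_of_nonneg
    (mul_nonneg (pow_nonneg (singularWeight_nonneg _) 3) (Real.exp_pos _).le)]
  exact singularWeight_pow_three_mul_exp_le t s

theorem integral_singularWeight_pow_three_mul_exp_le (t : ℝ) :
    ∫ s, singularWeight (t - s) ^ 3 * Real.exp (-|s|) ≤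
      (∫ s, localSingularWeight s) + ∫ s : ℝ, Real.exp (-|s|) := by
  refine (integral_mono (integrable_singularWeight_pow_three_mul_exp t)
    (integrable_localSingularWeight_add_exp t)
    (singularWeight_pow_three_mul_exp_le t)).trans_eq ?_
  rw [integral_add (integrable_localSingularWeight.comp_sub_left t) integrable_exp_neg_abs,
    integral_sub_left_eq_self localSingularWeight volume t]

theorem integrable_singularWeight_pow_three_mul_exp_fst (t : ℝ) :
    Integrable (fun q : ℝ × ℝ => singularWeight (t - q.1) ^ 3 * Real.exp (-|q.1|)) cylinderVol :=
  integrable_cylinderVol_fst (integrable_singularWeight_pow_three_mul_exp t)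

theorem exists_integral_singularWeight_le : ∃ C : ℝ, 0 < C ∧ ∀ t : ℝ,
    ∫ q, singularWeight (t - q.1) ^ 3 * Real.exp (-|q.1|) ∂cylinderVol ≤ C := by
  have hnonneg : 0 ≤ (∫ s, localSingularWeight s) + ∫ s : ℝ, Real.exp (-|s|) :=
    add_nonneg (integral_nonneg localSingularWeight_nonneg)
      (integral_nonneg fun s => (Real.exp_pos _).le)
  refine ⟨2 * Real.pi * ((∫ s, localSingularWeight s) + ∫ s : ℝ, Real.exp (-|s|)) + 1,
    by positivity, fun t => ?_⟩
  rw [integral_cylinderVol_fst fun s => singularWeight (t - s) ^ 3 * Real.exp (-|s|)]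
  have := integral_singularWeight_pow_three_mul_exp_le t
  exact (by gcongr : _ ≤ _).trans (le_add_of_nonneg_right zero_le_one)

end SingularWeight

section MovingPlanes

/-- The conformal factor of the metric `exp (2 w) g₀` with respect to the flat cylinder. -/
def cylinderFactor (w : Sph 2 → ℝ) (p : ℝ × ℝ) : ℝ := w (mercator p) - Real.log (Real.cosh p.1)

theorem continuous_cylinderFactor {w : Sph 2 → ℝ} (hw : Continuous w) :
    Continuous (cylinderFactor w) :=
  (hw.comp continuous_mercator).sub
    ((Real.continuous_cosh.comp continuous_fst).log fun _ => (Real.cosh_pos _).ne')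

theorem exp_two_mul_cylinderFactor (w : Sph 2 → ℝ) (p : ℝ × ℝ) :
    Real.exp (2 * cylinderFactor w p) =
      (Real.cosh p.1 ^ 2)⁻¹ * Real.exp (2 * w (mercator p)) := by
  rw [cylinderFactor, mul_sub, Real.exp_sub, two_mul (Real.log _), Real.exp_add,
    Real.exp_log (Real.cosh_pos _), div_eq_inv_mul, sq]

theorem cylinderFactor_le (w : Sph 2 → ℝ) (p : ℝ × ℝ) :
    cylinderFactor w p ≤ w (mercator p) + Real.log 2 - |p.1| := by
  have habs : |p.1| ≤ Real.log 2 + Real.log (Real.cosh p.1) := by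
    rw [← Real.log_mul two_ne_zero (Real.cosh_pos _).ne',
      Real.le_log_iff_exp_le (mul_pos two_pos (Real.cosh_pos _))]
    exact exp_abs_le_two_mul_cosh p.1
  rw [cylinderFactor]
  linarith

theorem exp_two_mul_cylinderFactor_le {w : Sph 2 → ℝ} {M : ℝ}
    (hM : ∀ x, Real.exp (2 * w x) ≤ M) (p : ℝ × ℝ) :
    Real.exp (2 * cylinderFactor w p) ≤ 4 * M * Real.exp (-(2 * |p.1|)) :=
  calc Real.exp (2 * cylinderFactor w p)
      ≤ Real.exp (Real.log 2 + Real.log 2 + 2 * w (mercator p) + -(2 * |p.1|)) :=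
        Real.exp_le_exp.mpr (by linarith [cylinderFactor_le w p])
    _ = 4 * Real.exp (2 * w (mercator p)) * Real.exp (-(2 * |p.1|)) := by
        rw [Real.exp_add, Real.exp_add, Real.exp_add, Real.exp_log two_pos]
        norm_num
    _ ≤ _ := by
        gcongr
        exact hM _

theorem ae_of_forall_of_cylinderRefl {P : ℝ × ℝ → Prop} {a : ℝ} (t : ℝ)
    (hrefl : ∀ q, P (cylinderRefl a q) → P q) (h : ∀ q : ℝ × ℝ, a < q.1 → q.1 ≠ t → P q) :
    ∀ᵐ q ∂cylinderVol, P q := by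
  filter_upwards [ae_fst_ne t, ae_fst_ne (2 * a - t), ae_fst_ne a] with q ht ht' ha
  rcases ha.lt_or_gt with hlt | hgt
  · refine hrefl q (h _ (show a < 2 * a - q.1 by linarith) fun heq => ht' ?_)
    rw [← show 2 * a - q.1 = t from heq, sub_sub_cancel]
  · exact h q hgt ht

section Asymmetry

variable (w : Sph 2 → ℝ) (a : ℝ)

/-- The difference between the conformal factor and its reflection in the circle `t = a`. -/
def factorAsymmetry (p : ℝ × ℝ) : ℝ := cylinderFactor w p - cylinderFactor w (cylinderRefl a p)

/-- The difference between the area density `exp (2 * cylinderFactor w)` and its reflection in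
the circle `t = a`. -/
def densityAsymmetry (p : ℝ × ℝ) : ℝ :=
  Real.exp (2 * cylinderFactor w p) - Real.exp (2 * cylinderFactor w (cylinderRefl a p))

theorem densityAsymmetry_cylinderRefl (p : ℝ × ℝ) :
    densityAsymmetry w a (cylinderRefl a p) = -densityAsymmetry w a p := by
  rw [densityAsymmetry, densityAsymmetry, cylinderRefl_involutive, neg_sub]

theorem densityAsymmetry_le (p : ℝ × ℝ) :
    densityAsymmetry w a p ≤ 2 * factorAsymmetry w a p * Real.exp (2 * cylinderFactor w p) := by
  have hexp : Real.exp (2 * cylinderFactor w (cylinderRefl a p)) =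
      Real.exp (2 * cylinderFactor w p) * Real.exp (-(2 * factorAsymmetry w a p)) := by
    rw [← Real.exp_add, factorAsymmetry]
    ring_nf
  rw [densityAsymmetry, hexp]
  nlinarith [Real.one_sub_le_exp_neg (2 * factorAsymmetry w a p),
    Real.exp_pos (2 * cylinderFactor w p)]

variable {w a} in
theorem densityAsymmetry_nonpos_iff {p : ℝ × ℝ} :
    densityAsymmetry w a p ≤ 0 ↔ factorAsymmetry w a p ≤ 0 := by
  simp [densityAsymmetry, factorAsymmetry]

theorem reflectedKernel_mul_densityAsymmetry_cylinderRefl (p q : ℝ × ℝ) :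
    reflectedKernel a p (cylinderRefl a q) * densityAsymmetry w a (cylinderRefl a q) =
      reflectedKernel a p q * densityAsymmetry w a q := by
  rw [reflectedKernel_cylinderRefl, densityAsymmetry_cylinderRefl, neg_mul_neg]

end Asymmetry

section IntegralEquation

variable {w : Sph 2 → ℝ}

theorem integrable_exp_cylinderFactor (hw : Continuous w) :
    Integrable (fun p => Real.exp (2 * cylinderFactor w p)) cylinderVol := by
  have hexp : Continuous fun x => Real.exp (2 * w x) := by fun_prop
  simpa only [exp_two_mul_cylinderFactor] using
    (integrable_sphVol_two_iff hexp.measurable).mp (integrable_of_continuous hexp)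

theorem IsLiouville.integral_exp_cylinderFactor (hw : IsLiouville w) :
    ∫ p, Real.exp (2 * cylinderFactor w p) ∂cylinderVol = 4 * Real.pi := by
  have hcont := hw.continuous
  have hexp : Continuous fun x => Real.exp (2 * w x) := by fun_prop
  simp only [exp_two_mul_cylinderFactor, ← integral_sphVol_two hexp.measurable, hw.mass]

theorem measurable_log_chord_mul_exp (hw : Continuous w) (x : Sph 2) :
    Measurable fun y => Real.log (chord x y) * Real.exp (2 * w y) :=
  (measurable_chord measurable_const measurable_id).log.mul
    (by fun_prop : Continuous fun y => Real.exp (2 * w y)).measurable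

theorem integrable_log_chord_mul_exp (hw : Continuous w) (x : Sph 2) :
    Integrable (fun y => Real.log (chord x y) * Real.exp (2 * w y)) (sphVol 2) := by
  have hexp : Continuous fun y => Real.exp (2 * w y) := by fun_prop
  obtain ⟨B, hB⟩ := isCompact_univ.exists_bound_of_continuousOn hexp.continuousOn
  exact (integrable_log_chord (lintegral_chordKernel_ne_top x)).mul_bdd (c := B)
    hexp.aestronglyMeasurable (.of_forall fun y => hB y (mem_univ y))

theorem integrable_log_chord_mercator_mul_exp (hw : Continuous w) (x : Sph 2) :
    Integrable (fun q => Real.log (chord x (mercator q)) * Real.exp (2 * cylinderFactor w q))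
      cylinderVol := by
  refine ((integrable_sphVol_two_iff (measurable_log_chord_mul_exp hw x)).mp
    (integrable_log_chord_mul_exp hw x)).congr (.of_forall fun q => ?_)
  dsimp only
  rw [exp_two_mul_cylinderFactor, mul_left_comm]

theorem IsLiouville.cylinderFactor_eq (hw : IsLiouville w) : ∃ c, ∀ p,
    cylinderFactor w p = c - Real.log (Real.cosh p.1) - 1 / (4 * Real.pi) *
      ∫ q, Real.log (chord (mercator p) (mercator q)) *
        Real.exp (2 * cylinderFactor w q) ∂cylinderVol := by
  obtain ⟨c, hc⟩ := hw.eq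
  refine ⟨c, fun p => ?_⟩
  rw [cylinderFactor, hc, integral_sphVol_two (measurable_log_chord_mul_exp hw.continuous _)]
  simp only [exp_two_mul_cylinderFactor, mul_left_comm]
  ring

theorem ae_reflectedKernel_eq (a : ℝ) (p : ℝ × ℝ) : ∀ᵐ q ∂cylinderVol, reflectedKernel a p q =
    Real.log (chord (mercator (cylinderRefl a p)) (mercator q)) -
      Real.log (chord (mercator p) (mercator q)) +
        (Real.log (Real.cosh (cylinderRefl a p).1) - Real.log (Real.cosh p.1)) := by
  filter_upwards [ae_fst_ne p.1, ae_fst_ne (cylinderRefl a p).1] with q hp hp'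
  rw [log_chord_mercator hp, log_chord_mercator hp', reflectedKernel]
  ring

theorem ae_reflectedKernel_mul_exp_eq (a : ℝ) (p : ℝ × ℝ) :
    (fun q => reflectedKernel a p q * Real.exp (2 * cylinderFactor w q)) =ᵐ[cylinderVol]
      fun q => Real.log (chord (mercator (cylinderRefl a p)) (mercator q)) *
          Real.exp (2 * cylinderFactor w q) -
        Real.log (chord (mercator p) (mercator q)) * Real.exp (2 * cylinderFactor w q) +
          (Real.log (Real.cosh (cylinderRefl a p).1) - Real.log (Real.cosh p.1)) *
            Real.exp (2 * cylinderFactor w q) := by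
  filter_upwards [ae_reflectedKernel_eq a p] with q hq
  rw [hq]
  ring

theorem integrable_reflectedKernel_mul_exp (hw : Continuous w) (a : ℝ) (p : ℝ × ℝ) :
    Integrable (fun q => reflectedKernel a p q * Real.exp (2 * cylinderFactor w q))
      cylinderVol :=
  (((integrable_log_chord_mercator_mul_exp hw _).sub
    (integrable_log_chord_mercator_mul_exp hw _)).add
      ((integrable_exp_cylinderFactor hw).const_mul _)).congr
        (ae_reflectedKernel_mul_exp_eq a p).symm

theorem IsLiouville.integral_reflectedKernel_mul_exp (hw : IsLiouville w) (a : ℝ) (p : ℝ × ℝ) :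
    ∫ q, reflectedKernel a p q * Real.exp (2 * cylinderFactor w q) ∂cylinderVol =
      4 * Real.pi * factorAsymmetry w a p := by
  obtain ⟨c, hc⟩ := hw.cylinderFactor_eq
  have hlog := integrable_log_chord_mercator_mul_exp hw.continuous
  rw [integral_congr_ae (ae_reflectedKernel_mul_exp_eq a p),
    integral_add (by exact (hlog _).sub (hlog _))
      ((integrable_exp_cylinderFactor hw.continuous).const_mul _),
    integral_sub (hlog _) (hlog _), integral_const_mul, hw.integral_exp_cylinderFactor,
    factorAsymmetry, hc p, hc (cylinderRefl a p)]
  field_simp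
  ring

theorem reflectedKernel_mul_densityAsymmetry_eq (a : ℝ) (p q : ℝ × ℝ) :
    reflectedKernel a p q * densityAsymmetry w a q =
      reflectedKernel a p q * Real.exp (2 * cylinderFactor w q) +
        reflectedKernel a p (cylinderRefl a q) *
          Real.exp (2 * cylinderFactor w (cylinderRefl a q)) := by
  rw [reflectedKernel_cylinderRefl, densityAsymmetry]
  ring

theorem integrable_reflectedKernel_mul_densityAsymmetry (hw : Continuous w) (a : ℝ)
    (p : ℝ × ℝ) :
    Integrable (fun q => reflectedKernel a p q * densityAsymmetry w a q) cylinderVol := by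
  simp only [reflectedKernel_mul_densityAsymmetry_eq]
  have hint := integrable_reflectedKernel_mul_exp hw a p
  exact hint.add (integrable_cylinderRefl a hint)

theorem IsLiouville.integral_reflectedKernel_mul_densityAsymmetry (hw : IsLiouville w) (a : ℝ)
    (p : ℝ × ℝ) : ∫ q, reflectedKernel a p q * densityAsymmetry w a q ∂cylinderVol =
      8 * Real.pi * factorAsymmetry w a p := by
  have hint := integrable_reflectedKernel_mul_exp hw.continuous a p
  simp only [reflectedKernel_mul_densityAsymmetry_eq]
  rw [integral_add hint (integrable_cylinderRefl a hint), integral_cylinderRefl a fun q =>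
    reflectedKernel a p q * Real.exp (2 * cylinderFactor w q),
    hw.integral_reflectedKernel_mul_exp]
  ring

end IntegralEquation

section Excess

variable {w : Sph 2 → ℝ} {a : ℝ}

/-- The conformal factor beyond the circle `t = a` is dominated by its reflection. -/
def IsReflectionDominated (w : Sph 2 → ℝ) (a : ℝ) : Prop :=
  ∀ p : ℝ × ℝ, a ≤ p.1 → factorAsymmetry w a p ≤ 0

/-- The part of the half cylinder beyond `t = a` where the conformal factor exceeds its
reflection. -/
def excess (w : Sph 2 → ℝ) (a : ℝ) : Set (ℝ × ℝ) := {q | a < q.1 ∧ 0 < factorAsymmetry w a q}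

/-- The mass of the excess set for the finite measure with density `exp (-|t|)`. -/
def excessMass (w : Sph 2 → ℝ) (a : ℝ) : ℝ :=
  ∫ q, (excess w a).indicator (fun q => Real.exp (-|q.1|)) q ∂cylinderVol

theorem continuous_factorAsymmetry (hw : Continuous w) (a : ℝ) :
    Continuous (factorAsymmetry w a) :=
  (continuous_cylinderFactor hw).sub
    ((continuous_cylinderFactor hw).comp (continuous_cylinderRefl a))

theorem measurableSet_excess (hw : Continuous w) (a : ℝ) : MeasurableSet (excess w a) :=
  ((isOpen_lt continuous_const continuous_fst).inter
    (isOpen_lt continuous_const (continuous_factorAsymmetry hw a))).measurableSet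

theorem integrable_indicator_excess (hw : Continuous w) (a : ℝ) :
    Integrable ((excess w a).indicator fun q => Real.exp (-|q.1|)) cylinderVol :=
  integrable_exp_neg_abs_fst.indicator (measurableSet_excess hw a)

/-- A majorant of the integrand `reflectedKernel a p q * densityAsymmetry w a q` on the half
cylinder beyond `t = a`, per unit of the supremum of `factorAsymmetry w a`; here `t` is the first
coordinate of `p`. -/
def excessMajorant (w : Sph 2 → ℝ) (M ε a t : ℝ) (q : ℝ × ℝ) : ℝ :=
  8 * M * (2 + 5 / ε ^ 2) * (excess w a).indicator (fun q => Real.exp (-|q.1|)) q +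
    40 * M * ε * (singularWeight (t - q.1) ^ 3 * Real.exp (-|q.1|))

theorem integrable_excessMajorant (hw : Continuous w) (M ε a t : ℝ) :
    Integrable (excessMajorant w M ε a t) cylinderVol :=
  ((integrable_indicator_excess hw a).const_mul _).add
    ((integrable_singularWeight_pow_three_mul_exp_fst t).const_mul _)

theorem integral_excessMajorant (hw : Continuous w) (M ε a t : ℝ) :
    ∫ q, excessMajorant w M ε a t q ∂cylinderVol = 8 * M * (2 + 5 / ε ^ 2) * excessMass w a +
      40 * M * ε * ∫ q, singularWeight (t - q.1) ^ 3 * Real.exp (-|q.1|) ∂cylinderVol := by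
  unfold excessMajorant
  rw [integral_add ((integrable_indicator_excess hw a).const_mul _)
    ((integrable_singularWeight_pow_three_mul_exp_fst t).const_mul _), integral_const_mul,
    integral_const_mul, excessMass]

theorem excessMajorant_nonneg {M ε : ℝ} (hM : 0 ≤ M) (hε : 0 ≤ ε) (a t : ℝ) (q : ℝ × ℝ) :
    0 ≤ excessMajorant w M ε a t q := by
  have hindicator : 0 ≤ (excess w a).indicator (fun q => Real.exp (-|q.1|)) q :=
    indicator_nonneg (fun q _ => (Real.exp_pos _).le) q
  have hweight := singularWeight_nonneg (t - q.1)
  unfold excessMajorant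
  positivity

variable {M ε H : ℝ} (hM : ∀ x, Real.exp (2 * w x) ≤ M) (hε : 0 < ε) (ha : 0 ≤ a) (hH : 0 ≤ H)
  (hbound : ∀ p : ℝ × ℝ, a ≤ p.1 → factorAsymmetry w a p ≤ H) {p q : ℝ × ℝ} (hp : a ≤ p.1)
include hM hε ha hH hbound hp

theorem reflectedKernel_mul_densityAsymmetry_le (hq : a < q.1) (hne : q.1 ≠ p.1) :
    reflectedKernel a p q * densityAsymmetry w a q ≤ H * excessMajorant w M ε a p.1 q := by
  have hMpos : 0 < M := (Real.exp_pos _).trans_le (hM north)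
  have hkernel := reflectedKernel_nonneg hp hq.le hne
  rcases le_or_gt (factorAsymmetry w a q) 0 with hneg | hpos
  · exact (mul_nonpos_of_nonneg_of_nonpos hkernel (densityAsymmetry_nonpos_iff.mpr hneg)).trans
      (mul_nonneg hH (excessMajorant_nonneg hMpos.le hε.le a p.1 q))
  have hq0 : |q.1| = q.1 := abs_of_nonneg (ha.trans hq.le)
  have hweight := singularWeight_nonneg (p.1 - q.1)
  have hdensity : densityAsymmetry w a q ≤ 2 * H * (4 * M * Real.exp (-(2 * |q.1|))) :=
    (densityAsymmetry_le w a q).trans (by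
      gcongr
      · exact hbound q hq.le
      · exact exp_two_mul_cylinderFactor_le hM q)
  calc reflectedKernel a p q * densityAsymmetry w a q
      ≤ (2 + 5 / ε ^ 2 + 5 * ε * singularWeight (p.1 - q.1) ^ 3) * Real.exp q.1 *
          (2 * H * (4 * M * Real.exp (-(2 * |q.1|)))) :=
        mul_le_mul (reflectedKernel_le_mul_exp ha hε hq.le hne) hdensity
          (le_of_not_gt fun hlt => hpos.not_ge (densityAsymmetry_nonpos_iff.mp hlt.le))
          (by positivity)
    _ = H * (8 * M * (2 + 5 / ε ^ 2) * (Real.exp q.1 * Real.exp (-(2 * q.1))) +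
          40 * M * ε * (singularWeight (p.1 - q.1) ^ 3 *
            (Real.exp q.1 * Real.exp (-(2 * q.1))))) := by
        rw [hq0]
        ring
    _ = H * excessMajorant w M ε a p.1 q := by
        rw [← Real.exp_add, show q.1 + -(2 * q.1) = -q.1 by ring, excessMajorant,
          indicator_of_mem (show q ∈ excess w a from ⟨hq, hpos⟩), hq0]

theorem IsLiouville.factorAsymmetry_le_half (hw : IsLiouville w)
    (hmajorant : ∫ q, excessMajorant w M ε a p.1 q ∂cylinderVol ≤ 2 * Real.pi) :
    factorAsymmetry w a p ≤ H / 2 := by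
  have hMpos : 0 < M := (Real.exp_pos _).trans_le (hM north)
  have hint := integrable_excessMajorant hw.continuous M ε a p.1
  have hnonneg := excessMajorant_nonneg (w := w) hMpos.le hε.le a p.1
  have hle : ∀ᵐ q ∂cylinderVol, reflectedKernel a p q * densityAsymmetry w a q ≤
      H * (excessMajorant w M ε a p.1 q + excessMajorant w M ε a p.1 (cylinderRefl a q)) := by
    refine ae_of_forall_of_cylinderRefl (a := a) p.1 (fun q hq => ?_) fun q hq hne => ?_
    · rwa [reflectedKernel_mul_densityAsymmetry_cylinderRefl, cylinderRefl_involutive,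
        add_comm] at hq
    · refine (reflectedKernel_mul_densityAsymmetry_le hM hε ha hH hbound hp hq hne).trans ?_
      gcongr
      exact le_add_of_nonneg_right (hnonneg _)
  have hintegral := integral_mono_ae
    (integrable_reflectedKernel_mul_densityAsymmetry hw.continuous a p)
    ((hint.add (integrable_cylinderRefl a hint)).const_mul H) hle
  simp only [Pi.add_apply] at hintegral
  rw [hw.integral_reflectedKernel_mul_densityAsymmetry, integral_const_mul,
    integral_add hint (integrable_cylinderRefl a hint), integral_cylinderRefl] at hintegral
  refine le_of_mul_le_mul_left ?_ (mul_pos (by norm_num : (0 : ℝ) < 8) Real.pi_pos)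
  nlinarith

end Excess

section SmallExcess

variable {w : Sph 2 → ℝ} {a : ℝ}

theorem factorAsymmetry_le_two_mul {B : ℝ} (hB : ∀ x, |w x| ≤ B) (ha : 0 ≤ a) {p : ℝ × ℝ}
    (hp : a ≤ p.1) : factorAsymmetry w a p ≤ 2 * B := by
  have hlog : Real.log (Real.cosh (cylinderRefl a p).1) ≤ Real.log (Real.cosh p.1) :=
    Real.log_le_log (Real.cosh_pos _) (Real.cosh_le_cosh.mpr (abs_le_abs
      (show 2 * a - p.1 ≤ p.1 by linarith) (show -(2 * a - p.1) ≤ p.1 by linarith)))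
  unfold factorAsymmetry cylinderFactor
  linarith [(abs_le.mp (hB (mercator p))).2, (abs_le.mp (hB (mercator (cylinderRefl a p)))).1]

/-- The supremum of `factorAsymmetry w a` beyond `t = a` is at most half of itself as soon as the
excess mass is small, so it vanishes. -/
theorem IsLiouville.exists_isReflectionDominated_of_excessMass_le (hw : IsLiouville w) :
    ∃ δ > 0, ∀ a, 0 ≤ a → excessMass w a ≤ δ → IsReflectionDominated w a := by
  have hcont := hw.continuous
  obtain ⟨B, hB⟩ := isCompact_univ.exists_bound_of_continuousOn hcont.continuousOn
  replace hB (x : Sph 2) : |w x| ≤ B := hB x (mem_univ x)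
  set M := Real.exp (2 * B)
  have hM (x : Sph 2) : Real.exp (2 * w x) ≤ M :=
    Real.exp_le_exp.mpr (by linarith [(abs_le.mp (hB x)).2])
  have hMpos : 0 < M := Real.exp_pos _
  have hBpos : 0 ≤ B := (abs_nonneg _).trans (hB north)
  obtain ⟨C, hCpos, hC⟩ := exists_integral_singularWeight_le
  set ε := Real.pi / (40 * M * C) with hε
  have hεpos : 0 < ε := by positivity
  set k := 8 * M * (2 + 5 / ε ^ 2)
  have hkpos : 0 < k := by positivity
  refine ⟨Real.pi / k, by positivity, fun a ha hsmall p hp => ?_⟩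
  have hmajorant (t : ℝ) : ∫ q, excessMajorant w M ε a t q ∂cylinderVol ≤ 2 * Real.pi :=
    calc ∫ q, excessMajorant w M ε a t q ∂cylinderVol
        ≤ k * (Real.pi / k) + 40 * M * ε * C := by
          rw [integral_excessMajorant hcont]
          gcongr
          exact hC t
      _ = 2 * Real.pi := by
          rw [mul_div_cancel₀ _ hkpos.ne', hε]
          field_simp
          norm_num
  have hiterate (n : ℕ) : ∀ p : ℝ × ℝ, a ≤ p.1 →
      factorAsymmetry w a p ≤ 2 * B * (1 / 2) ^ n := by
    induction n with
    | zero =>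
      intro p hp
      simpa using factorAsymmetry_le_two_mul hB ha hp
    | succ n ih =>
      intro p hp
      rw [pow_succ, ← mul_assoc, mul_one_div]
      exact hw.factorAsymmetry_le_half hM hεpos ha (by positivity) ih hp (hmajorant p.1)
  have hlimit := (tendsto_pow_atTop_nhds_zero_of_lt_one (r := (1 / 2 : ℝ)) (by norm_num)
    (by norm_num)).const_mul (2 * B)
  rw [mul_zero] at hlimit
  exact ge_of_tendsto' hlimit fun n => hiterate n p hp

end SmallExcess

end MovingPlanes

section EqualityCase

variable {w : Sph 2 → ℝ} {a : ℝ} {p : ℝ × ℝ}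

theorem IsReflectionDominated.ae_mul_densityAsymmetry_nonpos (h : IsReflectionDominated w a)
    (hp : a ≤ p.1) : ∀ᵐ q ∂cylinderVol, reflectedKernel a p q * densityAsymmetry w a q ≤ 0 := by
  refine ae_of_forall_of_cylinderRefl (a := a) p.1 (fun q hq => ?_) fun q hq hne => ?_
  · rwa [reflectedKernel_mul_densityAsymmetry_cylinderRefl] at hq
  · exact mul_nonpos_of_nonneg_of_nonpos (reflectedKernel_nonneg hp hq.le hne)
      (densityAsymmetry_nonpos_iff.mpr (h q hq.le))

theorem ae_reflectedKernel_ne_zero (hp : a < p.1) : ∀ᵐ q ∂cylinderVol, reflectedKernel a p q ≠ 0 :=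
  ae_of_forall_of_cylinderRefl (a := a) p.1
    (fun q hq => by rwa [reflectedKernel_cylinderRefl, neg_ne_zero] at hq)
    fun _ hq hne => (reflectedKernel_pos hp hq hne).ne'

theorem densityAsymmetry_eq_zero_iff : densityAsymmetry w a p = 0 ↔ factorAsymmetry w a p = 0 := by
  simp [densityAsymmetry, factorAsymmetry, sub_eq_zero]

theorem IsLiouville.ae_factorAsymmetry_eq_zero (hw : IsLiouville w)
    (h : IsReflectionDominated w a) (hp : a < p.1) (heq : factorAsymmetry w a p = 0) :
    ∀ᵐ q ∂cylinderVol, factorAsymmetry w a q = 0 := by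
  have hintegral := hw.integral_reflectedKernel_mul_densityAsymmetry a p
  rw [heq, mul_zero, ← neg_eq_zero, ← integral_neg, integral_eq_zero_iff_of_nonneg_ae
    ((h.ae_mul_densityAsymmetry_nonpos hp.le).mono fun q hq => neg_nonneg.mpr hq)
    (integrable_reflectedKernel_mul_densityAsymmetry hw.continuous a p).neg] at hintegral
  filter_upwards [hintegral, ae_reflectedKernel_ne_zero hp] with q hq hkernel
  exact densityAsymmetry_eq_zero_iff.mp
    ((mul_eq_zero.mp (neg_eq_zero.mp hq)).resolve_left hkernel)

theorem eq_zero_of_ae_eq_zero_cylinderVol {g : ℝ × ℝ → ℝ} (hg : Continuous g)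
    (h : ∀ᵐ q ∂cylinderVol, g q = 0) {q : ℝ × ℝ} (hq : q.2 ∈ Icc (-Real.pi) Real.pi) :
    g q = 0 := by
  have hvol : cylinderVol = volume.restrict (univ ×ˢ Ioo (-Real.pi) Real.pi) := by
    rw [Measure.volume_eq_prod, ← Measure.prod_restrict, Measure.restrict_univ, cylinderVol]
  rw [hvol] at h
  refine (Measure.eqOn_open_of_ae_eq h (isOpen_univ.prod isOpen_Ioo) hg.continuousOn
    continuousOn_const).closure hg continuous_const ?_
  rw [closure_prod_eq, closure_univ, closure_Ioo (by linarith [Real.pi_pos])]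
  exact ⟨mem_univ _, hq⟩

end EqualityCase

section EvenSolutions

variable {w : Sph 2 → ℝ} {a : ℝ}

theorem neg_mercator (t θ : ℝ) : -mercator (t, θ) = mercator (-t, θ + Real.pi) := by
  ext i
  rw [coe_mercator]
  change -(mercator (t, θ) : Ambient 2) i = _
  rw [coe_mercator]
  fin_cases i <;> simp [neg_div]

theorem cylinderFactor_neg_add_pi (heven : ∀ x, w (-x) = w x) (t θ : ℝ) :
    cylinderFactor w (-t, θ + Real.pi) = cylinderFactor w (t, θ) := by
  rw [cylinderFactor, cylinderFactor, ← neg_mercator, heven, Real.cosh_neg]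

theorem cylinderFactor_add_two_pi (w : Sph 2 → ℝ) (t θ : ℝ) :
    cylinderFactor w (t, θ + 2 * Real.pi) = cylinderFactor w (t, θ) := by
  have hmercator : mercator (t, θ + 2 * Real.pi) = mercator (t, θ) := by
    ext1
    rw [coe_mercator, coe_mercator, Real.cos_add_two_pi, Real.sin_add_two_pi]
  rw [cylinderFactor, cylinderFactor, hmercator]

/-- The antipodal map followed by the reflection is a glide reflection, whose square is the
translation by `4 * a`. -/
theorem cylinderFactor_add_four_mul (heven : ∀ x, w (-x) = w x)
    (hsymm : ∀ q : ℝ × ℝ, q.2 ∈ Icc (-Real.pi) Real.pi → factorAsymmetry w a q = 0) (t : ℝ) :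
    cylinderFactor w (t + 4 * a, 0) = cylinderFactor w (t, 0) :=
  have hpi := Real.pi_pos
  calc cylinderFactor w (t + 4 * a, 0)
      = cylinderFactor w (cylinderRefl a (t + 4 * a, 0)) :=
        sub_eq_zero.mp (hsymm _ ⟨by linarith, hpi.le⟩)
    _ = cylinderFactor w (t + 2 * a, Real.pi) := by
        rw [← cylinderFactor_neg_add_pi heven (t + 2 * a), ← cylinderFactor_add_two_pi,
          cylinderRefl]
        congr 2 <;> ring
    _ = cylinderFactor w (cylinderRefl a (t + 2 * a, Real.pi)) :=
        sub_eq_zero.mp (hsymm _ ⟨by linarith, le_rfl⟩)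
    _ = cylinderFactor w (t, 0) := by
        rw [← cylinderFactor_neg_add_pi heven t, cylinderRefl]
        congr 2 <;> ring

theorem not_forall_factorAsymmetry_eq_zero (hw : Continuous w) (heven : ∀ x, w (-x) = w x)
    (ha : 0 < a) :
    ¬ ∀ q : ℝ × ℝ, q.2 ∈ Icc (-Real.pi) Real.pi → factorAsymmetry w a q = 0 := by
  intro hsymm
  have hperiodic (n : ℕ) : cylinderFactor w (n * (4 * a), 0) = cylinderFactor w (0, 0) := by
    induction n with
    | zero => rw [Nat.cast_zero, zero_mul]
    | succ n ih => rw [Nat.cast_succ, add_one_mul, cylinderFactor_add_four_mul heven hsymm, ih]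
  obtain ⟨B, hB⟩ := isCompact_univ.exists_bound_of_continuousOn hw.continuousOn
  obtain ⟨n, hn⟩ :=
    exists_nat_gt ((B + Real.log 2 - cylinderFactor w (0, 0)) / (4 * a))
  rw [div_lt_iff₀ (by positivity)] at hn
  have hle := cylinderFactor_le w (n * (4 * a), 0)
  rw [hperiodic] at hle
  linarith [le_abs_self ((n : ℝ) * (4 * a)),
    (le_abs_self _).trans (hB (mercator (n * (4 * a), 0)) (mem_univ _))]

theorem IsLiouville.factorAsymmetry_lt_zero (hw : IsLiouville w) (heven : ∀ x, w (-x) = w x)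
    (ha : 0 < a) (h : IsReflectionDominated w a) {p : ℝ × ℝ} (hp : a < p.1) :
    factorAsymmetry w a p < 0 :=
  (h p hp.le).lt_of_ne fun heq => not_forall_factorAsymmetry_eq_zero hw.continuous heven ha
    fun _ => eq_zero_of_ae_eq_zero_cylinderVol (continuous_factorAsymmetry hw.continuous a)
      (hw.ae_factorAsymmetry_eq_zero h hp heq)

end EvenSolutions

section CriticalPosition

open Filter Topology

variable {w : Sph 2 → ℝ} {a : ℝ}

theorem tendsto_excessMass (hw : Continuous w) {l : Filter ℝ} [l.IsCountablyGenerated]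
    (h : ∀ᵐ q ∂cylinderVol, ∀ᶠ a in l, q ∉ excess w a) :
    Tendsto (excessMass w) l (𝓝 0) := by
  rw [← integral_zero (ℝ × ℝ) ℝ (μ := cylinderVol)]
  refine tendsto_integral_filter_of_dominated_convergence (fun q : ℝ × ℝ => Real.exp (-|q.1|))
    (.of_forall fun a => (integrable_indicator_excess hw a).aestronglyMeasurable)
    (.of_forall fun a => .of_forall fun q => ?_) integrable_exp_neg_abs_fst ?_
  · refine (norm_indicator_le_norm_self _ _).trans ?_
    rw [Real.norm_of_nonneg (Real.exp_pos _).le]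
  · filter_upwards [h] with q hq
    exact tendsto_const_nhds.congr' (hq.mono fun a ha => (indicator_of_notMem ha _).symm)

theorem IsLiouville.exists_isReflectionDominated (hw : IsLiouville w) :
    ∃ a, 0 ≤ a ∧ IsReflectionDominated w a := by
  obtain ⟨δ, hδ, hsmall⟩ := hw.exists_isReflectionDominated_of_excessMass_le
  have hlimit : Tendsto (excessMass w) atTop (𝓝 0) :=
    tendsto_excessMass hw.continuous <| .of_forall fun q =>
      (eventually_ge_atTop q.1).mono fun a ha hq => ha.not_gt hq.1
  obtain ⟨a, hmass, ha⟩ :=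
    ((hlimit.eventually (ge_mem_nhds hδ)).and (eventually_ge_atTop 0)).exists
  exact ⟨a, ha, hsmall a ha hmass⟩

theorem continuous_factorAsymmetry_left (hw : Continuous w) (q : ℝ × ℝ) :
    Continuous fun a => factorAsymmetry w a q :=
  continuous_const.sub ((continuous_cylinderFactor hw).comp (by unfold cylinderRefl; fun_prop))

theorem IsLiouville.tendsto_excessMass_nhdsLT (hw : IsLiouville w) (heven : ∀ x, w (-x) = w x)
    (ha : 0 < a) (h : IsReflectionDominated w a) : Tendsto (excessMass w) (𝓝[<] a) (𝓝 0) := by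
  refine tendsto_excessMass hw.continuous ?_
  filter_upwards [ae_fst_ne a] with q hq
  rcases hq.lt_or_gt with hlt | hgt
  · filter_upwards [nhdsWithin_le_nhds (lt_mem_nhds hlt)] with b hb hmem
    exact hb.not_gt hmem.1
  · filter_upwards [nhdsWithin_le_nhds ((continuous_factorAsymmetry_left hw.continuous q).tendsto
      a (gt_mem_nhds (hw.factorAsymmetry_lt_zero heven ha h hgt)))] with b hb hmem
    exact lt_asymm hb hmem.2

theorem IsLiouville.exists_isReflectionDominated_lt (hw : IsLiouville w)
    (heven : ∀ x, w (-x) = w x) (ha : 0 < a) (h : IsReflectionDominated w a) :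
    ∃ b, 0 ≤ b ∧ b < a ∧ IsReflectionDominated w b := by
  obtain ⟨δ, hδ, hsmall⟩ := hw.exists_isReflectionDominated_of_excessMass_le
  obtain ⟨b, ⟨hmass, hb⟩, hba⟩ :=
    (((hw.tendsto_excessMass_nhdsLT heven ha h).eventually (ge_mem_nhds hδ)).and
      (nhdsWithin_le_nhds (lt_mem_nhds ha))).and self_mem_nhdsWithin |>.exists
  exact ⟨b, hb.le, hba, hsmall b hb.le hmass⟩

theorem factorAsymmetry_fst_self (w : Sph 2 → ℝ) (p : ℝ × ℝ) : factorAsymmetry w p.1 p = 0 := by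
  rw [factorAsymmetry, cylinderRefl, two_mul, add_sub_cancel_right, sub_self]

theorem isReflectionDominated_iff_forall_min :
    IsReflectionDominated w a ↔ ∀ p : ℝ × ℝ, factorAsymmetry w (min a p.1) p ≤ 0 := by
  refine forall_congr' fun p => ⟨fun h => ?_, fun h hp => by rwa [min_eq_left hp] at h⟩
  rcases le_total a p.1 with hle | hge
  · rw [min_eq_left hle]
    exact h hle
  · rw [min_eq_right hge, factorAsymmetry_fst_self]

theorem isClosed_setOf_isReflectionDominated (hw : Continuous w) :
    IsClosed {a | IsReflectionDominated w a} := by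
  simp only [isReflectionDominated_iff_forall_min, ofPred_forall]
  exact isClosed_iInter fun p => isClosed_le
    ((continuous_factorAsymmetry_left hw p).comp (continuous_id.min continuous_const))
    continuous_const

theorem IsLiouville.isReflectionDominated_zero (hw : IsLiouville w)
    (heven : ∀ x, w (-x) = w x) : IsReflectionDominated w 0 := by
  set S := Ici (0 : ℝ) ∩ {a | IsReflectionDominated w a}
  have hbdd : BddBelow S := ⟨0, fun a ha => ha.1⟩
  obtain ⟨hnonneg, hdom⟩ : sInf S ∈ S :=
    (isClosed_Ici.inter (isClosed_setOf_isReflectionDominated hw.continuous)).csInf_mem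
      hw.exists_isReflectionDominated hbdd
  rcases (mem_Ici.mp hnonneg).eq_or_lt with hzero | hpos
  · rwa [hzero]
  · obtain ⟨b, hb, hlt, hb_dom⟩ := hw.exists_isReflectionDominated_lt heven hpos hdom
    exact absurd (csInf_le hbdd ⟨hb, hb_dom⟩) hlt.not_ge

theorem IsLiouville.cylinderFactor_neg_fst (hw : IsLiouville w) (heven : ∀ x, w (-x) = w x)
    (t θ : ℝ) : cylinderFactor w (-t, θ) = cylinderFactor w (t, θ) := by
  have hle (t θ : ℝ) (ht : 0 ≤ t) : cylinderFactor w (t, θ) ≤ cylinderFactor w (-t, θ) := by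
    simpa [factorAsymmetry, cylinderRefl] using hw.isReflectionDominated_zero heven (t, θ) ht
  have heq (t θ : ℝ) (ht : 0 ≤ t) : cylinderFactor w (-t, θ) = cylinderFactor w (t, θ) := by
    refine le_antisymm ?_ (hle t θ ht)
    have hantipode := hle t (θ + Real.pi) ht
    rwa [cylinderFactor_neg_add_pi heven, ← neg_neg t, cylinderFactor_neg_add_pi heven,
      neg_neg] at hantipode
  rcases le_total 0 t with ht | ht
  · exact heq t θ ht
  · rw [← heq (-t) θ (neg_nonneg.mpr ht), neg_neg]

end CriticalPosition

section Rigidity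

variable {w : Sph 2 → ℝ}

theorem IsLiouville.comp_sphMap (hw : IsLiouville w) (A : Ambient 2 ≃ₗᵢ[ℝ] Ambient 2) :
    IsLiouville fun x => w (sphMap A x) := by
  have hcont := hw.continuous
  obtain ⟨c, hc⟩ := hw.eq
  refine ⟨hcont.comp (continuous_sphMap A), ?_, c, fun x => ?_⟩
  · rw [← hw.mass, ← integral_sphMap A (g := fun x => Real.exp (2 * w x)) (by fun_prop)]
  · rw [hc, ← integral_sphMap A (measurable_log_chord_mul_exp hcont _)]
    simp only [chord_sphMap]

theorem sphMap_reflection_north_mercator (t θ : ℝ) :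
    sphMap (ℝ ∙ (north : Ambient 2))ᗮ.reflection (mercator (t, θ)) = mercator (-t, θ) := by
  ext i
  rw [coe_sphMap, Submodule.reflection_orthogonal_apply, Submodule.reflection_singleton_apply,
    coe_mercator, coe_mercator, north, EuclideanSpace.inner_single_left]
  fin_cases i <;> simp
  ring

theorem IsLiouville.sphMap_reflection_north (hw : IsLiouville w) (heven : ∀ x, w (-x) = w x)
    (x : Sph 2) : w (sphMap (ℝ ∙ (north : Ambient 2))ᗮ.reflection x) = w x := by
  have hrefl := hw.continuous.comp (continuous_sphMap (ℝ ∙ (north : Ambient 2))ᗮ.reflection)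
  refine congrFun (Measure.eq_of_ae_eq (μ := sphVol 2) ?_ hrefl hw.continuous) x
  rw [Filter.EventuallyEq, sphVol_two_eq, ae_map_iff continuous_mercator.measurable.aemeasurable
    (isClosed_eq hrefl hw.continuous).measurableSet]
  refine .of_forall fun p => ?_
  have hfactor := hw.cylinderFactor_neg_fst heven p.1 p.2
  rwa [cylinderFactor, cylinderFactor, Real.cosh_neg, sub_left_inj,
    ← sphMap_reflection_north_mercator] at hfactor

theorem IsLiouville.sphMap_reflection (hw : IsLiouville w) (heven : ∀ x, w (-x) = w x)
    (v x : Sph 2) : w (sphMap (ℝ ∙ (v : Ambient 2))ᗮ.reflection x) = w x := by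
  obtain ⟨A, rfl⟩ := exists_sphMap_eq north v
  have hrefl := (hw.comp_sphMap A).sphMap_reflection_north
    (fun y => by rw [sphMap_neg, heven]) (sphMap A.symm x)
  rw [sphMap_sphMap_symm] at hrefl
  have hinner : inner ℝ (A north) (x : Ambient 2) = inner ℝ (north : Ambient 2) (A.symm x) := by
    rw [← A.inner_map_map north, A.apply_symm_apply]
  rw [← hrefl]
  congr 1
  ext1
  simp [Submodule.reflection_orthogonal_apply, Submodule.reflection_singleton_apply, hinner]

/-- Every point is the mirror image of the north pole in a great circle. -/
theorem IsLiouville.eq_north (hw : IsLiouville w) (heven : ∀ x, w (-x) = w x) (x : Sph 2) :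
    w x = w north := by
  rcases eq_or_ne x north with rfl | hne
  · rfl
  have hsub : (x : Ambient 2) - north ≠ 0 := sub_ne_zero.mpr (Subtype.coe_injective.ne hne)
  set v : Sph 2 := ⟨‖(x : Ambient 2) - north‖⁻¹ • ((x : Ambient 2) - north), by
    simp [norm_smul, norm_ne_zero_iff.mpr hsub]⟩
  have hspan : ℝ ∙ (v : Ambient 2) = ℝ ∙ ((x : Ambient 2) - north) :=
    Submodule.span_singleton_smul_eq (inv_ne_zero (norm_ne_zero_iff.mpr hsub)).isUnit _
  rw [← hw.sphMap_reflection heven v x]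
  congr 1
  ext1
  simp only [coe_sphMap, hspan]
  exact Submodule.reflection_sub (by simp)

theorem HasConstantCurvature.measure_eq_zero {μ : SignedMeasure (Sph 2)} {f : RP 2 → ℝ≥0∞}
    (hK : HasConstantCurvature f μ) (hf : IsExpPotential f μ) (hμ : μ univ = 0) : μ = 0 := by
  obtain ⟨m, c, b, hfinite, hmass, hm, hfm⟩ := hK.exists_isLiouvilleMeasure hf hμ
  have hw := hm.isLiouville hmass
  refine hf.measure_eq_zero_of_ae_eq_const hμ
    (c := ENNReal.ofReal (Real.exp (liouvilleFactor c m north + b))) ?_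
  filter_upwards [hfm] with x hx
  rw [hx, hw.eq_north (neg_eq_of_ae_eq_exp hw.continuous hfm) x]

end Rigidity

end PuInequality

end

theorem mainTheorem2 :
    (∀ (n : ℕ), 1 ≤ n → ∀ f : RP n → ℝ≥0∞,
      MemLp f (n : ℝ≥0∞) (rpVol n) → sys f ≠ 0 →
      vol f / sys f ^ n ≥ vol (roundFactor n) / sys (roundFactor n) ^ n) ∧
    (∀ (μ : SignedMeasure (Sph 2)) (f : RP 2 → ℝ≥0∞),
      MemLp f 2 (rpVol 2) → sys f ≠ 0 →
      μ univ = 0 → IsExpPotential f μ →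
      (vol f / sys f ^ 2 = vol (roundFactor 2) / sys (roundFactor 2) ^ 2 ↔
        HasConstantCurvature f μ)) := by
  refine ⟨fun n hn f hf hsys => pu_inequality hn hf hsys, fun μ f hf hsys hμ hpot =>
    ⟨fun heq => ?_, fun hK => ?_⟩⟩
  · obtain ⟨c, hc⟩ := ae_eq_const_of_vol_div_sys_pow_eq le_rfl hf hsys heq
    obtain rfl := hpot.measure_eq_zero_of_ae_eq_const hμ hc
    rw [hpot.eq_roundFactor]
    exact hasConstantCurvature_roundFactor
  · obtain rfl := hK.measure_eq_zero hpot hμ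
    rw [hpot.eq_roundFactor]
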